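/- Let $L>0$, $T>0$, $u_0>0$, and let $a:[0,L]\to\mathbb R$ be a nonnegative measurable function such that $a(x)\le a_1$ for all $x\in[0,L]$ and $a(x)\ge a_0>0$ for all $x\in\omega$, where $\omega$ is a nonempty open subset of $(0,L)$. Let $\mathfrak{sat}:L^2(0,L)\to L^2(0,L)$ be either the localized saturation $\mathfrak{sat}(s)(x)=\max(-u_0,\min(u_0,s(x)))$ or the $L^2$ saturation, $\mathfrak{sat}(s)=s$ if $\|s\|_{L^2(0,L)}\le u_0$ and $\mathfrak{sat}(s)=u_0\,s/\|s\|_{L^2(0,L)}$ otherwise. Let $W(t)$ be the strongly continuous semigroup of contractions on $L^2(0,L)$ generated by $Aw=-w'-w'''$ with domain $D(A)=\{w\in H^3(0,L): w(0)=w(L)=w'(L)=0\}$. Then for every $y_0\in L^2(0,L)$ there exists a unique $y\in C([0,T];L^2(0,L))\cap L^2(0,T;H^1(0,L))$ that is a mild solution of $$y_t+y_x+y_{xxx}+yy_x+\mathfrak{sat}(ay)=0,\qquad y(t,0)=y(t,L)=y_x(t,L)=0,\qquad y(0,\cdot)=y_0,$$ that is, $yy_x$ and $\mathfrak{sat}(ay)$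 belong to $L^1(0,T;L^2(0,L))$ and $$y(t)=W(t)y_0-\int_0^t W(t-\tau)(yy_x)(\tau)\,d\tau-\int_0^t W(t-\tau)\,\mathfrak{sat}(ay(\tau))\,d\tau,\qquad t\in[0,T].$$ -/

import Mathlib

open MeasureTheory Set Filter Topology
open scoped ContDiff NNReal ENNReal

noncomputable section

namespace KdV

/-- Lebesgue measure on the interval `(0, L)`. -/
abbrev mu (L : ℝ) : Measure ℝ := volume.restrict (Ioo 0 L)

/-- The real Hilbert space `L²(0, L)`. -/
abbrev L2 (L : ℝ) : Type := Lp ℝ 2 (mu L)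

/-- `v ∈ L²(0, L)` is the weak derivative of `u ∈ L²(0, L)` on `(0, L)`. -/
def IsWeakDeriv (L : ℝ) (u v : L2 L) : Prop :=
  ∀ φ : ℝ → ℝ, ContDiff ℝ ∞ φ → HasCompactSupport φ → tsupport φ ⊆ Ioo 0 L →
    ∫ x in Ioo 0 L, u x * deriv φ x = - ∫ x in Ioo 0 L, v x * φ x

/-- The class `u` has a representative that is continuous on `[0, L]` and takes the value `c`
at `x`; for `u ∈ H¹(0, L)` and `x ∈ [0, L]` this says `u(x) = c`. -/
def HasTrace (L : ℝ) (u : L2 L) (x c : ℝ) : Prop :=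
  ∃ f : ℝ → ℝ, ContinuousOn f (Icc 0 L) ∧ u =ᵐ[mu L] f ∧ f x = c

/-- The graph of the operator `A w = -w' - w'''` with domain
`D(A) = {w ∈ H³(0, L) : w(0) = w(L) = w'(L) = 0}`: it says `w ∈ D(A)` and `A w = z`. -/
def OperatorGraph (L : ℝ) (w z : L2 L) : Prop :=
  ∃ w₁ w₂ w₃ : L2 L,
    IsWeakDeriv L w w₁ ∧ IsWeakDeriv L w₁ w₂ ∧ IsWeakDeriv L w₂ w₃ ∧
    HasTrace L w 0 0 ∧ HasTrace L w L 0 ∧ HasTrace L w₁ L 0 ∧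
    z = -w₁ - w₃

/-- `(W t)_{t ≥ 0}` is the strongly continuous semigroup of contractions on `L²(0, L)` whose
infinitesimal generator is the operator `A` (same domain and same values). The values `W t` for
`t < 0` are irrelevant. -/
structure IsSemigroupOfA (L : ℝ) (W : ℝ → L2 L →L[ℝ] L2 L) : Prop where
  map_zero : W 0 = ContinuousLinearMap.id ℝ (L2 L)
  map_add : ∀ s t : ℝ, 0 ≤ s → 0 ≤ t → W (s + t) = (W s).comp (W t)
  contraction : ∀ t : ℝ, 0 ≤ t → ‖W t‖ ≤ 1
  continuous_at_zero : ∀ u : L2 L, Tendsto (fun t => W t u) (𝓝[>] 0) (𝓝 u)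
  generator : ∀ w z : L2 L,
    Tendsto (fun h : ℝ => h⁻¹ • (W h w - w)) (𝓝[>] 0) (𝓝 z) ↔ OperatorGraph L w z

/-- The scalar saturation of level `u₀`. -/
def sat (u₀ s : ℝ) : ℝ :=
  if s ≤ -u₀ then -u₀ else if s ≤ u₀ then s else u₀

theorem sat_lipschitz {u₀ : ℝ} (hu : 0 < u₀) : LipschitzWith 1 (sat u₀) := by
  have h : sat u₀ = fun s => max (-u₀) (min u₀ s) := by
    funext s
    unfold sat
    split_ifs with h1 h2
    · rw [min_eq_right (by linarith), max_eq_left h1]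
    · rw [min_eq_right h2, max_eq_right (by linarith)]
    · rw [min_eq_left (by linarith), max_eq_right (by linarith)]
  rw [h]
  exact (LipschitzWith.id.const_min u₀).const_max (-u₀)

theorem sat_zero {u₀ : ℝ} (hu : 0 < u₀) : sat u₀ 0 = 0 := by
  unfold sat
  rw [if_neg (by linarith), if_pos hu.le]

/-- The localized saturation `s ↦ (x ↦ sat (s x))` on `L²(0, L)`. -/
def satLoc (L u₀ : ℝ) (hu : 0 < u₀) : L2 L → L2 L :=
  (sat_lipschitz hu).compLp (sat_zero hu)

/-- The saturation with respect to the norm of `L²(0, L)`. -/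
def satTwo (L u₀ : ℝ) (s : L2 L) : L2 L :=
  if ‖s‖ ≤ u₀ then s else (u₀ / ‖s‖) • s

/-- The gain `a` on `[0, L]`: a (measurable) nonnegative function, bounded by `a₁`, with
`0 < a₀ ≤ a` on the nonempty open set `Ω ⊆ (0, L)`. -/
structure GainCondition (L a₀ a₁ : ℝ) (Ω : Set ℝ) (a : ℝ → ℝ) : Prop where
  isOpen : IsOpen Ω
  nonempty : Ω.Nonempty
  subset : Ω ⊆ Ioo 0 L
  pos : 0 < a₀
  lower : ∀ x ∈ Ω, a₀ ≤ a x
  nonneg : ∀ x ∈ Icc 0 L, 0 ≤ a x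
  upper : ∀ x ∈ Icc 0 L, a x ≤ a₁
  measurable : AEMeasurable a (mu L)

/-- `y ∈ L²(0, T; H¹(0, L))`: both `y` and its weak space derivative are (Bochner) square
integrable with values in `L²(0, L)`. -/
def MemL2H1 (L T : ℝ) (y : ℝ → L2 L) : Prop :=
  MemLp y 2 (volume.restrict (Ioo 0 T)) ∧
  ∃ yx : ℝ → L2 L, MemLp yx 2 (volume.restrict (Ioo 0 T)) ∧
    ∀ᵐ t ∂(volume.restrict (Ioo 0 T)), IsWeakDeriv L (y t) (yx t)

/-- `y ∈ C([0, T]; L²(0, L)) ∩ L²(0, T; H¹(0, L))`. -/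
def MemB (L T : ℝ) (y : ℝ → L2 L) : Prop :=
  ContinuousOn y (Icc 0 T) ∧ MemL2H1 L T y

/-- `p ∈ L²(0, L)` is the function `u u_x`, where `u_x` is the weak derivative of `u`. -/
def IsConvection (L : ℝ) (u p : L2 L) : Prop :=
  ∃ ux : L2 L, IsWeakDeriv L u ux ∧ p =ᵐ[mu L] fun x => u x * ux x

/-- `f ∈ L²(0, L)` is the saturated feedback `𝔰𝔞𝔱(a u)`. -/
def IsFeedback (L : ℝ) (𝔰 : L2 L → L2 L) (a : ℝ → ℝ) (u f : L2 L) : Prop :=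
  ∃ m : L2 L, (m =ᵐ[mu L] fun x => a x * u x) ∧ f = 𝔰 m

/-- `y` is a mild solution on `[0, T]` of
`y_t + y_x + y_xxx + y y_x + 𝔰𝔞𝔱(a y) = 0`, `y(t,0) = y(t,L) = y_x(t,L) = 0`, `y(0,·) = y₀`:
with `p(t) = y(t) y_x(t)` and `f(t) = 𝔰𝔞𝔱(a y(t))`, both in `L¹(0, T; L²(0, L))`, the variation of
constants formula for the semigroup generated by `A` holds. -/
def IsMildSolution (L T : ℝ) (𝔰 : L2 L → L2 L) (a : ℝ → ℝ) (y₀ : L2 L) (y : ℝ → L2 L) : Prop :=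
  ∃ W : ℝ → L2 L →L[ℝ] L2 L, IsSemigroupOfA L W ∧
  ∃ p f : ℝ → L2 L,
    IntegrableOn p (Ioo 0 T) ∧ IntegrableOn f (Ioo 0 T) ∧
    (∀ᵐ t ∂(volume.restrict (Ioo 0 T)), IsConvection L (y t) (p t)) ∧
    (∀ᵐ t ∂(volume.restrict (Ioo 0 T)), IsFeedback L 𝔰 a (y t) (f t)) ∧
    ∀ t ∈ Icc 0 T,
      y t = W t y₀ - (∫ τ in (0 : ℝ)..t, W (t - τ) (p τ))
        - ∫ τ in (0 : ℝ)..t, W (t - τ) (f τ)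

end KdV

end

/-! ### The Volterra operator, multiplication by `x`, and their integration by parts identities. -/

noncomputable section

namespace KdV

variable {L : ℝ}

/-! Derivatives are handled through primitives. With `(V f)(x) = ∫_L^x f`, a function of `H¹(0, L)`
that vanishes at `L` is `V g` for its weak derivative `g`, and it vanishes at `0` exactly when `g`
has zero mean. Integration by parts becomes the statement that `V + V*` has rank one
(`inner_volterra_add`), and the weight `x` enters through `[x, V] = V²` (`mulX_volterra`). These two
identities give `⟨A w, w⟩ = -w'(0)²/2` and `⟨A w, x w⟩ = ‖w‖²/2 - 3‖w'‖²/2`. They also make `V`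
quasinilpotent, so that `λ - A` is onto for `λ > 0` and the Hille–Yosida theorem produces the
semigroup.

For the linear problem with forcing `F ∈ L¹(0, T; L²)`, the resolvents `J_n` of `A` map a mild
solution to an absolutely continuous curve in `D(A)`. The energy and multiplier computations are
legitimate for `J_n y`, and they pass to the limit. The multiplier `x` then yields the Kato
smoothing effect `y ∈ L²(0, T; H¹)` (`exists_deriv_of_resolventSolution`).

For the nonlinear problem the unknown is the forcing `F = -(y y_x + 𝔰𝔞𝔱(a y))`. The inequality
`‖u‖_∞² ≤ 2‖u‖‖u'‖` together with smoothing bounds `u` in `L²(0, δ; L^∞)` with a factor `δ^{1/4}`,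
so the nonlinearity is a contraction on short intervals (`exists_local_forcing`). Since `∫ u² u' =
0` and `⟨u, 𝔰𝔞𝔱(a u)⟩ ≥ 0`, the norm of a solution never grows, and steps of one fixed length cover
`[0, T]` (`exists_forcing`). For uniqueness (`eqOn_of_nonlinear`), the difference of two solutions
is tested with the multiplier `1 + x`: the derivative terms are absorbed by smoothing, and
Gronwall's lemma concludes with a kernel that is integrable in time, the feedback being Lipschitz.
-/

lemma intervalIntegrable_coe [Fact (0 < L)] (f : L2 L) {x y : ℝ} (hx : x ∈ Icc 0 L)
    (hy : y ∈ Icc 0 L) : IntervalIntegrable f volume x y := by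
  have hL : (0 : ℝ) < L := Fact.out
  have h : IntervalIntegrable f volume 0 L := by
    rw [intervalIntegrable_iff_integrableOn_Ioo_of_le hL.le]
    exact (Lp.memLp f).integrable one_le_two
  refine h.mono_set ?_
  rw [uIcc_of_le hL.le]
  exact uIcc_subset_Icc hx hy

/-- The primitive of `f` that vanishes at `L`. -/
def prim (L : ℝ) (f : ℝ → ℝ) (x : ℝ) : ℝ := ∫ s in L..x, f s

lemma mu_Ioo_ae (L : ℝ) : ∀ᵐ x ∂(mu L), x ∈ Ioo 0 L := ae_restrict_mem measurableSet_Ioo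

/-- Integration by parts for primitives of integrable functions. -/
lemma integral_prim_mul_add {f g : ℝ → ℝ} {x : ℝ} (hf : IntervalIntegrable f volume L x)
    (hg : IntervalIntegrable g volume L x) :
    ∫ s in L..x, (f s * prim L g s + prim L f s * g s) = prim L f x * prim L g x := by
  have hfa := hf.absolutelyContinuousOnInterval_intervalIntegral (c := L) left_mem_uIcc
  have hga := hg.absolutelyContinuousOnInterval_intervalIntegral (c := L) left_mem_uIcc
  have h := hfa.integral_deriv_mul_eq_sub hga
  simp only [intervalIntegral.integral_same, mul_zero, sub_zero] at h
  rw [prim, prim, ← h]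
  apply intervalIntegral.integral_congr_ae
  filter_upwards [hf.ae_hasDerivAt_integral, hg.ae_hasDerivAt_integral] with s h1 h2 hs
  have hs' := uIoc_subset_uIcc hs
  rw [(h1 hs' L left_mem_uIcc).deriv, (h2 hs' L left_mem_uIcc).deriv]
  rfl

lemma continuousOn_prim [Fact (0 < L)] (f : L2 L) : ContinuousOn (prim L f) (Icc 0 L) := by
  have hL : (0 : ℝ) < L := Fact.out
  have h := (intervalIntegrable_coe f (left_mem_Icc.2 hL.le) (right_mem_Icc.2 hL.le)
    ).absolutelyContinuousOnInterval_intervalIntegral (c := L) right_mem_uIcc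
  have := h.continuousOn
  rwa [uIcc_of_le hL.le] at this

/-- The constant function `1`. -/
def one (L : ℝ) : L2 L := indicatorConstLp 2 MeasurableSet.univ (measure_ne_top _ _) 1

lemma coeFn_one (L : ℝ) : one L =ᵐ[mu L] fun _ => 1 := by
  filter_upwards [indicatorConstLp_coeFn (μ := mu L) (p := 2) (s := univ) (hs := MeasurableSet.univ)
    (hμs := measure_ne_top _ _) (c := (1 : ℝ))] with x hx
  rw [one, hx, indicator_univ]

lemma inner_eq_integral (f g : L2 L) : inner ℝ f g = ∫ x, f x * g x ∂(mu L) := by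
  rw [L2.inner_def]
  refine integral_congr_ae (Eventually.of_forall fun x => ?_)
  simp [mul_comm]

lemma inner_eq_interval [Fact (0 < L)] (f g : L2 L) :
    inner ℝ f g = ∫ x in (0 : ℝ)..L, f x * g x := by
  have hL : (0 : ℝ) < L := Fact.out
  rw [inner_eq_integral, intervalIntegral.integral_of_le hL.le, integral_Ioc_eq_integral_Ioo]

lemma ae_mu_iff_interval [Fact (0 < L)] {P : ℝ → Prop} :
    (∀ᵐ x ∂(mu L), P x) ↔ ∀ᵐ x ∂volume, x ∈ Ioc 0 L → P x := by
  rw [mu, restrict_Ioo_eq_restrict_Ioc, ae_restrict_iff' measurableSet_Ioc]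

/-- Interval integrals inside `[0, L]` depend only on the class of the integrand. -/
lemma interval_congr [Fact (0 < L)] {f g : ℝ → ℝ} (h : f =ᵐ[mu L] g) {x y : ℝ}
    (hx : x ∈ Icc 0 L) (hy : y ∈ Icc 0 L) : ∫ s in x..y, f s = ∫ s in x..y, g s := by
  apply intervalIntegral.integral_congr_ae
  filter_upwards [ae_mu_iff_interval.1 h] with s hs hs'
  refine hs ?_
  rw [uIoc, mem_Ioc] at hs'
  exact ⟨(le_min hx.1 hy.1).trans_lt hs'.1, hs'.2.trans (max_le hx.2 hy.2)⟩

lemma prim_zero_eq [Fact (0 < L)] (f : L2 L) : prim L f 0 = -inner ℝ f (one L) := by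
  have hL : (0 : ℝ) < L := Fact.out
  rw [prim, inner_eq_interval, intervalIntegral.integral_symm]
  congr 1
  refine interval_congr ?_ (left_mem_Icc.2 hL.le) (right_mem_Icc.2 hL.le)
  filter_upwards [coeFn_one L] with x hx
  rw [hx, mul_one]

/-- Up to sign, the primitive at `x` is the inner product with the indicator of `(x, L]`, whose norm
is at most `√L`. -/
lemma abs_prim_le [Fact (0 < L)] (f : L2 L) {x : ℝ} (hx : x ∈ Icc 0 L) :
    |prim L f x| ≤ √L * ‖f‖ := by
  have hL : (0 : ℝ) < L := Fact.out
  have h1 : prim L f x = - inner ℝ (indicatorConstLp 2 (measurableSet_Ioc (a := x) (b := L))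
      (measure_ne_top (mu L) _) (1 : ℝ)) f := by
    rw [L2.inner_indicatorConstLp_one, prim, intervalIntegral.integral_symm,
      intervalIntegral.integral_of_le hx.2, integral_Ioc_eq_integral_Ioo,
      Measure.restrict_restrict measurableSet_Ioc]
    congr 3
    ext s
    simp only [mem_inter_iff, mem_Ioc, mem_Ioo]
    exact ⟨fun h => ⟨⟨h.1, h.2.le⟩, hx.1.trans_lt h.1, h.2⟩, fun h => ⟨h.1.1, h.2.2⟩⟩
  rw [h1, abs_neg]
  refine (abs_real_inner_le_norm _ _).trans ?_
  gcongr
  rw [norm_indicatorConstLp (by norm_num) (by norm_num)]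
  simp only [norm_one, one_mul, ENNReal.toReal_ofNat]
  rw [← Real.sqrt_eq_rpow]
  apply Real.sqrt_le_sqrt
  refine (measureReal_mono (subset_univ _)).trans ?_
  simp [measureReal_def, hL.le]

lemma memLp_prim [Fact (0 < L)] (f : L2 L) : MemLp (prim L f) ∞ (mu L) := by
  refine memLp_top_of_bound (C := √L * ‖f‖) ?_ ?_
  · exact ((continuousOn_prim f).mono Ioo_subset_Icc_self).aestronglyMeasurable measurableSet_Ioo
  · filter_upwards [mu_Ioo_ae L] with x hx
    exact abs_prim_le f (Ioo_subset_Icc_self hx)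

lemma prim_add [Fact (0 < L)] (f g : L2 L) {x : ℝ} (hx : x ∈ Icc 0 L) :
    prim L (f + g : L2 L) x = prim L f x + prim L g x := by
  have hL : (0 : ℝ) < L := Fact.out
  have hLm := right_mem_Icc.2 hL.le
  rw [prim, prim, prim, ← intervalIntegral.integral_add (intervalIntegrable_coe f hLm hx)
    (intervalIntegrable_coe g hLm hx)]
  exact interval_congr (Lp.coeFn_add f g) hLm hx

lemma prim_smul [Fact (0 < L)] (c : ℝ) (f : L2 L) {x : ℝ} (hx : x ∈ Icc 0 L) :
    prim L (c • f : L2 L) x = c * prim L f x := by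
  have hL : (0 : ℝ) < L := Fact.out
  have hLm := right_mem_Icc.2 hL.le
  rw [prim, prim, ← intervalIntegral.integral_const_mul]
  exact interval_congr (Lp.coeFn_smul c f) hLm hx

lemma norm_top_le {b : Lp ℝ ∞ (mu L)} {C : ℝ} (hC : 0 ≤ C) (h : ∀ᵐ x ∂(mu L), |b x| ≤ C) :
    ‖b‖ ≤ C := by
  have := Lp.norm_le_of_ae_bound (p := ∞) (f := b) hC h
  simpa using this

/-- The Volterra operator with values in `L^∞`. -/
def volterraTop (L : ℝ) [Fact (0 < L)] : L2 L →L[ℝ] Lp ℝ ∞ (mu L) :=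
  LinearMap.mkContinuous
    { toFun := fun f => (memLp_prim f).toLp
      map_add' := fun f g => by
        rw [← MemLp.toLp_add]
        apply MemLp.toLp_congr
        filter_upwards [mu_Ioo_ae L] with x hx
        exact prim_add f g (Ioo_subset_Icc_self hx)
      map_smul' := fun c f => by
        rw [← MemLp.toLp_const_smul]
        apply MemLp.toLp_congr
        filter_upwards [mu_Ioo_ae L] with x hx
        exact prim_smul c f (Ioo_subset_Icc_self hx) }
    (√L) (fun f => by
      refine norm_top_le (by positivity) ?_
      filter_upwards [(memLp_prim f).coeFn_toLp, mu_Ioo_ae L] with x hx hx'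
      simp only [LinearMap.coe_mk, AddHom.coe_mk, hx]
      exact abs_prim_le f (Ioo_subset_Icc_self hx'))

lemma coeFn_volterraTop [Fact (0 < L)] (f : L2 L) : volterraTop L f =ᵐ[mu L] prim L f :=
  (memLp_prim f).coeFn_toLp

/-- Multiplication of an `L^∞` function with an `L²` function, as a bilinear map. -/
def mulTop (L : ℝ) : Lp ℝ ∞ (mu L) →L[ℝ] L2 L →L[ℝ] L2 L :=
  (ContinuousLinearMap.mul ℝ ℝ).holderL (mu L) ∞ 2 2

lemma coeFn_mulTop (b : Lp ℝ ∞ (mu L)) (f : L2 L) : mulTop L b f =ᵐ[mu L] fun x => b x * f x :=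
  (ContinuousLinearMap.mul ℝ ℝ).coeFn_holder (r := 2) b f

lemma norm_mulTop_le (b : Lp ℝ ∞ (mu L)) (f : L2 L) : ‖mulTop L b f‖ ≤ ‖b‖ * ‖f‖ := by
  refine ((ContinuousLinearMap.mul ℝ ℝ).norm_holder_apply_apply_le (r := 2) b f).trans ?_
  simp

lemma inner_mulTop_left (b : Lp ℝ ∞ (mu L)) (f g : L2 L) :
    inner ℝ (mulTop L b f) g = inner ℝ f (mulTop L b g) := by
  rw [inner_eq_integral, inner_eq_integral]
  apply integral_congr_ae
  filter_upwards [coeFn_mulTop b f, coeFn_mulTop b g] with x h1 h2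
  rw [h1, h2]
  ring

/-- The Volterra operator `f ↦ (x ↦ ∫_L^x f)` on `L²(0, L)`. -/
def volterra (L : ℝ) [Fact (0 < L)] : L2 L →L[ℝ] L2 L :=
  -- Multiplying by the constant function `1` embeds `L^∞` into `L²`.
  ((mulTop L).flip (one L)).comp (volterraTop L)

lemma coeFn_volterra [Fact (0 < L)] (f : L2 L) : volterra L f =ᵐ[mu L] prim L f := by
  filter_upwards [coeFn_mulTop (volterraTop L f) (one L), coeFn_volterraTop f, coeFn_one L]
    with x h1 h2 h3
  change (mulTop L (volterraTop L f) (one L)) x = _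
  rw [h1, h2, h3, mul_one]

lemma memLp_id (L : ℝ) : MemLp (fun x : ℝ => x) ∞ (mu L) := by
  refine memLp_top_of_bound (C := |L|) (by fun_prop) ?_
  filter_upwards [mu_Ioo_ae L] with x hx
  rw [Real.norm_eq_abs, abs_of_pos hx.1]
  exact hx.2.le.trans (le_abs_self L)

/-- Multiplication by the coordinate `x` on `L²(0, L)`. -/
def mulX (L : ℝ) : L2 L →L[ℝ] L2 L := mulTop L (memLp_id L).toLp

lemma coeFn_mulX (f : L2 L) : mulX L f =ᵐ[mu L] fun x => x * f x := by
  filter_upwards [coeFn_mulTop (memLp_id L).toLp f, (memLp_id L).coeFn_toLp] with x h1 h2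
  rw [mulX, h1, h2]

lemma inner_mulX_left (f g : L2 L) : inner ℝ (mulX L f) g = inner ℝ f (mulX L g) :=
  inner_mulTop_left _ f g

lemma norm_mulX_le [Fact (0 < L)] (f : L2 L) : ‖mulX L f‖ ≤ L * ‖f‖ := by
  have hL : (0 : ℝ) < L := Fact.out
  refine (norm_mulTop_le _ f).trans ?_
  gcongr
  refine norm_top_le hL.le ?_
  filter_upwards [(memLp_id L).coeFn_toLp, mu_Ioo_ae L] with x h1 h2
  rw [h1, abs_of_pos h2.1]
  exact h2.2.le

lemma inner_mulX_nonneg (f : L2 L) : 0 ≤ inner ℝ (mulX L f) f := by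
  rw [inner_eq_integral]
  refine integral_nonneg_of_ae ?_
  filter_upwards [coeFn_mulX f, mu_Ioo_ae L] with x h1 h2
  rw [h1, Pi.zero_apply, mul_assoc]
  exact mul_nonneg h2.1.le (mul_self_nonneg _)

/-- Integration by parts for the primitives of `f` and `g`: both vanish at `L`, and their values at
`0` are `-⟨f, 1⟩` and `-⟨g, 1⟩`. When one of the means is zero, `V` acts as a skew operator. -/
lemma inner_volterra_add [Fact (0 < L)] (f g : L2 L) :
    inner ℝ (volterra L f) g + inner ℝ f (volterra L g) =
      -(inner ℝ f (one L) * inner ℝ g (one L)) := by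
  have hL : (0 : ℝ) < L := Fact.out
  have h0 := left_mem_Icc.2 hL.le
  have h1 := right_mem_Icc.2 hL.le
  have h := integral_prim_mul_add (intervalIntegrable_coe f h1 h0) (intervalIntegrable_coe g h1 h0)
  rw [prim_zero_eq, prim_zero_eq, intervalIntegral.integral_symm] at h
  have e : inner ℝ (volterra L f) g + inner ℝ f (volterra L g) =
      ∫ s in (0 : ℝ)..L, (f s * prim L g s + prim L f s * g s) := by
    rw [inner_eq_integral, inner_eq_integral, ← integral_add,
      intervalIntegral.integral_of_le hL.le, integral_Ioc_eq_integral_Ioo]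
    · apply integral_congr_ae
      filter_upwards [coeFn_volterra f, coeFn_volterra g] with x h1 h2
      rw [h1, h2]; ring
    · simpa [mul_comm] using L2.integrable_inner (𝕜 := ℝ) (volterra L f) g
    · simpa [mul_comm] using L2.integrable_inner (𝕜 := ℝ) f (volterra L g)
  rw [e]
  linarith

/-- A class is determined by a pointwise formula on `(0, L)` for its representatives. -/
lemma L2_ext {f g : L2 L} {F G : ℝ → ℝ} (hf : f =ᵐ[mu L] F) (hg : g =ᵐ[mu L] G)
    (h : ∀ x ∈ Ioo 0 L, F x = G x) : f = g := by
  apply Lp.ext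
  filter_upwards [hf, hg, mu_Ioo_ae L] with x h1 h2 h3
  rw [h1, h2, h x h3]

/-- Both sides vanish at `L` and have derivative `V f + x f`. This is the commutator relation `[x,
V] = V²`, the source of the multiplier identities and of the quasinilpotence of `V`. -/
lemma mulX_volterra [Fact (0 < L)] (f : L2 L) :
    mulX L (volterra L f) = volterra L (volterra L f) + volterra L (mulX L f) := by
  have hL : (0 : ℝ) < L := Fact.out
  have h1 := right_mem_Icc.2 hL.le
  refine L2_ext (F := fun x => x * prim L f x)
    (G := fun x => prim L (volterra L f) x + prim L (mulX L f) x) ?_ ?_ ?_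
  · filter_upwards [coeFn_mulX (volterra L f), coeFn_volterra f] with x h1 h2
    rw [h1, h2]
  · filter_upwards [Lp.coeFn_add (volterra L (volterra L f)) (volterra L (mulX L f)),
      coeFn_volterra (volterra L f), coeFn_volterra (mulX L f)] with x h1 h2 h3
    rw [h1, Pi.add_apply, h2, h3]
  · intro x hx
    have hx' := Ioo_subset_Icc_self hx
    -- The second factor is taken to be the primitive `x - L` of `1`; the extra terms with `L`
    -- cancel at the end.
    have h := integral_prim_mul_add (g := fun _ => (1 : ℝ)) (intervalIntegrable_coe f h1 hx')
      intervalIntegrable_const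
    have e : ∀ y, prim L (fun _ => (1 : ℝ)) y = y - L := fun y => by simp [prim]
    simp only [e, mul_one] at h
    have i1 := intervalIntegrable_coe (mulX L f) h1 hx'
    have i2 := intervalIntegrable_coe (volterra L f) h1 hx'
    have i3 := intervalIntegrable_coe f h1 hx'
    have e2 : ∫ s in L..x, (f s * (s - L) + prim L f s) =
        prim L (mulX L f) x - L * prim L f x + prim L (volterra L f) x := by
      rw [prim, prim, prim, ← intervalIntegral.integral_const_mul,
        ← intervalIntegral.integral_sub i1 (i3.const_mul L),
        ← intervalIntegral.integral_add (i1.sub (i3.const_mul L)) i2]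
      refine interval_congr ?_ h1 hx'
      filter_upwards [coeFn_mulX f, coeFn_volterra f] with s e1 e2
      rw [e1, e2]; ring
    rw [e2] at h
    linarith

lemma volterra_one [Fact (0 < L)] : volterra L (one L) = mulX L (one L) - L • one L := by
  have hL : (0 : ℝ) < L := Fact.out
  refine L2_ext (F := fun x => x - L) (G := fun x => x - L) ?_ ?_ (fun _ _ => rfl)
  · filter_upwards [coeFn_volterra (one L), mu_Ioo_ae L] with x h1 h2
    rw [h1, prim, interval_congr (coeFn_one L) (right_mem_Icc.2 hL.le) (Ioo_subset_Icc_self h2)]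
    simp
  · filter_upwards [Lp.coeFn_sub (mulX L (one L)) (L • one L), coeFn_mulX (one L),
      Lp.coeFn_smul L (one L), coeFn_one L] with x h1 h2 h3 h4
    rw [h1, Pi.sub_apply, h2, h3, Pi.smul_apply, h4]
    simp

lemma inner_one_one [Fact (0 < L)] : inner ℝ (one L) (one L) = L := by
  have hL : (0 : ℝ) < L := Fact.out
  rw [inner_eq_interval, interval_congr (g := fun _ => 1) _ (left_mem_Icc.2 hL.le)
    (right_mem_Icc.2 hL.le)]
  · simp
  · filter_upwards [coeFn_one L] with x hx
    rw [hx, mul_one]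

lemma one_ne_zero [Fact (0 < L)] : one L ≠ 0 := by
  have hL : (0 : ℝ) < L := Fact.out
  intro h
  have := inner_one_one (L := L)
  rw [h, inner_zero_left] at this
  exact hL.ne this

/-- `u u' = (u²/2)'` for `u = V f`, with `u(L) = 0`. -/
lemma prim_sq [Fact (0 < L)] (f : L2 L) {x : ℝ} (hx : x ∈ Icc 0 L) :
    prim L (mulTop L (volterraTop L f) f) x = 2⁻¹ * prim L f x ^ 2 := by
  have hL : (0 : ℝ) < L := Fact.out
  have h1 := right_mem_Icc.2 hL.le
  have h := integral_prim_mul_add (intervalIntegrable_coe f h1 hx) (intervalIntegrable_coe f h1 hx)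
  have e : ∫ s in L..x, (f s * prim L f s + prim L f s * f s) =
      2 * prim L (mulTop L (volterraTop L f) f) x := by
    rw [prim, ← intervalIntegral.integral_const_mul]
    refine interval_congr ?_ h1 hx
    filter_upwards [coeFn_mulTop (volterraTop L f) f, coeFn_volterraTop f] with s e1 e2
    rw [e1, e2]; ring
  rw [e] at h
  linear_combination 2⁻¹ * h

/-- `‖Vf‖_∞² ≤ 2 ‖Vf‖ ‖f‖`. -/
lemma norm_volterraTop_sq_le [Fact (0 < L)] (f : L2 L) :
    ‖volterraTop L f‖ ^ 2 ≤ 2 * ‖volterra L f‖ * ‖f‖ := by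
  have hL : (0 : ℝ) < L := Fact.out
  suffices h : ‖volterraTop L f‖ ≤ √(2 * ‖volterra L f‖ * ‖f‖) by
    have := pow_le_pow_left₀ (norm_nonneg _) h 2
    rwa [Real.sq_sqrt (by positivity)] at this
  refine norm_top_le (by positivity) ?_
  filter_upwards [coeFn_volterraTop f, mu_Ioo_ae L] with x hx hx'
  rw [hx]
  apply Real.abs_le_sqrt
  have h := prim_sq f (Ioo_subset_Icc_self hx')
  -- Agmon's argument: `u(x)²/2 = -∫_x^L u u'`, and this integral is at most `∫_0^L |u| |u'|`, to
  -- which Cauchy–Schwarz applies.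
  suffices |prim L (mulTop L (volterraTop L f) f) x| ≤ ‖volterra L f‖ * ‖f‖ by
    have := (le_abs_self _).trans this
    linarith
  rw [prim, intervalIntegral.integral_symm, abs_neg, intervalIntegral.integral_of_le hx'.2.le]
  have hi : Integrable (fun s => |volterra L f s| * |f s|) (mu L) := by
    have := (L2.integrable_inner (𝕜 := ℝ) (volterra L f) f).norm
    simpa [mul_comm] using this
  calc |∫ s in Ioc x L, (mulTop L (volterraTop L f) f) s|
      ≤ ∫ s in Ioc x L, |(mulTop L (volterraTop L f) f) s| := abs_integral_le_integral_abs
    _ ≤ ∫ s in Ioc 0 L, |(mulTop L (volterraTop L f) f) s| := by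
        refine setIntegral_mono_set ?_ (Eventually.of_forall fun _ => abs_nonneg _)
          (Ioc_subset_Ioc_left hx'.1.le).eventuallyLE
        rw [integrableOn_Ioc_iff_integrableOn_Ioo]
        exact ((Lp.memLp _).integrable one_le_two).abs
    _ = ∫ s, |volterra L f s| * |f s| ∂(mu L) := by
        rw [integral_Ioc_eq_integral_Ioo]
        apply integral_congr_ae
        filter_upwards [coeFn_mulTop (volterraTop L f) f, coeFn_volterraTop f, coeFn_volterra f]
          with s e1 e2 e3
        rw [e1, e2, e3, abs_mul]
    _ = inner ℝ |volterra L f| |f| := by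
        rw [inner_eq_integral]
        apply integral_congr_ae
        filter_upwards [Lp.coeFn_abs (volterra L f), Lp.coeFn_abs f] with s e1 e2
        rw [e1, e2]
    _ ≤ ‖(|volterra L f| : L2 L)‖ * ‖(|f| : L2 L)‖ := real_inner_le_norm _ _
    _ = _ := by rw [norm_abs_eq_norm, norm_abs_eq_norm]

lemma norm_volterraTop_le [Fact (0 < L)] (f : L2 L) : ‖volterraTop L f‖ ≤ √L * ‖f‖ :=
  (volterraTop L).le_of_opNorm_le (LinearMap.mkContinuous_norm_le _ (by positivity) _) f

/-- For `u = V f` this is `∫ u u' = -u(0)²/2`. -/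
lemma inner_volterra_self [Fact (0 < L)] (f : L2 L) :
    inner ℝ (volterra L f) f = -2⁻¹ * inner ℝ f (one L) ^ 2 := by
  have := inner_volterra_add f f
  rw [real_inner_comm (volterra L f) f] at this
  linarith

/-- `∫ u² u' = 0` for `u = Vg` vanishing at both ends. -/
lemma inner_convection_eq_zero [Fact (0 < L)] (g : L2 L) (hg : inner ℝ g (one L) = 0) :
    inner ℝ (mulTop L (volterraTop L g) g) (volterra L g) = 0 := by
  set h := mulTop L (volterraTop L g) g with hh
  have h1 := inner_volterra_add g h
  rw [hg, zero_mul, neg_zero] at h1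
  -- With `u = V g` and `h = u u'`, `V h = u²/2`, so `⟨g, V h⟩ = ⟨u g, u⟩/2 = ⟨h, V g⟩/2`. Skewness
  -- then reads `(3/2)⟨h, V g⟩ = 0`.
  have h2 : volterra L h = (2⁻¹ : ℝ) • mulTop L (volterraTop L g) (volterra L g) := by
    refine L2_ext (F := fun x => 2⁻¹ * prim L g x ^ 2) (G := fun x => 2⁻¹ * prim L g x ^ 2)
      ?_ ?_ (fun _ _ => rfl)
    · filter_upwards [coeFn_volterra h, mu_Ioo_ae L] with x e1 e2
      rw [e1, prim_sq g (Ioo_subset_Icc_self e2)]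
    · filter_upwards [Lp.coeFn_smul (2⁻¹ : ℝ) (mulTop L (volterraTop L g) (volterra L g)),
        coeFn_mulTop (volterraTop L g) (volterra L g), coeFn_volterraTop g, coeFn_volterra g]
        with x e1 e2 e3 e4
      rw [e1, Pi.smul_apply, e2, e3, e4, smul_eq_mul]; ring
  rw [h2, inner_smul_right, ← inner_mulTop_left _ g (volterra L g), ← hh,
    real_inner_comm h (volterra L g)] at h1
  linarith

end KdV
end

/-! ### Weak derivatives, traces and the graph of `A` in terms of `V`. -/

noncomputable section

namespace KdV

variable {L : ℝ}

lemma memLp_of_contDiff {n : ℕ∞} {φ : ℝ → ℝ} (hφ : ContDiff ℝ n φ) : MemLp φ 2 (mu L) := by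
  have hc : ContinuousOn φ (Icc 0 L) := hφ.continuous.continuousOn
  obtain ⟨C, hC⟩ := isCompact_Icc.exists_bound_of_continuousOn hc
  refine MemLp.of_bound hφ.continuous.aestronglyMeasurable C ?_
  filter_upwards [mu_Ioo_ae L] with x hx
  exact hC x (Ioo_subset_Icc_self hx)

lemma eq_zero_of_tsupport_subset {φ : ℝ → ℝ} (h : tsupport φ ⊆ Ioo 0 L) {x : ℝ}
    (hx : x ∉ Ioo 0 L) : φ x = 0 := image_eq_zero_of_notMem_tsupport fun hx' => hx (h hx')

/-- A test function satisfies `φ = V φ'` and `∫ φ' = 0`: the second fact removes the constant, and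
makes `V` skew when paired with `φ'`. -/
lemma isWeakDeriv_smul_one_add_volterra [Fact (0 < L)] (c : ℝ) (v : L2 L) :
    IsWeakDeriv L (c • one L + volterra L v) v := by
  have hL : (0 : ℝ) < L := Fact.out
  intro φ hφ _ hs
  have hd : ContDiff ℝ ∞ (deriv φ) := ((contDiff_infty_iff_deriv).1 hφ).2
  set ψ : L2 L := (memLp_of_contDiff hd).toLp with hψ
  have hψe : ψ =ᵐ[mu L] deriv φ := (memLp_of_contDiff hd).coeFn_toLp
  have hprim : ∀ x ∈ Icc 0 L, prim L ψ x = φ x := fun x hx => by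
    rw [prim, interval_congr hψe (right_mem_Icc.2 hL.le) hx,
      intervalIntegral.integral_deriv_eq_sub (fun y _ => hφ.differentiable (by simp) y)
        (hd.continuous.intervalIntegrable _ _),
      eq_zero_of_tsupport_subset hs (x := L) (fun h => lt_irrefl _ h.2), sub_zero]
  have h0 : inner ℝ ψ (one L) = 0 := by
    have := hprim 0 (left_mem_Icc.2 hL.le)
    rw [prim_zero_eq, eq_zero_of_tsupport_subset hs (x := 0) (fun h => lt_irrefl _ h.1)] at this
    linarith
  have h1 : ∫ x in Ioo 0 L, (c • one L + volterra L v : L2 L) x * deriv φ x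
      = inner ℝ (c • one L + volterra L v) ψ := by
    rw [inner_eq_integral]
    apply integral_congr_ae
    filter_upwards [hψe] with x hx
    rw [hx]
  have h2 : ∫ x in Ioo 0 L, v x * φ x = inner ℝ v (volterra L ψ) := by
    rw [inner_eq_integral]
    apply integral_congr_ae
    filter_upwards [coeFn_volterra ψ, mu_Ioo_ae L] with x hx hx'
    rw [hx, hprim x (Ioo_subset_Icc_self hx')]
  have h3 := inner_volterra_add v ψ
  rw [h0, mul_zero, neg_zero] at h3
  rw [h1, h2, inner_add_left, inner_smul_left, real_inner_comm, h0]
  simp only [mul_zero, zero_add]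
  linarith

lemma exists_Icc_superset (hL : 0 < L) {K : Set ℝ} (hK : IsCompact K) (h : K ⊆ Ioo 0 L) :
    ∃ a b, 0 < a ∧ b < L ∧ K ⊆ Icc a b := by
  rcases K.eq_empty_or_nonempty with rfl | hne
  · exact ⟨L / 2, L / 2, by linarith, by linarith, empty_subset _⟩
  · exact ⟨sInf K, sSup K, (h (hK.sInf_mem hne)).1, (h (hK.sSup_mem hne)).2, fun x hx =>
      ⟨csInf_le hK.bddBelow hx, le_csSup hK.bddAbove hx⟩⟩

/-- A test function of zero mean has a primitive that is a test function. -/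
lemma exists_test_primitive (hL : 0 < L) {χ : ℝ → ℝ} (hχ : ContDiff ℝ ∞ χ)
    (hc : HasCompactSupport χ) (hs : tsupport χ ⊆ Ioo 0 L) (h0 : ∫ x in (0 : ℝ)..L, χ x = 0) :
    ∃ φ : ℝ → ℝ, ContDiff ℝ ∞ φ ∧ HasCompactSupport φ ∧ tsupport φ ⊆ Ioo 0 L ∧ deriv φ = χ := by
  obtain ⟨a, b, ha, hb, hab⟩ := exists_Icc_superset hL hc hs
  have hder : ∀ x, HasDerivAt (fun x => ∫ s in (0 : ℝ)..x, χ s) (χ x) x := fun x =>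
    intervalIntegral.integral_hasDerivAt_right (hχ.continuous.intervalIntegrable _ _)
      (hχ.continuous.stronglyMeasurableAtFilter _ _) hχ.continuous.continuousAt
  have hzero : ∀ x, x ∉ Icc a b → χ x = 0 := fun x hx =>
    image_eq_zero_of_notMem_tsupport fun h => hx (hab h)
  have hsub : tsupport (fun x => ∫ s in (0 : ℝ)..x, χ s) ⊆ Icc a b := by
    refine closure_minimal (fun x hx => ?_) isClosed_Icc
    by_contra hxab
    apply hx
    rcases lt_or_ge x a with h | h
    -- Left of the support of `χ` the integrand vanishes; right of it, the integral over `(0, x)` is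
    -- the total integral, which is zero.
    · change ∫ s in (0 : ℝ)..x, χ s = 0
      rw [intervalIntegral.integral_congr (g := fun _ => 0), intervalIntegral.integral_zero]
      intro s hs
      exact hzero s fun h' => by
        have := hs.2
        rcases le_max_iff.1 this with h3 | h3 <;> linarith [h'.1]
    · have hbx : b < x := by
        by_contra hbx
        exact hxab ⟨h, not_lt.1 hbx⟩
      change ∫ s in (0 : ℝ)..x, χ s = 0
      rw [← intervalIntegral.integral_add_adjacent_intervals (b := L)
        (hχ.continuous.intervalIntegrable _ _) (hχ.continuous.intervalIntegrable _ _), h0, zero_add,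
        intervalIntegral.integral_congr (g := fun _ => 0), intervalIntegral.integral_zero]
      intro s hs
      exact hzero s fun h' => by
        have := hs.1
        rcases min_le_iff.1 this with h3 | h3 <;> linarith [h'.2]
  refine ⟨fun x => ∫ s in (0 : ℝ)..x, χ s, ?_, ?_, ?_, ?_⟩
  · rw [contDiff_infty_iff_deriv]
    exact ⟨fun x => (hder x).differentiableAt, by
      rw [show deriv (fun x => ∫ s in (0 : ℝ)..x, χ s) = χ from funext fun x => (hder x).deriv]
      exact hχ⟩
  · exact isCompact_Icc.of_isClosed_subset (isClosed_tsupport _) hsub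
  · exact hsub.trans fun x hx => ⟨ha.trans_le hx.1, hx.2.trans_lt hb⟩
  · exact funext fun x => (hder x).deriv

/-- The du Bois-Reymond lemma. Subtracting from a test function `ψ` the multiple `(∫ ψ) η` of a
normalized bump leaves a function of zero mean, hence the derivative of a test function, on which
`w` vanishes. So `w` acts on `ψ` as the constant `c = ∫ w η`. -/
lemma eq_smul_one_of_isWeakDeriv_zero [Fact (0 < L)] {w : L2 L} (h : IsWeakDeriv L w 0) :
    ∃ c : ℝ, w = c • one L := by
  have hL : (0 : ℝ) < L := Fact.out
  have hφ : ∀ φ : ℝ → ℝ, ContDiff ℝ ∞ φ → HasCompactSupport φ → tsupport φ ⊆ Ioo 0 L →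
      ∫ x in Ioo 0 L, w x * deriv φ x = 0 := fun φ h1 h2 h3 => by
    rw [h φ h1 h2 h3, neg_eq_zero]
    rw [integral_congr_ae (g := fun _ => (0 : ℝ)), integral_zero]
    filter_upwards [Lp.coeFn_zero ℝ 2 (mu L)] with x hx
    rw [hx, Pi.zero_apply, zero_mul]
  let η : ContDiffBump (L / 2) := ⟨L / 8, L / 4, by linarith, by linarith⟩
  have hηs : tsupport (η.normed volume) ⊆ Ioo 0 L := by
    rw [η.tsupport_normed_eq, Real.closedBall_eq_Icc]
    exact fun x hx => ⟨by have := hx.1; simp only [η] at this; linarith,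
      by have := hx.2; simp only [η] at this; linarith⟩
  have hηd : ContDiff ℝ ∞ (η.normed volume) := η.contDiff_normed
  have hηc : HasCompactSupport (η.normed volume) := η.hasCompactSupport_normed
  have hsupp : ∀ {χ : ℝ → ℝ}, tsupport χ ⊆ Ioo 0 L → ∀ f : ℝ → ℝ,
      ∫ x in Ioo 0 L, f x * χ x = ∫ x, χ x * f x := fun {χ} hχ f => by
    rw [← integral_indicator measurableSet_Ioo]
    congr 1
    funext x
    by_cases hx : x ∈ Ioo 0 L
    · rw [indicator_of_mem hx, mul_comm]
    · rw [indicator_of_notMem hx, eq_zero_of_tsupport_subset hχ hx, zero_mul]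
  set c := ∫ x in Ioo 0 L, w x * η.normed volume x with hc
  have hwi : ∀ {χ : ℝ → ℝ}, ContDiff ℝ ∞ χ → IntegrableOn (fun x => w x * χ x) (Ioo 0 L) :=
    fun {χ} hχ => by
      have := L2.integrable_inner (𝕜 := ℝ) w (memLp_of_contDiff (L := L) hχ).toLp
      refine this.congr ?_
      filter_upwards [(memLp_of_contDiff (L := L) hχ).coeFn_toLp] with x hx
      simp [hx, mul_comm]
  have key : ∀ᵐ x ∂volume, x ∈ Ioo 0 L → w x - c = 0 := by
    refine isOpen_Ioo.ae_eq_zero_of_integral_contDiff_smul_eq_zero ?_ ?_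
    · refine IntegrableOn.locallyIntegrableOn ?_
      exact ((Lp.memLp w).integrable one_le_two).sub (integrable_const _)
    · intro ψ hψ hψc hψs
      set I := ∫ x in (0 : ℝ)..L, ψ x with hI
      have hint : ∀ {χ : ℝ → ℝ}, tsupport χ ⊆ Ioo 0 L → ∫ x in (0 : ℝ)..L, χ x = ∫ x, χ x := by
        intro χ hχ
        have := hsupp hχ (fun _ => 1)
        simp only [one_mul, mul_one] at this
        rw [intervalIntegral.integral_of_le hL.le, integral_Ioc_eq_integral_Ioo, this]
      have hη1 : ∫ x in (0 : ℝ)..L, η.normed volume x = 1 := by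
        rw [hint hηs, η.integral_normed]
      set χ : ℝ → ℝ := fun x => ψ x - I * η.normed volume x with hχ
      have hχd : ContDiff ℝ ∞ χ := hψ.sub (contDiff_const.mul hηd)
      have hχsub : tsupport χ ⊆ tsupport ψ ∪ tsupport (η.normed volume) := by
        refine closure_minimal (fun x hx => ?_)
          ((isClosed_tsupport _).union (isClosed_tsupport _))
        by_contra hx'
        rw [mem_union, not_or] at hx'
        apply hx
        simp [hχ, image_eq_zero_of_notMem_tsupport hx'.1, image_eq_zero_of_notMem_tsupport hx'.2]
      have hχc : HasCompactSupport χ :=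
        (hψc.isCompact.union hηc.isCompact).of_isClosed_subset (isClosed_tsupport _) hχsub
      have hχs : tsupport χ ⊆ Ioo 0 L := hχsub.trans (union_subset hψs hηs)
      have hχ0 : ∫ x in (0 : ℝ)..L, χ x = 0 := by
        rw [hχ, intervalIntegral.integral_sub (hψ.continuous.intervalIntegrable _ _)
          ((contDiff_const.mul hηd).continuous.intervalIntegrable _ _),
          intervalIntegral.integral_const_mul, hη1, mul_one, hI, sub_self]
      obtain ⟨φ, h1, h2, h3, h4⟩ := exists_test_primitive hL hχd hχc hχs hχ0
      have h5 := hφ φ h1 h2 h3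
      rw [h4] at h5
      have h6 : ∫ x in Ioo 0 L, w x * χ x = (∫ x in Ioo 0 L, w x * ψ x) - I * c := by
        rw [hc, ← integral_const_mul, ← integral_sub (hwi hψ) ((hwi hηd).const_mul I)]
        congr 1; funext x; simp only [hχ]; ring
      have h7 : ∫ x, ψ x • (w x - c) = (∫ x in Ioo 0 L, w x * ψ x) - c * I := by
        rw [hI, intervalIntegral.integral_of_le hL.le, integral_Ioc_eq_integral_Ioo,
          ← integral_const_mul, ← integral_sub (hwi hψ)
            ((hψ.continuous.integrable_of_hasCompactSupport hψc).integrableOn.const_mul c)]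
        have := hsupp hψs (fun x => w x - c)
        simp only [smul_eq_mul]
        rw [← this]
        congr 1; funext x; ring
      rw [h7]
      linarith
  refine ⟨c, Lp.ext ?_⟩
  filter_upwards [(ae_restrict_iff' measurableSet_Ioo).2 key, Lp.coeFn_smul c (one L), coeFn_one L]
    with x h1 h2 h3
  rw [h2, Pi.smul_apply, h3, smul_eq_mul, mul_one]
  linarith

lemma IsWeakDeriv.sub {u v u' v' : L2 L} (h : IsWeakDeriv L u v) (h' : IsWeakDeriv L u' v') :
    IsWeakDeriv L (u - u') (v - v') := by
  intro φ hφ hc hs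
  have hi : ∀ (w : L2 L) {χ : ℝ → ℝ}, ContDiff ℝ ∞ χ →
      IntegrableOn (fun x => w x * χ x) (Ioo 0 L) := fun w {χ} hχ => by
    have := L2.integrable_inner (𝕜 := ℝ) w (memLp_of_contDiff (L := L) hχ).toLp
    refine this.congr ?_
    filter_upwards [(memLp_of_contDiff (L := L) hχ).coeFn_toLp] with x hx
    simp [hx, mul_comm]
  have hd : ContDiff ℝ ∞ (deriv φ) := ((contDiff_infty_iff_deriv).1 hφ).2
  have e : ∀ (a b : L2 L) {χ : ℝ → ℝ}, ContDiff ℝ ∞ χ →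
      ∫ x in Ioo 0 L, (a - b : L2 L) x * χ x =
        (∫ x in Ioo 0 L, a x * χ x) - ∫ x in Ioo 0 L, b x * χ x := fun a b {χ} hχ => by
    rw [← integral_sub (hi a hχ) (hi b hχ)]
    apply integral_congr_ae
    filter_upwards [Lp.coeFn_sub a b] with x hx
    rw [hx, Pi.sub_apply, sub_mul]
  rw [e u u' hd, e v v' hφ, h φ hφ hc hs, h' φ hφ hc hs]
  ring

/-- `H¹(0, L)` is the constants plus the range of `V`: subtracting `V v` from `u` leaves a function
of zero weak derivative. -/
lemma isWeakDeriv_iff [Fact (0 < L)] {u v : L2 L} :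
    IsWeakDeriv L u v ↔ ∃ c : ℝ, u = c • one L + volterra L v := by
  refine ⟨fun h => ?_, fun ⟨c, h⟩ => h ▸ isWeakDeriv_smul_one_add_volterra c v⟩
  have h0 := h.sub (isWeakDeriv_smul_one_add_volterra 0 v)
  rw [sub_self] at h0
  obtain ⟨c, hc⟩ := eq_smul_one_of_isWeakDeriv_zero h0
  refine ⟨c, ?_⟩
  rw [← hc]
  simp

/-- Two continuous representatives that agree almost everywhere agree on the whole closed interval,
endpoints included, so a trace can be read off the explicit primitive. -/
lemma hasTrace_iff [Fact (0 < L)] {c d : ℝ} {v : L2 L} {x : ℝ} (hx : x ∈ Icc 0 L) :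
    HasTrace L (c • one L + volterra L v) x d ↔ c + prim L v x = d := by
  have hL : (0 : ℝ) < L := Fact.out
  have hcont : ContinuousOn (fun x => c + prim L v x) (Icc 0 L) :=
    continuousOn_const.add (continuousOn_prim v)
  have hae : (c • one L + volterra L v : L2 L) =ᵐ[mu L] fun x => c + prim L v x := by
    filter_upwards [Lp.coeFn_add (c • one L) (volterra L v), Lp.coeFn_smul c (one L), coeFn_one L,
      coeFn_volterra v] with x h1 h2 h3 h4
    rw [h1, Pi.add_apply, h2, Pi.smul_apply, h3, h4, smul_eq_mul, mul_one]
  refine ⟨fun ⟨f, h1, h2, h3⟩ => ?_, fun h => ⟨_, hcont, hae, h⟩⟩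
  have h4 : f =ᵐ[volume.restrict (Icc 0 L)] fun x => c + prim L v x := by
    rw [← restrict_Ioo_eq_restrict_Icc]
    exact h2.symm.trans hae
  rw [← h3]
  exact (Measure.eqOn_Icc_of_ae_eq volume hL.ne h4 h1 hcont hx).symm

lemma prim_self (f : ℝ → ℝ) : prim L f L = 0 := intervalIntegral.integral_same

/-- The graph of `A` in terms of the Volterra operator. -/
lemma operatorGraph_iff [Fact (0 < L)] {w z : L2 L} :
    OperatorGraph L w z ↔ ∃ (c : ℝ) (w₂ w₃ : L2 L), w₂ = c • one L + volterra L w₃ ∧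
      inner ℝ (volterra L w₂) (one L) = 0 ∧ w = volterra L (volterra L w₂) ∧
      z = -volterra L w₂ - w₃ := by
  have hL : (0 : ℝ) < L := Fact.out
  have m0 := left_mem_Icc.2 hL.le
  have m1 := right_mem_Icc.2 hL.le
  constructor
  · rintro ⟨w₁, w₂, w₃, h1, h2, h3, t1, t2, t3, rfl⟩
    obtain ⟨c1, rfl⟩ := isWeakDeriv_iff.1 h1
    obtain ⟨c2, rfl⟩ := isWeakDeriv_iff.1 h2
    obtain ⟨c3, h3⟩ := isWeakDeriv_iff.1 h3
    -- The two conditions at `L` annihilate the constants in `w` and `w'`; the condition at `0`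
    -- becomes the zero mean of `w'`. The free constant `c` is `w''(L)`.
    rw [hasTrace_iff m1, prim_self, add_zero] at t2 t3
    subst t2 t3
    rw [hasTrace_iff m0, prim_zero_eq] at t1
    simp only [zero_smul, zero_add, neg_eq_zero] at t1 ⊢
    exact ⟨c3, w₂, w₃, h3, t1, rfl, rfl⟩
  · rintro ⟨c, w₂, w₃, h2, h1, rfl, rfl⟩
    refine ⟨volterra L w₂, w₂, w₃, isWeakDeriv_iff.2 ⟨0, by simp⟩, isWeakDeriv_iff.2 ⟨0, by simp⟩,
      isWeakDeriv_iff.2 ⟨c, h2⟩, ?_, ?_, ?_, rfl⟩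
    · have := (hasTrace_iff (c := 0) (d := 0) (v := volterra L w₂) m0).2
        (by rw [prim_zero_eq, h1]; simp)
      simpa using this
    · have := (hasTrace_iff (c := 0) (d := 0) (v := volterra L w₂) m1).2 (by rw [prim_self]; simp)
      simpa using this
    · have := (hasTrace_iff (c := 0) (d := 0) (v := w₂) m1).2 (by rw [prim_self]; simp)
      simpa using this

end KdV
end

/-! ### Dissipativity of `A`, the multiplier identity, and surjectivity of `λ - A`. -/

noncomputable section

/-- If `M V - V M = V²` then `V` is quasinilpotent, so that `1 + V P` is invertible for every `P`
commuting with `V`. -/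
lemma isUnit_one_add_mul_of_commutator {R : Type*} [NormedRing R] [NormedAlgebra ℝ R]
    [CompleteSpace R] {M V P : R}
    (h : M * V - V * M = V * V) (hc : Commute V P) : IsUnit (1 + V * (V * P)) := by
  have h1 : ∀ n : ℕ, M * V ^ n - V ^ n * M = (n : ℕ) • V ^ (n + 1) := by
    intro n
    induction n with
    | zero => simp
    | succ n ih =>
      have e : M * V ^ (n + 1) - V ^ (n + 1) * M =
          (M * V ^ n - V ^ n * M) * V + V ^ n * (M * V - V * M) := by
        rw [pow_succ]; noncomm_ring
      rw [e, ih, h, smul_mul_assoc, ← pow_succ, ← mul_assoc, ← pow_succ, ← pow_succ, succ_nsmul]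
  -- Norms in `[M, V^n] = n V^(n+1)` give `n ‖V^(n+1)‖ ≤ 2‖M‖ ‖V^n‖`: the powers of `V` decay like
  -- `1/n!`.
  have h2 : ∀ n : ℕ, ‖V ^ (n + 1)‖ * (n.factorial : ℝ) ≤ ‖V‖ * (2 * ‖M‖) ^ n := by
    intro n
    induction n with
    | zero => simp
    | succ n ih =>
      have h3 : ((n + 1 : ℕ) : ℝ) * ‖V ^ (n + 1 + 1)‖ ≤ 2 * ‖M‖ * ‖V ^ (n + 1)‖ := by
        have h5 : ‖(n + 1 : ℕ) • V ^ (n + 1 + 1)‖ = ((n + 1 : ℕ) : ℝ) * ‖V ^ (n + 1 + 1)‖ := by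
          rw [← Nat.cast_smul_eq_nsmul ℝ, norm_smul, Real.norm_natCast]
        rw [← h5, ← h1 (n + 1)]
        calc _ ≤ ‖M * V ^ (n + 1)‖ + ‖V ^ (n + 1) * M‖ := norm_sub_le _ _
          _ ≤ ‖M‖ * ‖V ^ (n + 1)‖ + ‖V ^ (n + 1)‖ * ‖M‖ := by gcongr <;> exact norm_mul_le _ _
          _ = _ := by ring
      calc ‖V ^ (n + 1 + 1)‖ * ((n + 1).factorial : ℝ)
          = (((n + 1 : ℕ) : ℝ) * ‖V ^ (n + 1 + 1)‖) * n.factorial := by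
            rw [Nat.factorial_succ]; push_cast; ring
        _ ≤ (2 * ‖M‖ * ‖V ^ (n + 1)‖) * n.factorial := by gcongr
        _ = 2 * ‖M‖ * (‖V ^ (n + 1)‖ * n.factorial) := by ring
        _ ≤ 2 * ‖M‖ * (‖V‖ * (2 * ‖M‖) ^ n) := by gcongr
        _ = _ := by ring
  set q := ‖V * P‖
  have h3 : Tendsto (fun n : ℕ => ‖V‖ * q * ((2 * ‖M‖ * q) ^ n / n.factorial)) atTop (𝓝 0) := by
    simpa using (FloorSemiring.tendsto_pow_div_factorial_atTop (2 * ‖M‖ * q)).const_mul (‖V‖ * q)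
  obtain ⟨n, hn⟩ := (h3.eventually (gt_mem_nhds one_pos)).exists
  have hcomm : Commute V (V * P) := (Commute.refl V).mul_right hc
  set N := V * (V * P) with hN
  have h4 : ‖(-N) ^ (n + 1)‖ < 1 := by
    rw [neg_pow, hN, hcomm.mul_pow]
    refine lt_of_le_of_lt ?_ hn
    have h5 : ‖(-1 : R) ^ (n + 1) * (V ^ (n + 1) * (V * P) ^ (n + 1))‖ =
        ‖V ^ (n + 1) * (V * P) ^ (n + 1)‖ := by
      rcases neg_one_pow_eq_or R (n + 1) with h | h <;> simp [h]
    rw [h5]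
    have hf : (0 : ℝ) < n.factorial := by positivity
    calc _ ≤ ‖V ^ (n + 1)‖ * q ^ (n + 1) :=
          (norm_mul_le _ _).trans (by gcongr; exact norm_pow_le' _ n.succ_pos)
      _ ≤ (‖V‖ * (2 * ‖M‖) ^ n / n.factorial) * q ^ (n + 1) := by
          gcongr
          rw [le_div_iff₀ hf]
          exact h2 n
      _ = _ := by rw [mul_pow, pow_succ]; ring
  -- A high power of `-N` is small, so `1 - (-N)^(n+1)` is invertible by Neumann series; it is the
  -- product of `1 + N` and a commuting geometric sum, so `1 + N` is invertible too.
  have h5 : IsUnit ((1 : R) - (-N) ^ (n + 1)) := isUnit_one_sub_of_norm_lt_one h4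
  have h6 : (1 - (-N)) * (∑ i ∈ Finset.range (n + 1), (-N) ^ i) = 1 - (-N) ^ (n + 1) :=
    mul_neg_geom_sum (-N) (n + 1)
  have h7 : Commute (1 - (-N)) (∑ i ∈ Finset.range (n + 1), (-N) ^ i) :=
    Commute.sum_right _ _ _ fun i _ =>
      ((Commute.one_left _).sub_left (Commute.refl _)).pow_right i
  rw [← h6, h7.isUnit_mul_iff] at h5
  simpa using h5.1

namespace KdV

variable {L : ℝ}

/-- `V f + x f` is the derivative of `x · V f`, which vanishes at `0` because of `x` and at `L`
because of `V f`. -/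
lemma inner_volterra_one [Fact (0 < L)] (f : L2 L) :
    inner ℝ (volterra L f + mulX L f) (one L) = 0 := by
  have h := inner_volterra_add f (one L)
  rw [volterra_one, inner_one_one, inner_sub_right, inner_smul_right, ← inner_mulX_left] at h
  rw [inner_add_left]
  linarith

/-- `x · V f` is the primitive of a function of zero mean, so the integration by parts has no
boundary term. -/
lemma inner_mulX_volterra [Fact (0 < L)] (f g : L2 L) :
    inner ℝ (mulX L (volterra L f)) g =
      -inner ℝ (volterra L f + mulX L f) (volterra L g) := by
  have h := inner_volterra_add (volterra L f + mulX L f) g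
  rw [inner_volterra_one, map_add, ← mulX_volterra] at h
  linarith

lemma inner_mulX_volterra_self [Fact (0 < L)] (f : L2 L) :
    inner ℝ (mulX L (volterra L f)) f = -2⁻¹ * ‖volterra L f‖ ^ 2 := by
  have h := inner_mulX_volterra f f
  rw [inner_add_left, real_inner_self_eq_norm_sq, inner_mulX_left f, real_inner_comm _ f] at h
  linarith

section

variable [Fact (0 < L)] {c : ℝ} {w₂ w₃ : L2 L}

/-- `⟨A w, w⟩ ≤ 0`. -/
lemma inner_operator_nonpos (h2 : w₂ = c • one L + volterra L w₃)
    (h0 : inner ℝ (volterra L w₂) (one L) = 0) :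
    inner ℝ (-volterra L w₂ - w₃) (volterra L (volterra L w₂)) ≤ 0 := by
  set w₁ := volterra L w₂ with hw1
  -- `⟨w', w⟩` vanishes, and `⟨w''', w⟩ = -⟨w', w''⟩ = w'(0)²/2`, where `w'(0) = -⟨w₂, 1⟩`.
  have e1 := inner_volterra_self w₁
  have e2 := inner_volterra_add w₁ w₃
  have e3 := inner_volterra_self w₂
  have e4 : volterra L w₃ = w₂ - c • one L := by rw [h2]; abel
  rw [← hw1] at e3
  rw [e4, inner_sub_right, inner_smul_right, h0] at e2
  rw [h0] at e1
  rw [inner_sub_left, inner_neg_left, real_inner_comm, real_inner_comm _ w₃]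
  nlinarith [sq_nonneg (inner ℝ w₂ (one L))]

/-- `⟨A w, x w⟩ = ½ ‖w‖² - (3/2) ‖w'‖²`. -/
lemma inner_operator_mulX (h2 : w₂ = c • one L + volterra L w₃)
    (h0 : inner ℝ (volterra L w₂) (one L) = 0) :
    inner ℝ (-volterra L w₂ - w₃) (mulX L (volterra L (volterra L w₂))) =
      2⁻¹ * ‖volterra L (volterra L w₂)‖ ^ 2 - 3 / 2 * ‖volterra L w₂‖ ^ 2 := by
  set w₁ := volterra L w₂ with hw1
  -- `⟨w', x w⟩ = -‖w‖²/2`. For the third derivative, `⟨w''', x w⟩ = -⟨w + x w', w''⟩`, where `⟨w,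
  -- w''⟩ = -‖w'‖²` and `⟨x w', w''⟩ = -‖w'‖²/2`. The boundary value `c = w''(L)` drops out because
  -- `(x w)'` has zero mean.
  have e1 := inner_mulX_volterra_self w₁
  have e2 := inner_mulX_volterra w₁ w₃
  have e3 := inner_mulX_volterra_self w₂
  have e4 : volterra L w₃ = w₂ - c • one L := by rw [h2]; abel
  have e5 := inner_volterra_add w₁ w₂
  rw [← hw1] at e3 e5
  rw [h0, real_inner_self_eq_norm_sq] at e5
  rw [e4, inner_sub_right, inner_smul_right, inner_volterra_one, inner_add_left] at e2
  rw [inner_sub_left, inner_neg_left, real_inner_comm, real_inner_comm _ w₃]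
  linarith

end

lemma OperatorGraph.inner_nonpos [Fact (0 < L)] {w z : L2 L} (h : OperatorGraph L w z) :
    inner ℝ z w ≤ 0 := by
  obtain ⟨c, w₂, w₃, h2, h0, rfl, rfl⟩ := operatorGraph_iff.1 h
  exact inner_operator_nonpos h2 h0

/-- A function in the domain of `A` has a derivative `g` of zero mean, controlled by the multiplier
`x`. -/
lemma OperatorGraph.exists_deriv [Fact (0 < L)] {w z : L2 L} (h : OperatorGraph L w z) :
    ∃ g : L2 L, w = volterra L g ∧ inner ℝ g (one L) = 0 ∧
      inner ℝ z (mulX L w) = 2⁻¹ * ‖w‖ ^ 2 - 3 / 2 * ‖g‖ ^ 2 := by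
  obtain ⟨c, w₂, w₃, h2, h0, rfl, rfl⟩ := operatorGraph_iff.1 h
  exact ⟨volterra L w₂, rfl, h0, inner_operator_mulX h2 h0⟩

lemma IsWeakDeriv.eq_zero {d : L2 L} (h : IsWeakDeriv L 0 d) : d = 0 := by
  have key : ∀ᵐ x ∂volume, x ∈ Ioo 0 L → d x = 0 := by
    refine isOpen_Ioo.ae_eq_zero_of_integral_contDiff_smul_eq_zero
      (IntegrableOn.locallyIntegrableOn ((Lp.memLp d).integrable one_le_two)) fun φ hφ hc hs => ?_
    have h4 := h φ hφ hc hs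
    rw [integral_congr_ae (g := fun _ => (0 : ℝ)), integral_zero, zero_eq_neg,
      ← integral_indicator measurableSet_Ioo] at h4
    · rw [← h4]
      congr 1
      funext x
      by_cases hx : x ∈ Ioo 0 L
      · rw [indicator_of_mem hx, smul_eq_mul, mul_comm]
      · rw [indicator_of_notMem hx, eq_zero_of_tsupport_subset hs hx, zero_smul]
    · filter_upwards [Lp.coeFn_zero ℝ 2 (mu L)] with x hx
      rw [hx, Pi.zero_apply, zero_mul]
  apply Lp.ext
  filter_upwards [(ae_restrict_iff' measurableSet_Ioo).2 key, Lp.coeFn_zero ℝ 2 (mu L)]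
    with x h1 h2
  rw [h1, h2, Pi.zero_apply]

lemma IsWeakDeriv.unique {u v v' : L2 L} (h : IsWeakDeriv L u v) (h' : IsWeakDeriv L u v') :
    v = v' := by
  have h3 := h.sub h'
  rw [sub_self] at h3
  exact sub_eq_zero.1 h3.eq_zero

lemma isWeakDeriv_volterra [Fact (0 < L)] (f : L2 L) : IsWeakDeriv L (volterra L f) f :=
  isWeakDeriv_iff.2 ⟨0, by simp⟩

lemma volterra_injective [Fact (0 < L)] : Function.Injective (volterra L) := fun f g h =>
  (isWeakDeriv_volterra f).unique (h ▸ isWeakDeriv_volterra g)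

/-- The operator `λ - A` is onto for every `λ > 0`. -/
lemma OperatorGraph.exists_resolvent [Fact (0 < L)] {l : ℝ} (hl : 0 < l) (f : L2 L) :
    ∃ w z : L2 L, OperatorGraph L w z ∧ l • w - z = f := by
  set V := volterra L with hV
  -- With `w = V² w₂` and `w₂ = c + V w₃`, the equation `λ w - A w = f` reads `(1 + V² + λ V³) w₃ =
  -- f - c (V 1 + λ V² 1)`. It is solvable for every `c`, and `c` remains to be fixed by the
  -- boundary condition at `0`.
  have hu : IsUnit (1 + V * (V * (1 + l • V))) := by
    refine isUnit_one_add_mul_of_commutator (M := mulX L) ?_ ?_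
    · ext1 f
      simp only [sub_apply, mul_apply_eq_comp, hV, mulX_volterra]
      abel
    · exact (Commute.one_right V).add_right ((Commute.refl V).smul_right l)
  obtain ⟨N, hN⟩ := hu
  have hK : ∀ h : L2 L, ∃ g : L2 L, g + V (V g) + l • V (V (V g)) = h := fun h => by
    refine ⟨(↑N⁻¹ : L2 L →L[ℝ] L2 L) h, ?_⟩
    have := congrArg (fun S : L2 L →L[ℝ] L2 L => S h) N.mul_inv
    simp only [hN, mul_apply_eq_comp, add_apply,
      one_apply_eq_self, smul_apply, map_add, map_smul] at this
    rw [← add_assoc] at this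
    exact this
  obtain ⟨g₀, hg₀⟩ := hK (-(V (one L) + l • V (V (one L))))
  obtain ⟨g₁, hg₁⟩ := hK f
  -- `g₀` is the solution for `c = 1`, `f = 0`, and `g₁` the one for `c = 0`. The condition at `0`
  -- is `c α + β = 0`. If `α` vanished, `g₀` would give an eigenfunction of `A` for the eigenvalue
  -- `λ > 0`; dissipativity makes it zero, and then `1 = 0` by injectivity of `V`.
  set α := inner ℝ (V (one L + V g₀)) (one L) with hα
  have hα0 : α ≠ 0 := by
    intro h0
    have e : OperatorGraph L (V (V (one L + V g₀))) (-V (one L + V g₀) - g₀) :=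
      operatorGraph_iff.2 ⟨1, one L + V g₀, g₀, by simp [hV], h0, rfl, rfl⟩
    have e1 : -V (one L + V g₀) - g₀ = l • V (V (one L + V g₀)) := by
      simp only [map_add, smul_add]
      rw [neg_add, ← sub_eq_zero] at hg₀
      rw [← sub_eq_zero, ← neg_eq_zero, ← hg₀]
      abel
    have e2 := e.inner_nonpos
    rw [e1, inner_smul_left, real_inner_self_eq_norm_sq] at e2
    have e3 : V (V (one L + V g₀)) = 0 := by
      rw [← norm_eq_zero]
      have : 0 ≤ l * ‖V (V (one L + V g₀))‖ ^ 2 := by positivity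
      have h6 : l * ‖V (V (one L + V g₀))‖ ^ 2 = 0 := le_antisymm (by simpa using e2) this
      simpa [hl.ne'] using h6
    have e4 : V (one L + V g₀) = 0 := volterra_injective (by rw [map_zero]; exact e3)
    have e5 : one L + V g₀ = 0 := volterra_injective (by rw [map_zero]; exact e4)
    have e6 : g₀ = 0 := by
      rw [e3, e4] at e1
      simpa using e1
    rw [e6, map_zero, add_zero] at e5
    exact one_ne_zero e5
  set β := inner ℝ (V (V g₁)) (one L) with hβ
  set c := -(β / α) with hc
  set w₃ := c • g₀ + g₁ with hw3
  refine ⟨V (V (c • one L + V w₃)), -V (c • one L + V w₃) - w₃,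
    operatorGraph_iff.2 ⟨c, _, w₃, rfl, ?_, rfl, rfl⟩, ?_⟩
  · have : V (c • one L + V w₃) = c • V (one L + V g₀) + V (V g₁) := by
      simp only [hw3, map_add, map_smul, smul_add]; abel
    rw [← hV, this, inner_add_left, inner_smul_left, ← hα, ← hβ, hc]
    simp only [conj_trivial]
    field_simp
    ring
  · have e0 := congrArg (fun u => c • u) hg₀
    rw [← hg₁, ← sub_eq_zero]
    rw [← sub_eq_zero] at e0
    rw [← e0]
    simp only [hw3, map_add, map_smul, smul_add, smul_neg, neg_add, smul_comm l c]
    abel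

end KdV
end

/-! ### The Hille–Yosida theorem in a Hilbert space. -/

noncomputable section

variable {X : Type*} [NormedAddCommGroup X] [InnerProductSpace ℝ X]

lemma tendsto_zero_of_dense {ι : Type*} {l : Filter ι} {T : ι → X →L[ℝ] X} {C : ℝ}
    (hT : ∀ᶠ i in l, ∀ x, ‖T i x‖ ≤ C * ‖x‖) {D : Set X} (hD : Dense D)
    (h : ∀ x ∈ D, Tendsto (fun i => T i x) l (𝓝 0)) (x : X) :
    Tendsto (fun i => T i x) l (𝓝 0) := by
  rw [Metric.tendsto_nhds]
  intro ε hε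
  obtain ⟨y, hy, hxy⟩ := Metric.mem_closure_iff.1 (hD x) (ε / (2 * (|C| + 1))) (by positivity)
  filter_upwards [hT, Metric.tendsto_nhds.1 (h y hy) (ε / 2) (by positivity)] with i h1 h2
  rw [dist_zero_right] at h2 ⊢
  rw [dist_eq_norm] at hxy
  calc ‖T i x‖ = ‖T i (x - y) + T i y‖ := by rw [map_sub, sub_add_cancel]
    _ ≤ C * ‖x - y‖ + ‖T i y‖ := (norm_add_le _ _).trans (by gcongr; exact h1 _)
    _ ≤ (|C| + 1) * ‖x - y‖ + ‖T i y‖ := by gcongr; linarith [le_abs_self C]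
    _ < (|C| + 1) * (ε / (2 * (|C| + 1))) + ε / 2 := by gcongr
    _ = ε := by field_simp; ring

/-- A linear, single-valued, maximal dissipative operator on a Hilbert space, given by its
graph. -/
structure IsMaxDissipative (G : X → X → Prop) : Prop where
  add : ∀ {w z w' z'}, G w z → G w' z' → G (w + w') (z + z')
  smul : ∀ (c : ℝ) {w z}, G w z → G (c • w) (c • z)
  single : ∀ {z}, G 0 z → z = 0
  nonpos : ∀ {w z}, G w z → inner ℝ z w ≤ 0
  onto : ∀ {l : ℝ}, 0 < l → ∀ f, ∃ w z, G w z ∧ l • w - z = f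

namespace IsMaxDissipative

variable {G : X → X → Prop}

lemma sub (hG : IsMaxDissipative G) {w z w' z' : X} (h : G w z) (h' : G w' z') :
    G (w - w') (z - z') := by
  have := hG.add h (hG.smul (-1) h')
  simpa [sub_eq_add_neg] using this

/-- Pairing `l w - z` with `w` and discarding `-⟨z, w⟩ ≥ 0` leaves `l ‖w‖²`; Cauchy–Schwarz does the
rest. -/
lemma norm_le (hG : IsMaxDissipative G) {w z : X} (h : G w z) (l : ℝ) :
    l * ‖w‖ ≤ ‖l • w - z‖ := by
  rcases (norm_nonneg w).eq_or_lt with h0 | h0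
  · rw [← h0, mul_zero]; exact norm_nonneg _
  · have h1 : l * ‖w‖ ^ 2 ≤ inner ℝ (l • w - z) w := by
      rw [inner_sub_left, inner_smul_left, real_inner_self_eq_norm_sq]
      have := hG.nonpos h
      simp only [conj_trivial]
      linarith
    have h2 := h1.trans (real_inner_le_norm _ _)
    nlinarith

lemma unique (hG : IsMaxDissipative G) {w z w' z' : X} (h : G w z) (h' : G w' z') {l : ℝ}
    (hl : 0 < l) (he : l • w - z = l • w' - z') : w = w' := by
  have h1 := hG.norm_le (hG.sub h h') l
  rw [show l • (w - w') - (z - z') = (l • w - z) - (l • w' - z') by rw [smul_sub]; abel, he,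
    sub_self, norm_zero] at h1
  have h2 : ‖w - w'‖ = 0 := le_antisymm (by nlinarith) (norm_nonneg _)
  exact sub_eq_zero.1 (norm_eq_zero.1 h2)

/-- The equation `w - A w / (n + 1) = f` solved for `A w`, so that it can be stated with the graph
alone. The shift to `n + 1` keeps the parameter positive. -/
lemma exists_resolvent (hG : IsMaxDissipative G) (n : ℕ) (f : X) :
    ∃ w, G w (((n : ℝ) + 1) • (w - f)) := by
  have hn : (0 : ℝ) < n + 1 := by positivity
  obtain ⟨w, z, h, he⟩ := hG.onto hn f
  refine ⟨((n : ℝ) + 1) • w, ?_⟩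
  have := hG.smul ((n : ℝ) + 1) h
  rwa [show z = ((n : ℝ) + 1) • w - f by rw [← he]; abel] at this

lemma resolvent_unique (hG : IsMaxDissipative G) {n : ℕ} {f w w' : X}
    (h : G w (((n : ℝ) + 1) • (w - f))) (h' : G w' (((n : ℝ) + 1) • (w' - f))) : w = w' := by
  have hn : (0 : ℝ) < n + 1 := by positivity
  refine hG.unique h h' hn ?_
  simp [smul_sub]

/-- The operator `(1 - A / (n + 1))⁻¹`. -/
def J (hG : IsMaxDissipative G) (n : ℕ) : X →L[ℝ] X :=
  LinearMap.mkContinuous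
    { toFun := fun f => (hG.exists_resolvent n f).choose
      map_add' := fun f g => by
        refine hG.resolvent_unique (hG.exists_resolvent n (f + g)).choose_spec ?_
        convert hG.add (hG.exists_resolvent n f).choose_spec (hG.exists_resolvent n g).choose_spec
          using 1
        rw [← smul_add]; congr 1; abel
      map_smul' := fun c f => by
        refine hG.resolvent_unique (hG.exists_resolvent n (c • f)).choose_spec ?_
        have h := hG.smul c (hG.exists_resolvent n f).choose_spec
        rwa [smul_comm c, smul_sub c] at h }
    1 (fun f => by
      have hn : (0 : ℝ) < n + 1 := by positivity
      have h := hG.norm_le (hG.exists_resolvent n f).choose_spec (n + 1)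
      rw [← smul_sub, sub_sub_cancel, norm_smul, Real.norm_of_nonneg hn.le] at h
      rw [one_mul]
      exact le_of_mul_le_mul_left h hn)

variable (hG : IsMaxDissipative G)

lemma J_graph (n : ℕ) (f : X) : G (hG.J n f) (((n : ℝ) + 1) • (hG.J n f - f)) :=
  (hG.exists_resolvent n f).choose_spec

lemma norm_J_le (n : ℕ) (f : X) : ‖hG.J n f‖ ≤ ‖f‖ := by
  have := (hG.J n).le_of_opNorm_le (LinearMap.mkContinuous_norm_le _ zero_le_one _) f
  rwa [one_mul] at this

/-- On the domain, `A J_n w = J_n A w`; hence the Yosida approximations of `A w` are bounded by `‖A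
w‖` and converge to it. -/
lemma J_sub_self {w z : X} (h : G w z) (n : ℕ) :
    ((n : ℝ) + 1) • (hG.J n w - w) = hG.J n z := by
  have hn : ((n : ℝ) + 1) ≠ 0 := by positivity
  have h1 : hG.J n (w - ((n : ℝ) + 1)⁻¹ • z) = w := by
    refine hG.resolvent_unique (hG.J_graph n _) ?_
    rwa [sub_sub_cancel, smul_inv_smul₀ hn]
  rw [map_sub, map_smul] at h1
  nth_rw 2 [← h1]
  rw [sub_sub_cancel, smul_inv_smul₀ hn]

lemma J_comm (n m : ℕ) (f : X) : hG.J n (hG.J m f) = hG.J m (hG.J n f) := by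
  rcases eq_or_ne n m with rfl | hnm
  · rfl
  -- Each of the two relations is a resolvent identity; their sum is `(n - m)(J_n J_m - J_m J_n) f =
  -- 0`.
  have h1 := hG.J_sub_self (hG.J_graph m f) n
  have h2 := hG.J_sub_self (hG.J_graph n f) m
  simp only [map_smul, map_sub, smul_sub] at h1 h2
  have h3 : ((n : ℝ) - m) ≠ 0 := sub_ne_zero.2 (Nat.cast_injective.ne hnm)
  refine smul_right_injective X h3 ?_
  simp only
  linear_combination (norm := module) h1 + h2

lemma J_injective (n : ℕ) : Function.Injective (hG.J n) := by
  have hn : ((n : ℝ) + 1) ≠ 0 := by positivity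
  rw [injective_iff_map_eq_zero]
  intro f hf
  have := hG.J_graph n f
  rw [hf, zero_sub] at this
  simpa [hn] using hG.single this

/-- The Yosida approximation `A (1 - A / (n + 1))⁻¹`. -/
def yosida (n : ℕ) : X →L[ℝ] X := ((n : ℝ) + 1) • (hG.J n - 1)

lemma yosida_apply (n : ℕ) (f : X) : hG.yosida n f = ((n : ℝ) + 1) • (hG.J n f - f) := rfl

lemma inner_yosida_nonpos (n : ℕ) (f : X) : inner ℝ (hG.yosida n f) f ≤ 0 := by
  rw [yosida_apply, inner_smul_left, inner_sub_left, real_inner_self_eq_norm_sq]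
  have h1 := real_inner_le_norm (hG.J n f) f
  have h2 := hG.norm_J_le n f
  have hn : (0 : ℝ) ≤ n + 1 := by positivity
  refine mul_nonpos_of_nonneg_of_nonpos hn ?_
  nlinarith [norm_nonneg f]

lemma commute_yosida (n m : ℕ) : Commute (hG.yosida n) (hG.yosida m) := by
  have : Commute (hG.J n) (hG.J m) := by
    ext f
    exact hG.J_comm n m f
  exact ((this.sub_right (Commute.one_right _)).sub_left
    ((Commute.one_left _).sub_right (Commute.one_right _))).smul_left _ |>.smul_right _

/-- The semigroup generated by the Yosida approximation. -/
def approx (n : ℕ) (t : ℝ) : X →L[ℝ] X := NormedSpace.exp (t • hG.yosida n)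

lemma approx_zero (n : ℕ) : hG.approx n 0 = 1 := by simp [approx, NormedSpace.exp_zero]

lemma commute_approx_yosida (n m : ℕ) (t : ℝ) : Commute (hG.approx n t) (hG.yosida m) := by
  let _ : NormedAlgebra ℚ (X →L[ℝ] X) := NormedAlgebra.restrictScalars ℚ ℝ _
  exact ((hG.commute_yosida n m).smul_left t).exp_left

variable [CompleteSpace X]

/-- The domain of `A` is dense: if `v` is orthogonal to the range, then `⟨J v, v⟩ = 0`, so `⟨J v -
v, J v⟩ ≤ 0` forces `J v = 0` and `v = 0`. -/
lemma dense_range_J : Dense (range (hG.J 0)) := by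
  have h : (LinearMap.range (hG.J 0).toLinearMap).topologicalClosure = ⊤ := by
    rw [Submodule.topologicalClosure_eq_top_iff, Submodule.eq_bot_iff]
    intro v hv
    have h1 : inner ℝ (hG.J 0 v) v = 0 := hv _ ⟨v, rfl⟩
    have h2 := hG.nonpos (hG.J_graph 0 v)
    simp only [CharP.cast_eq_zero, zero_add, one_smul] at h2
    rw [inner_sub_left, real_inner_self_eq_norm_sq, real_inner_comm, h1, sub_zero] at h2
    have h3 : hG.J 0 v = 0 := by
      rw [← norm_eq_zero]
      exact pow_eq_zero_iff two_ne_zero |>.1 (le_antisymm h2 (sq_nonneg _))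
    exact hG.J_injective 0 (by rw [h3, map_zero])
  have := Submodule.dense_iff_topologicalClosure_eq_top.2 h
  exact this

/-- For `w` in the domain `‖J_n w - w‖ ≤ ‖A w‖ / (n + 1)`; the uniform bound on `J_n` and density
extend the convergence to all vectors. -/
lemma tendsto_J (f : X) : Tendsto (fun n => hG.J n f) atTop (𝓝 f) := by
  have h : Tendsto (fun n => (hG.J n - 1) f) atTop (𝓝 0) := by
    refine tendsto_zero_of_dense (C := 2) (Eventually.of_forall fun n x => ?_) hG.dense_range_J
      ?_ f
    · refine (norm_sub_le _ _).trans ?_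
      have := hG.norm_J_le n x
      change ‖hG.J n x‖ + ‖x‖ ≤ 2 * ‖x‖
      linarith
    · rintro _ ⟨u, rfl⟩
      have h0 := hG.J_graph 0 u
      set w := hG.J 0 u
      set z := (((0 : ℕ) : ℝ) + 1) • (w - u)
      have h1 : Tendsto (fun n : ℕ => (1 / ((n : ℝ) + 1)) * ‖z‖) atTop (𝓝 0) := by
        simpa using tendsto_one_div_add_atTop_nhds_zero_nat.mul_const ‖z‖
      refine squeeze_zero_norm (fun n => ?_) h1
      have hn : (0 : ℝ) < n + 1 := by positivity
      have h2 := congrArg norm (hG.J_sub_self h0 n)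
      rw [norm_smul, Real.norm_of_nonneg hn.le] at h2
      rw [one_div, inv_mul_eq_div, le_div_iff₀ hn, mul_comm]
      simp only [sub_apply, one_apply_eq_self]
      rw [h2]
      exact hG.norm_J_le n z
  simpa using h.add_const f

lemma approx_add (n : ℕ) (s t : ℝ) : hG.approx n (s + t) = hG.approx n s * hG.approx n t := by
  let _ : NormedAlgebra ℚ (X →L[ℝ] X) := NormedAlgebra.restrictScalars ℚ ℝ _
  rw [approx, add_smul]
  exact NormedSpace.exp_add_of_commute (((Commute.refl _).smul_left s).smul_right t)

lemma hasDerivAt_approx (n : ℕ) (t : ℝ) :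
    HasDerivAt (hG.approx n) (hG.approx n t * hG.yosida n) t :=
  hasDerivAt_exp_smul_const (𝕂 := ℝ) (hG.yosida n) t

lemma norm_approx_le (n : ℕ) {t : ℝ} (ht : 0 ≤ t) (x : X) : ‖hG.approx n t x‖ ≤ ‖x‖ := by
  have hd : ∀ s, HasDerivAt (fun s => hG.approx n s x) (hG.yosida n (hG.approx n s x)) s :=
    fun s => by
      have := (hG.hasDerivAt_approx n s).clm_apply (hasDerivAt_const s x)
      rw [(hG.commute_approx_yosida n n s).eq] at this
      simpa using this
  have hanti : Antitone (fun s => ‖hG.approx n s x‖ ^ 2) := by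
    refine antitone_of_deriv_nonpos (fun s => (hd s).norm_sq.differentiableAt) fun s => ?_
    rw [(hd s).norm_sq.deriv, real_inner_comm]
    have := hG.inner_yosida_nonpos n (hG.approx n s x)
    linarith
  have := hanti ht
  simp only [approx_zero, one_apply_eq_self] at this
  exact le_of_sq_le_sq this (norm_nonneg _)

/-- The path `s ↦ e^{s A_n} e^{(t - s) A_m} x` joins the two vectors, and its derivative is `A_n x -
A_m x` transported by contractions, since the approximations commute. -/
lemma norm_approx_sub_le (n m : ℕ) {t : ℝ} (ht : 0 ≤ t) (x : X) :
    ‖hG.approx n t x - hG.approx m t x‖ ≤ ‖hG.yosida n x - hG.yosida m x‖ * t := by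
  have hd : ∀ s, HasDerivAt (fun s => hG.approx n s (hG.approx m (t - s) x))
      (hG.approx n s (hG.approx m (t - s) (hG.yosida n x - hG.yosida m x))) s := fun s => by
    have h1 := (hG.hasDerivAt_approx m (t - s)).scomp s ((hasDerivAt_id s).const_sub t)
    have h2 := (hG.hasDerivAt_approx n s).clm_apply (h1.clm_apply (hasDerivAt_const s x))
    convert! h2 using 1
    have h3 : hG.yosida n (hG.approx m (t - s) x) = hG.approx m (t - s) (hG.yosida n x) :=
      congrArg (fun S : X →L[ℝ] X => S x) (hG.commute_approx_yosida m n (t - s)).eq.symm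
    simp only [Function.comp_apply, mul_apply_eq_comp, neg_smul, one_smul, neg_apply, map_zero,
      add_zero, map_sub, map_neg, h3]
    abel
  have := norm_image_sub_le_of_norm_deriv_le_segment' (a := 0) (b := t)
    (C := ‖hG.yosida n x - hG.yosida m x‖) (fun s _ => (hd s).hasDerivWithinAt)
    (fun s hs => (hG.norm_approx_le n hs.1 _).trans (hG.norm_approx_le m (sub_nonneg.2 hs.2.le) _))
    t (right_mem_Icc.2 ht)
  simpa [approx_zero] using this

lemma tendsto_yosida {w z : X} (h : G w z) : Tendsto (fun n => hG.yosida n w) atTop (𝓝 z) := by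
  simp only [yosida_apply, hG.J_sub_self h]
  exact hG.tendsto_J z

lemma cauchySeq_approx {t : ℝ} (ht : 0 ≤ t) (x : X) : CauchySeq fun n => hG.approx n t x := by
  rw [cauchySeq_iff_tendsto_dist_atTop_0]
  simp only [dist_eq_norm]
  rw [← tendsto_zero_iff_norm_tendsto_zero]
  refine tendsto_zero_of_dense (T := fun p : ℕ × ℕ => hG.approx p.1 t - hG.approx p.2 t) (C := 2)
    (Eventually.of_forall fun p x => ?_) hG.dense_range_J ?_ x
  · refine (norm_sub_le _ _).trans ?_
    have h1 := hG.norm_approx_le p.1 ht x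
    have h2 := hG.norm_approx_le p.2 ht x
    change ‖hG.approx p.1 t x‖ + ‖hG.approx p.2 t x‖ ≤ 2 * ‖x‖
    linarith
  · rintro _ ⟨u, rfl⟩
    have h := (hG.tendsto_yosida (hG.J_graph 0 u)).cauchySeq
    rw [cauchySeq_iff_tendsto_dist_atTop_0] at h
    simp only [dist_eq_norm] at h
    refine squeeze_zero_norm (fun p => hG.norm_approx_sub_le p.1 p.2 ht _) ?_
    simpa using h.mul_const t

end IsMaxDissipative

/-- `W` is a strongly continuous semigroup of contractions. -/
structure IsContractionSemigroup (W : ℝ → X →L[ℝ] X) : Prop where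
  map_zero : W 0 = ContinuousLinearMap.id ℝ X
  map_add : ∀ s t : ℝ, 0 ≤ s → 0 ≤ t → W (s + t) = (W s).comp (W t)
  contraction : ∀ t : ℝ, 0 ≤ t → ‖W t‖ ≤ 1
  continuous_at_zero : ∀ u : X, Tendsto (fun t => W t u) (𝓝[>] 0) (𝓝 u)

/-- The infinitesimal generator of `W` has the graph `G`. -/
def IsGenerator (G : X → X → Prop) (W : ℝ → X →L[ℝ] X) : Prop :=
  ∀ w z : X, Tendsto (fun h : ℝ => h⁻¹ • (W h w - w)) (𝓝[>] 0) (𝓝 z) ↔ G w z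

namespace IsContractionSemigroup

variable {W : ℝ → X →L[ℝ] X}

lemma norm_le (hW : IsContractionSemigroup W) {t : ℝ} (ht : 0 ≤ t) (x : X) : ‖W t x‖ ≤ ‖x‖ := by
  have := (W t).le_of_opNorm_le (hW.contraction t ht) x
  rwa [one_mul] at this

lemma zero_apply (hW : IsContractionSemigroup W) (x : X) : W 0 x = x := by
  rw [hW.map_zero]; rfl

lemma add_apply (hW : IsContractionSemigroup W) {s t : ℝ} (hs : 0 ≤ s) (ht : 0 ≤ t) (x : X) :
    W (s + t) x = W s (W t x) := by
  rw [hW.map_add s t hs ht]; rfl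

lemma norm_sub_le (hW : IsContractionSemigroup W) {s t : ℝ} (hs : 0 ≤ s) (ht : 0 ≤ t) (x : X) :
    ‖W s x - W t x‖ ≤ ‖W |s - t| x - x‖ := by
  wlog h : t ≤ s generalizing s t
  · rw [norm_sub_rev, abs_sub_comm]
    exact this ht hs (not_le.1 h).le
  have h1 : W s x = W t (W (s - t) x) := by
    rw [← hW.add_apply ht (sub_nonneg.2 h), add_sub_cancel]
  rw [abs_of_nonneg (sub_nonneg.2 h), h1, ← map_sub]
  exact hW.norm_le ht _

lemma tendsto_zero (hW : IsContractionSemigroup W) (x : X) :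
    Tendsto (fun t => W t x) (𝓝[≥] 0) (𝓝 x) := by
  rw [← Ioi_insert, nhdsWithin_insert]
  refine Tendsto.sup ?_ (hW.continuous_at_zero x)
  rw [tendsto_pure_left]
  intro s hs
  rw [hW.zero_apply]
  exact mem_of_mem_nhds hs

/-- Joint strong continuity, the basis of every measurability claim below. Truncating the time at
`0` discards the arbitrary values of `W` at negative times. -/
lemma continuous_uncurry (hW : IsContractionSemigroup W) :
    Continuous fun p : ℝ × X => W (max p.1 0) p.2 := by
  rw [continuous_iff_continuousAt]
  rintro ⟨t, x⟩
  rw [ContinuousAt, tendsto_iff_norm_sub_tendsto_zero]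
  have h1 : Tendsto (fun p : ℝ × X => |max p.1 0 - max t 0|) (𝓝 (t, x)) (𝓝[≥] 0) := by
    rw [tendsto_nhdsWithin_iff]
    refine ⟨?_, Eventually.of_forall fun p => mem_Ici.2 (abs_nonneg _)⟩
    have : Continuous fun p : ℝ × X => |max p.1 0 - max t 0| := by fun_prop
    simpa using this.tendsto (t, x)
  have h2 := ((hW.tendsto_zero x).comp h1).sub_const x |>.norm
  have h3 : Tendsto (fun p : ℝ × X => ‖p.2 - x‖) (𝓝 (t, x)) (𝓝 0) := by
    have : Continuous fun p : ℝ × X => ‖p.2 - x‖ := by fun_prop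
    simpa using this.tendsto (t, x)
  have h4 := h3.add h2
  simp only [sub_self, norm_zero, add_zero] at h4
  refine squeeze_zero (fun _ => norm_nonneg _) (fun p => ?_) h4
  calc ‖W (max p.1 0) p.2 - W (max t 0) x‖
      = ‖W (max p.1 0) (p.2 - x) + (W (max p.1 0) x - W (max t 0) x)‖ := by
        rw [map_sub]; congr 1; abel
    _ ≤ _ := (norm_add_le _ _).trans (add_le_add (hW.norm_le (le_max_right _ _) _)
        (hW.norm_sub_le (le_max_right _ _) (le_max_right _ _) x))

lemma continuousOn (hW : IsContractionSemigroup W) (x : X) :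
    ContinuousOn (fun t => W t x) (Ici 0) := by
  have h : Continuous fun t : ℝ => W (max t 0) x :=
    hW.continuous_uncurry.comp (Continuous.prodMk continuous_id continuous_const)
  refine h.continuousOn.congr fun t ht => ?_
  simp only [max_eq_left (mem_Ici.1 ht)]

lemma intervalIntegrable (hW : IsContractionSemigroup W) (x : X) {s t : ℝ} (hs : 0 ≤ s)
    (ht : 0 ≤ t) : IntervalIntegrable (fun r => W r x) volume s t :=
  ((hW.continuousOn x).mono fun _ hr => (le_min hs ht).trans hr.1).intervalIntegrable

lemma inner_generator_nonpos (hW : IsContractionSemigroup W) {w z : X}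
    (h : Tendsto (fun h : ℝ => h⁻¹ • (W h w - w)) (𝓝[>] 0) (𝓝 z)) : inner ℝ z w ≤ 0 := by
  refine le_of_tendsto (h.inner tendsto_const_nhds) ?_
  filter_upwards [self_mem_nhdsWithin] with r hr
  have hr' : (0 : ℝ) < r := hr
  rw [inner_smul_left, inner_sub_left, real_inner_self_eq_norm_sq]
  refine mul_nonpos_of_nonneg_of_nonpos (by simpa using hr'.le) ?_
  have h1 := real_inner_le_norm (W r w) w
  have h2 := hW.norm_le hr'.le w
  nlinarith [norm_nonneg w]

lemma hasDerivWithinAt (hW : IsContractionSemigroup W) {w z : X}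
    (h : Tendsto (fun h : ℝ => h⁻¹ • (W h w - w)) (𝓝[>] 0) (𝓝 z)) {t : ℝ} (ht : 0 ≤ t) :
    HasDerivWithinAt (fun t => W t w) (W t z) (Ioi t) t := by
  rw [hasDerivWithinAt_iff_tendsto_slope' self_notMem_Ioi]
  have h1 : Tendsto (fun s => s - t) (𝓝[>] t) (𝓝[>] 0) := by
    rw [tendsto_nhdsWithin_iff]
    refine ⟨tendsto_nhdsWithin_of_tendsto_nhds ?_, ?_⟩
    · have : Continuous fun s : ℝ => s - t := by fun_prop
      simpa using this.tendsto t
    · filter_upwards [self_mem_nhdsWithin] with s hs using mem_Ioi.2 (sub_pos.2 (mem_Ioi.1 hs))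
  have h2 := ((W t).continuous.tendsto z).comp (h.comp h1)
  refine h2.congr' ?_
  filter_upwards [self_mem_nhdsWithin] with s hs
  have hs' : 0 ≤ s - t := sub_nonneg.2 (mem_Ioi.1 hs).le
  simp only [Function.comp_apply, map_smul, map_sub, slope, vsub_eq_sub]
  rw [← hW.add_apply ht hs', add_sub_cancel]

lemma sub_eq_integral [CompleteSpace X] (hW : IsContractionSemigroup W) {w z : X}
    (h : Tendsto (fun h : ℝ => h⁻¹ • (W h w - w)) (𝓝[>] 0) (𝓝 z)) {t : ℝ} (ht : 0 ≤ t) :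
    W t w - w = ∫ s in (0 : ℝ)..t, W s z := by
  have h1 := intervalIntegral.integral_eq_sub_of_hasDeriv_right (a := 0) (b := t)
    (f := fun s => W s w) (f' := fun s => W s z)
    ((hW.continuousOn w).mono (by rw [uIcc_of_le ht]; exact Icc_subset_Ici_self))
    (fun s hs => hW.hasDerivWithinAt h (by
      rw [min_eq_left ht] at hs; exact hs.1.le))
    (hW.intervalIntegrable z le_rfl ht)
  rw [h1, hW.zero_apply]

/-- Converse of `sub_eq_integral`: the integral identity, which is stable under limits,
characterizes the generator. -/
lemma tendsto_of_integral [CompleteSpace X] (hW : IsContractionSemigroup W) {w z : X}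
    (h : ∀ t, 0 ≤ t → W t w - w = ∫ s in (0 : ℝ)..t, W s z) :
    Tendsto (fun h : ℝ => h⁻¹ • (W h w - w)) (𝓝[>] 0) (𝓝 z) := by
  rw [Metric.tendsto_nhds]
  intro ε hε
  have h1 := Metric.tendsto_nhdsWithin_nhds.1 (hW.tendsto_zero z) (ε / 2) (by positivity)
  obtain ⟨δ, hδ, h1⟩ := h1
  filter_upwards [Ioo_mem_nhdsGT hδ] with r hr
  have h2 : ‖∫ s in (0 : ℝ)..r, (W s z - z)‖ ≤ (ε / 2) * |r - 0| := by
    refine intervalIntegral.norm_integral_le_of_norm_le_const fun s hs => ?_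
    rw [uIoc_of_le hr.1.le] at hs
    have := h1 (mem_Ici.2 hs.1.le) (by
      rw [dist_zero_right, Real.norm_of_nonneg hs.1.le]; exact hs.2.trans_lt hr.2)
    rw [dist_eq_norm] at this
    exact this.le
  rw [intervalIntegral.integral_sub (hW.intervalIntegrable z le_rfl hr.1.le)
    intervalIntegrable_const, ← h r hr.1.le, intervalIntegral.integral_const, sub_zero,
    abs_of_pos hr.1] at h2
  rw [dist_eq_norm]
  have h3 : r⁻¹ • (W r w - w) - z = r⁻¹ • (W r w - w - r • z) := by
    rw [smul_sub r⁻¹ _ (r • z), inv_smul_smul₀ hr.1.ne']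
  rw [h3, norm_smul, norm_inv, Real.norm_of_nonneg hr.1.le, inv_mul_eq_div]
  calc _ ≤ ε / 2 * r / r := by gcongr; exact hr.1.le
    _ = ε / 2 := mul_div_cancel_right₀ _ hr.1.ne'
    _ < ε := by linarith

end IsContractionSemigroup

/-- The Hille–Yosida theorem in Hilbert spaces. -/
theorem IsMaxDissipative.exists_semigroup [CompleteSpace X] {G : X → X → Prop}
    (hG : IsMaxDissipative G) :
    ∃ W : ℝ → X →L[ℝ] X, IsContractionSemigroup W ∧ IsGenerator G W := by
  have hex : ∀ t : ℝ, ∃ S : X →L[ℝ] X, 0 ≤ t →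
      ∀ x, Tendsto (fun n => hG.approx n t x) atTop (𝓝 (S x)) := fun t => by
    by_cases ht : 0 ≤ t
    · choose f hf using fun x => cauchySeq_tendsto_of_complete (hG.cauchySeq_approx ht x)
      exact ⟨continuousLinearMapOfTendsto (fun n => hG.approx n t) (f := f)
        (tendsto_pi_nhds.2 hf), fun _ => hf⟩
    · exact ⟨0, fun h => absurd h ht⟩
  choose W hW using hex
  have hnorm : ∀ t, 0 ≤ t → ∀ x, ‖W t x‖ ≤ ‖x‖ := fun t ht x =>
    le_of_tendsto (hW t ht x).norm (Eventually.of_forall fun n => hG.norm_approx_le n ht x)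
  have hadd : ∀ s t : ℝ, 0 ≤ s → 0 ≤ t → W (s + t) = (W s).comp (W t) := by
    intro s t hs ht
    ext x
    refine tendsto_nhds_unique (hW _ (add_nonneg hs ht) x) ?_
    have h1 : Tendsto (fun n => hG.approx n s (hG.approx n t x - W t x)) atTop (𝓝 0) := by
      refine squeeze_zero_norm (fun n => hG.norm_approx_le n hs _) ?_
      have := ((hW t ht x).sub_const (W t x)).norm
      simpa using this
    have h2 := h1.add (hW s hs (W t x))
    simp only [map_sub, sub_add_cancel, zero_add] at h2
    simpa [hG.approx_add] using h2
  have hderiv : ∀ (n : ℕ) (x : X) (s : ℝ),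
      HasDerivAt (fun s => hG.approx n s x) (hG.approx n s (hG.yosida n x)) s := fun n x s => by
    simpa using (hG.hasDerivAt_approx n s).clm_apply (hasDerivAt_const s x)
  have happrox : ∀ (n : ℕ) (x : X), Continuous fun s => hG.approx n s x := fun n x =>
    continuous_iff_continuousAt.2 fun s => (hderiv n x s).continuousAt
  -- The identity for the approximate semigroups passes to the limit by dominated convergence, since
  -- `‖A_n w‖ = ‖J_n z‖ ≤ ‖z‖`.
  have hint : ∀ {w z}, G w z → ∀ t, 0 ≤ t → W t w - w = ∫ s in (0 : ℝ)..t, W s z := by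
    intro w z h t ht
    have h1 : ∀ n, ∫ s in (0 : ℝ)..t, hG.approx n s (hG.yosida n w) = hG.approx n t w - w :=
      fun n => by
        rw [intervalIntegral.integral_eq_sub_of_hasDerivAt (fun s _ => hderiv n w s)
          ((happrox n _).intervalIntegrable _ _), hG.approx_zero, one_apply_eq_self]
    refine tendsto_nhds_unique ((hW t ht w).sub_const w) ?_
    simp only [← h1]
    refine intervalIntegral.tendsto_integral_filter_of_dominated_convergence (fun _ => ‖z‖)
      (Eventually.of_forall fun n => (happrox n _).aestronglyMeasurable)
      (Eventually.of_forall fun n => Eventually.of_forall fun s hs => ?_)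
      intervalIntegrable_const (Eventually.of_forall fun s hs => ?_)
    · rw [uIoc_of_le ht] at hs
      refine (hG.norm_approx_le n hs.1.le _).trans ?_
      rw [hG.yosida_apply, hG.J_sub_self h]
      exact hG.norm_J_le n z
    · rw [uIoc_of_le ht] at hs
      have h2 : Tendsto (fun n => hG.approx n s (hG.yosida n w - z)) atTop (𝓝 0) := by
        refine squeeze_zero_norm (fun n => hG.norm_approx_le n hs.1.le _) ?_
        have := ((hG.tendsto_yosida h).sub_const z).norm
        simpa using this
      have h3 := h2.add (hW s hs.1.le z)
      simpa only [map_sub, sub_add_cancel, zero_add] using h3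
  have hS : IsContractionSemigroup W := by
    refine ⟨?_, hadd, fun t ht => ?_, fun u => ?_⟩
    · ext x
      refine tendsto_nhds_unique (hW 0 le_rfl x) ?_
      simp [hG.approx_zero]
    · exact ContinuousLinearMap.opNorm_le_bound _ zero_le_one fun x => by
        rw [one_mul]; exact hnorm t ht x
    · have h : Tendsto (fun t => (W t - 1) u) (𝓝[>] 0) (𝓝 0) := by
        refine tendsto_zero_of_dense (C := 2) ?_ hG.dense_range_J ?_ u
        · filter_upwards [self_mem_nhdsWithin] with t ht x
          refine (norm_sub_le _ _).trans ?_
          have := hnorm t (le_of_lt ht) x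
          change ‖W t x‖ + ‖x‖ ≤ 2 * ‖x‖
          linarith
        · rintro _ ⟨v, rfl⟩
          have h0 := hG.J_graph 0 v
          set w := hG.J 0 v
          set z := (((0 : ℕ) : ℝ) + 1) • (w - v)
          refine squeeze_zero_norm' (a := fun t => ‖z‖ * |t - 0|) ?_ ?_
          · filter_upwards [self_mem_nhdsWithin] with t ht
            have ht' : (0 : ℝ) < t := ht
            change ‖W t w - w‖ ≤ _
            rw [hint h0 t ht'.le]
            refine intervalIntegral.norm_integral_le_of_norm_le_const fun s hs => ?_
            rw [uIoc_of_le ht'.le] at hs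
            exact hnorm s hs.1.le z
          · refine tendsto_nhdsWithin_of_tendsto_nhds ?_
            have : Continuous fun t : ℝ => ‖z‖ * |t - 0| := by fun_prop
            simpa using this.tendsto 0
      simpa using h.add_const u
  refine ⟨W, hS, fun w z => ⟨fun h => ?_, fun h => hS.tendsto_of_integral (hint h)⟩⟩
  -- The generator is dissipative and extends `G`, for which `1 - A` is already onto. The vectors
  -- `w` and `w'` have the same image under `1 - A`, so dissipativity applied to `w - w'` shows that
  -- they coincide.
  obtain ⟨w', z', h1, h2⟩ := hG.onto one_pos (w - z)
  have h3 := hS.tendsto_of_integral (hint h1)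
  have h4 : Tendsto (fun h : ℝ => h⁻¹ • (W h (w - w') - (w - w'))) (𝓝[>] 0) (𝓝 (z - z')) := by
    refine (h.sub h3).congr fun r => ?_
    rw [← smul_sub, map_sub]; congr 1; abel
  have h5 := hS.inner_generator_nonpos h4
  have h6 : z - z' = w - w' := by
    rw [one_smul] at h2
    rw [← sub_eq_zero, ← sub_eq_zero.2 h2]; abel
  rw [h6, real_inner_self_eq_norm_sq] at h5
  have h7 : w - w' = 0 := norm_eq_zero.1 (pow_eq_zero_iff two_ne_zero |>.1
    (le_antisymm h5 (sq_nonneg _)))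
  rw [sub_eq_zero.1 h7, sub_eq_zero.1 (h6.trans h7)]
  exact h1

end

/-! ### Mild solutions, their resolvent formulation, and the energy identity. -/

noncomputable section

variable {X : Type*} [NormedAddCommGroup X] [InnerProductSpace ℝ X]

lemma intervalIntegrable_clm_comp (S : X →L[ℝ] X) {f : ℝ → X} {a b : ℝ}
    (hf : IntervalIntegrable f volume a b) : IntervalIntegrable (fun s => S (f s)) volume a b :=
  ⟨S.integrable_comp hf.1, S.integrable_comp hf.2⟩

/-- The mild solution of `y' = A y + F`, `y(0) = y₀`, for the semigroup `W` generated by `A`. -/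
def mild (W : ℝ → X →L[ℝ] X) (y₀ : X) (F : ℝ → X) (t : ℝ) : X :=
  W t y₀ + ∫ s in (0 : ℝ)..t, W (t - s) (F s)

namespace IsContractionSemigroup

variable {W : ℝ → X →L[ℝ] X}

lemma aestronglyMeasurable_comp (hW : IsContractionSemigroup W) {α : Type*} [MeasurableSpace α]
    {μ : Measure α} {r : α → ℝ} {f : α → X} (hr : AEStronglyMeasurable r μ)
    (hf : AEStronglyMeasurable f μ) :
    AEStronglyMeasurable (fun a => W (max (r a) 0) (f a)) μ :=
  hW.continuous_uncurry.comp_aestronglyMeasurable (hr.prodMk hf)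

lemma intervalIntegrable_conv (hW : IsContractionSemigroup W) {F : ℝ → X} {a t : ℝ}
    (hat : a ≤ t) (hF : IntervalIntegrable F volume a t) :
    IntervalIntegrable (fun s => W (t - s) (F s)) volume a t := by
  rw [intervalIntegrable_iff_integrableOn_Ioc_of_le hat] at hF ⊢
  have h1 : AEStronglyMeasurable (fun s => W (max (t - s) 0) (F s))
      (volume.restrict (Ioc a t)) :=
    hW.aestronglyMeasurable_comp (by fun_prop) hF.aestronglyMeasurable
  have he : (fun s => W (max (t - s) 0) (F s)) =ᵐ[volume.restrict (Ioc a t)]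
      fun s => W (t - s) (F s) := by
    filter_upwards [ae_restrict_mem measurableSet_Ioc] with s hs
    rw [max_eq_left (sub_nonneg.2 hs.2)]
  refine Integrable.mono hF (h1.congr he) ?_
  filter_upwards [ae_restrict_mem measurableSet_Ioc] with s hs
  exact hW.norm_le (sub_nonneg.2 hs.2) _

lemma continuousOn_conv [CompleteSpace X] (hW : IsContractionSemigroup W) {F : ℝ → X} {T : ℝ}
    (hT : 0 ≤ T) (hF : IntervalIntegrable F volume 0 T) :
    ContinuousOn (fun t => ∫ s in (0 : ℝ)..t, W (t - s) (F s)) (Icc 0 T) := by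
  have hF' := (intervalIntegrable_iff_integrableOn_Ioc_of_le hT).1 hF
  -- Extending the kernel by zero for `s ≥ t` fixes the interval of integration. As a function of
  -- `t` the kernel jumps at `t₀` only for `s = t₀`, so dominated convergence by `‖F s‖` applies.
  let K : ℝ → ℝ → X := fun t => (Iio t).indicator fun s => W (max (t - s) 0) (F s)
  have hK : ∀ t ∈ Icc 0 T, ∫ s in (0 : ℝ)..t, W (t - s) (F s) = ∫ s in (0 : ℝ)..T, K t s := by
    intro t ht
    rw [intervalIntegral.integral_of_le ht.1, intervalIntegral.integral_of_le hT,
      setIntegral_indicator measurableSet_Iio, integral_Ioc_eq_integral_Ioo]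
    have : Ioc 0 T ∩ Iio t = Ioo 0 t := by
      ext s; simp only [mem_inter_iff, mem_Ioc, mem_Iio, mem_Ioo]
      exact ⟨fun h => ⟨h.1.1, h.2⟩, fun h => ⟨⟨h.1, h.2.le.trans ht.2⟩, h.2⟩⟩
    rw [this]
    refine setIntegral_congr_fun measurableSet_Ioo fun s hs => ?_
    simp only [max_eq_left (sub_nonneg.2 hs.2.le)]
  have hcont : Continuous fun t => ∫ s in (0 : ℝ)..T, K t s := by
    rw [continuous_iff_continuousAt]
    intro t₀
    refine intervalIntegral.continuousAt_of_dominated_interval (bound := fun s => ‖F s‖)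
      (Eventually.of_forall fun t => ?_) (Eventually.of_forall fun t => ?_) hF.norm ?_
    · rw [uIoc_of_le hT]
      exact (hW.aestronglyMeasurable_comp (by fun_prop) hF'.aestronglyMeasurable).indicator
        measurableSet_Iio
    · refine Eventually.of_forall fun s _ => ?_
      exact (norm_indicator_le_norm_self _ _).trans (hW.norm_le (le_max_right _ _) _)
    · have : ∀ᵐ s : ℝ ∂volume, s ≠ t₀ := by simp [ae_iff, measure_singleton]
      filter_upwards [this] with s hs _
      rcases lt_or_gt_of_ne hs with h | h
      · have h1 : ContinuousAt (fun t => W (max (t - s) 0) (F s)) t₀ :=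
          (hW.continuous_uncurry.comp (by fun_prop :
            Continuous fun t : ℝ => ((t - s, F s) : ℝ × X))).continuousAt
        refine h1.congr ?_
        filter_upwards [lt_mem_nhds h] with t ht
        exact (indicator_of_mem (mem_Iio.2 ht) (fun s => W (max (t - s) 0) (F s))).symm
      · refine (continuousAt_const (y := (0 : X))).congr ?_
        filter_upwards [gt_mem_nhds h] with t ht
        exact (indicator_of_notMem (fun h' => lt_asymm ht (mem_Iio.1 h'))
          (fun s => W (max (t - s) 0) (F s))).symm
  exact hcont.continuousOn.congr hK

lemma continuousOn_mild [CompleteSpace X] (hW : IsContractionSemigroup W) (y₀ : X) {F : ℝ → X}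
    {T : ℝ} (hT : 0 ≤ T) (hF : IntervalIntegrable F volume 0 T) :
    ContinuousOn (mild W y₀ F) (Icc 0 T) :=
  ((hW.continuousOn y₀).mono Icc_subset_Ici_self).add (hW.continuousOn_conv hT hF)

lemma norm_mild_le (hW : IsContractionSemigroup W) (y₀ : X) {F : ℝ → X} {t : ℝ} (ht : 0 ≤ t)
    (hF : IntervalIntegrable F volume 0 t) :
    ‖mild W y₀ F t‖ ≤ ‖y₀‖ + ∫ s in (0 : ℝ)..t, ‖F s‖ := by
  refine (norm_add_le _ _).trans (add_le_add (hW.norm_le ht _) ?_)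
  refine intervalIntegral.norm_integral_le_of_norm_le ht ?_ hF.norm
  refine Eventually.of_forall fun s hs => hW.norm_le (sub_nonneg.2 hs.2) _

lemma mild_sub (hW : IsContractionSemigroup W) (y₀ z₀ : X) {F F' : ℝ → X} {t : ℝ} (ht : 0 ≤ t)
    (hF : IntervalIntegrable F volume 0 t) (hF' : IntervalIntegrable F' volume 0 t) :
    mild W (y₀ - z₀) (fun s => F s - F' s) t = mild W y₀ F t - mild W z₀ F' t := by
  simp only [mild, map_sub]
  rw [intervalIntegral.integral_sub (hW.intervalIntegrable_conv ht hF)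
    (hW.intervalIntegrable_conv ht hF')]
  abel

/-- Restarting a mild solution at a later time. -/
lemma mild_add [CompleteSpace X] (hW : IsContractionSemigroup W) (y₀ : X) {F : ℝ → X} {r t : ℝ}
    (hr : 0 ≤ r) (ht : 0 ≤ t) (hF : IntervalIntegrable F volume 0 (r + t)) :
    mild W y₀ F (r + t) = mild W (mild W y₀ F r) (fun s => F (r + s)) t := by
  have h1 : IntervalIntegrable F volume 0 r := hF.mono_set (by
    rw [uIcc_of_le hr, uIcc_of_le (by linarith)]; exact Icc_subset_Icc_right (by linarith))
  have h2 : IntervalIntegrable F volume r (r + t) := hF.mono_set (by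
    rw [uIcc_of_le (by linarith), uIcc_of_le (by linarith)]; exact Icc_subset_Icc_left hr)
  have h3 := hW.intervalIntegrable_conv (by linarith) hF
  have h4 := hW.intervalIntegrable_conv (by linarith) h2
  have h5 : IntervalIntegrable (fun s => W (r + t - s) (F s)) volume 0 r := h3.mono_set (by
    rw [uIcc_of_le hr, uIcc_of_le (by linarith)]; exact Icc_subset_Icc_right (by linarith))
  simp only [mild]
  rw [_root_.map_add, ← hW.add_apply ht hr, add_comm t r, add_assoc,
    ← intervalIntegral.integral_add_adjacent_intervals h5 h4,
    ← (W t).intervalIntegral_comp_comm (hW.intervalIntegrable_conv hr h1)]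
  congr 2
  · refine intervalIntegral.integral_congr fun s hs => ?_
    rw [uIcc_of_le hr] at hs
    rw [← hW.add_apply ht (sub_nonneg.2 hs.2)]
    congr 2; ring
  · have := intervalIntegral.integral_comp_add_left (a := 0) (b := t)
      (fun s => W (r + t - s) (F s)) r
    rw [add_zero] at this
    rw [← this]
    refine intervalIntegral.integral_congr fun s _ => ?_
    congr 2; ring

/-- Fubini on the triangle `s < r`, with the kernel extended by zero to the square. -/
lemma integral_swap [CompleteSpace X] (hW : IsContractionSemigroup W) {f : ℝ → X} {t : ℝ}
    (ht : 0 ≤ t) (hf : IntervalIntegrable f volume 0 t) :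
    ∫ s in (0 : ℝ)..t, ∫ r in s..t, W (r - s) (f s) =
      ∫ r in (0 : ℝ)..t, ∫ s in (0 : ℝ)..r, W (r - s) (f s) := by
  have hf' := (intervalIntegrable_iff_integrableOn_Ioc_of_le ht).1 hf
  set μ := volume.restrict (Ioc 0 t) with hμ
  let K : ℝ → ℝ → X := fun s r => {p : ℝ × ℝ | p.1 < p.2}.indicator
    (fun p => W (max (p.2 - p.1) 0) (f p.1)) (s, r)
  have hset : MeasurableSet {p : ℝ × ℝ | p.1 < p.2} :=
    measurableSet_lt measurable_fst measurable_snd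
  have hK : Integrable (Function.uncurry K) (μ.prod μ) := by
    have hfst : Integrable (fun p : ℝ × ℝ => f p.1) (μ.prod μ) := hf'.comp_fst μ
    have hm : AEStronglyMeasurable (fun p : ℝ × ℝ => W (max (p.2 - p.1) 0) (f p.1)) (μ.prod μ) :=
      hW.aestronglyMeasurable_comp (by fun_prop) hfst.aestronglyMeasurable
    refine hfst.mono (hm.indicator hset) (Eventually.of_forall fun p => ?_)
    exact (norm_indicator_le_norm_self (fun p : ℝ × ℝ => W (max (p.2 - p.1) 0) (f p.1)) p).trans
      (hW.norm_le (le_max_right _ _) _)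
  have h1 : ∫ s in (0 : ℝ)..t, ∫ r in s..t, W (r - s) (f s) = ∫ s, ∫ r, K s r ∂μ ∂μ := by
    rw [intervalIntegral.integral_of_le ht]
    refine setIntegral_congr_fun measurableSet_Ioc fun s hs => ?_
    have e : (fun r => K s r) = (Ioi s).indicator fun r => W (max (r - s) 0) (f s) := by
      funext r
      by_cases h : s < r
      · rw [indicator_of_mem (mem_Ioi.2 h)]
        exact indicator_of_mem (s := {p : ℝ × ℝ | p.1 < p.2}) h _
      · rw [indicator_of_notMem (fun h' => h (mem_Ioi.1 h'))]
        exact indicator_of_notMem (s := {p : ℝ × ℝ | p.1 < p.2}) h _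
    simp only [e, hμ]
    rw [setIntegral_indicator measurableSet_Ioi, intervalIntegral.integral_of_le hs.2]
    have : Ioc 0 t ∩ Ioi s = Ioc s t := by
      ext r; simp only [mem_inter_iff, mem_Ioc, mem_Ioi]
      exact ⟨fun h => ⟨h.2, h.1.2⟩, fun h => ⟨⟨hs.1.trans h.1, h.2⟩, h.1⟩⟩
    rw [this]
    refine setIntegral_congr_fun measurableSet_Ioc fun r hr => ?_
    simp only [max_eq_left (sub_nonneg.2 hr.1.le)]
  have h2 : ∫ r in (0 : ℝ)..t, ∫ s in (0 : ℝ)..r, W (r - s) (f s) = ∫ r, ∫ s, K s r ∂μ ∂μ := by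
    rw [intervalIntegral.integral_of_le ht]
    refine setIntegral_congr_fun measurableSet_Ioc fun r hr => ?_
    have e : (fun s => K s r) = (Iio r).indicator fun s => W (max (r - s) 0) (f s) := by
      funext s
      by_cases h : s < r
      · rw [indicator_of_mem (mem_Iio.2 h)]
        exact indicator_of_mem (s := {p : ℝ × ℝ | p.1 < p.2}) h _
      · rw [indicator_of_notMem (fun h' => h (mem_Iio.1 h'))]
        exact indicator_of_notMem (s := {p : ℝ × ℝ | p.1 < p.2}) h _
    simp only [e, hμ]
    rw [setIntegral_indicator measurableSet_Iio, intervalIntegral.integral_of_le hr.1.le,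
      integral_Ioc_eq_integral_Ioo]
    have : Ioc 0 t ∩ Iio r = Ioo 0 r := by
      ext s; simp only [mem_inter_iff, mem_Ioc, mem_Iio, mem_Ioo]
      exact ⟨fun h => ⟨h.1.1, h.2⟩, fun h => ⟨⟨h.1, h.2.le.trans hr.2⟩, h.2⟩⟩
    rw [this]
    refine setIntegral_congr_fun measurableSet_Ioo fun s hs => ?_
    simp only [max_eq_left (sub_nonneg.2 hs.2.le)]
  rw [h1, h2, integral_integral_swap hK]

end IsContractionSemigroup

section

variable {G : X → X → Prop} {W : ℝ → X →L[ℝ] X}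

/-- `W t` preserves the domain and commutes with the generator, so `W t (J_n x)` solves the
resolvent equation with datum `W t x`. -/
lemma IsMaxDissipative.J_semigroup (hG : IsMaxDissipative G) (hW : IsContractionSemigroup W)
    (hA : IsGenerator G W) (n : ℕ) {t : ℝ} (ht : 0 ≤ t) (x : X) :
    hG.J n (W t x) = W t (hG.J n x) := by
  refine hG.resolvent_unique (hG.J_graph n (W t x)) ?_
  rw [← map_sub, ← map_smul, ← hA]
  have h := (hA _ _).2 (hG.J_graph n x)
  refine (((W t).continuous.tendsto _).comp h).congr' ?_
  filter_upwards [self_mem_nhdsWithin] with r hr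
  have hr' : (0 : ℝ) ≤ r := (mem_Ioi.1 hr).le
  simp only [Function.comp_apply, map_smul, map_sub]
  rw [← hW.add_apply ht hr', add_comm, hW.add_apply hr' ht]

lemma IsMaxDissipative.yosida_semigroup (hG : IsMaxDissipative G) (hW : IsContractionSemigroup W)
    (hA : IsGenerator G W) (n : ℕ) {t : ℝ} (ht : 0 ≤ t) (x : X) :
    hG.yosida n (W t x) = W t (hG.yosida n x) := by
  rw [hG.yosida_apply, hG.yosida_apply, hG.J_semigroup hW hA n ht, map_smul, map_sub]

/-- `y` solves `y' = A y + F`, `y(0) = y₀` on `[0, T]` in the sense that the equation holds after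
applying the resolvents of `A`. -/
structure IsResolventSolution (hG : IsMaxDissipative G) (T : ℝ) (y₀ : X) (F y : ℝ → X) : Prop where
  continuousOn : ContinuousOn y (Icc 0 T)
  integrable : IntervalIntegrable F volume 0 T
  eq : ∀ n, ∀ t ∈ Icc 0 T, hG.J n (y t) =
    hG.J n y₀ + ∫ s in (0 : ℝ)..t, (hG.yosida n (y s) + hG.J n (F s))

lemma intervalIntegrable_initial {E : Type*} [NormedAddCommGroup E] {F : ℝ → E} {T t : ℝ}
    (hF : IntervalIntegrable F volume 0 T) (ht : t ∈ Icc 0 T) : IntervalIntegrable F volume 0 t :=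
  hF.mono_set (by
    rw [uIcc_of_le ht.1, uIcc_of_le (ht.1.trans ht.2)]; exact Icc_subset_Icc_right ht.2)

/-- `J_n` maps into the domain, where `W_r J_n x = J_n x + ∫_0^r W_s A_n x ds`. Inserting this in
the variation of constants formula and exchanging the integrals reassembles `A_n y` under a single
integral. -/
lemma isResolventSolution_mild [CompleteSpace X] (hG : IsMaxDissipative G)
    (hW : IsContractionSemigroup W) (hA : IsGenerator G W) {T : ℝ} (hT : 0 ≤ T) (y₀ : X)
    {F : ℝ → X} (hF : IntervalIntegrable F volume 0 T) :
    IsResolventSolution hG T y₀ F (mild W y₀ F) := by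
  refine ⟨hW.continuousOn_mild y₀ hT hF, hF, fun n t ht => ?_⟩
  have hFt := intervalIntegrable_initial hF ht
  have hY : IntervalIntegrable (fun s => hG.yosida n (F s)) volume 0 t :=
    intervalIntegrable_clm_comp _ hFt
  have hY' : ∀ {r}, r ∈ Icc 0 t → ∫ s in (0 : ℝ)..r, W (r - s) (hG.yosida n (F s)) =
      hG.yosida n (∫ s in (0 : ℝ)..r, W (r - s) (F s)) := fun {r} hr => by
    rw [← (hG.yosida n).intervalIntegral_comp_comm
      (hW.intervalIntegrable_conv hr.1 (intervalIntegrable_initial hFt hr))]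
    refine intervalIntegral.integral_congr fun s hs => ?_
    rw [uIcc_of_le hr.1] at hs
    exact (hG.yosida_semigroup hW hA n (sub_nonneg.2 hs.2) _).symm
  have h1 : hG.J n (W t y₀) = hG.J n y₀ + ∫ s in (0 : ℝ)..t, hG.yosida n (W s y₀) := by
    have := hW.sub_eq_integral ((hA _ _).2 (hG.J_graph n y₀)) ht.1
    rw [hG.J_semigroup hW hA n ht.1, ← sub_eq_iff_eq_add', this]
    refine intervalIntegral.integral_congr fun s hs => ?_
    rw [uIcc_of_le ht.1] at hs
    exact (hG.yosida_semigroup hW hA n hs.1 _).symm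
  have h2 : ∀ s ∈ Icc 0 t, hG.J n (W (t - s) (F s)) =
      hG.J n (F s) + ∫ r in s..t, W (r - s) (hG.yosida n (F s)) := fun s hs => by
    have h := hW.sub_eq_integral ((hA _ _).2 (hG.J_graph n (F s))) (sub_nonneg.2 hs.2)
    rw [hG.J_semigroup hW hA n (sub_nonneg.2 hs.2), ← sub_eq_iff_eq_add', h]
    have e := intervalIntegral.integral_comp_sub_right (a := s) (b := t)
      (fun r => W r (hG.yosida n (F s))) s
    rw [sub_self] at e
    exact e.symm
  have hJ : IntervalIntegrable (fun s => hG.J n (F s)) volume 0 t :=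
    intervalIntegrable_clm_comp _ hFt
  have h3 : IntervalIntegrable (fun s => ∫ r in s..t, W (r - s) (hG.yosida n (F s)))
      volume 0 t := by
    have h4 : IntervalIntegrable (fun s => hG.J n (W (t - s) (F s)) - hG.J n (F s)) volume 0 t :=
      IntervalIntegrable.sub
        (intervalIntegrable_clm_comp _ (hW.intervalIntegrable_conv ht.1 hFt)) hJ
    refine h4.congr ?_
    intro s hs
    rw [uIoc_of_le ht.1] at hs
    simp only
    rw [h2 s ⟨hs.1.le, hs.2⟩, add_sub_cancel_left]
  have hcy : ContinuousOn (mild W y₀ F) (uIcc 0 t) := by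
    rw [uIcc_of_le ht.1]
    exact hW.continuousOn_mild y₀ ht.1 hFt
  have hcW : ContinuousOn (fun s => hG.yosida n (W s y₀)) (uIcc 0 t) := by
    rw [uIcc_of_le ht.1]
    exact (hG.yosida n).continuous.comp_continuousOn
      ((hW.continuousOn y₀).mono Icc_subset_Ici_self)
  have hcc : ContinuousOn (fun r => ∫ s in (0 : ℝ)..r, W (r - s) (hG.yosida n (F s)))
      (uIcc 0 t) := by
    rw [uIcc_of_le ht.1]
    exact hW.continuousOn_conv ht.1 hY
  have h5 : hG.J n (∫ s in (0 : ℝ)..t, W (t - s) (F s)) =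
      (∫ s in (0 : ℝ)..t, hG.J n (F s)) +
        ∫ r in (0 : ℝ)..t, ∫ s in (0 : ℝ)..r, W (r - s) (hG.yosida n (F s)) := by
    rw [← hW.integral_swap ht.1 hY, ← intervalIntegral.integral_add hJ h3,
      ← (hG.J n).intervalIntegral_comp_comm (hW.intervalIntegrable_conv ht.1 hFt)]
    refine intervalIntegral.integral_congr fun s hs => ?_
    rw [uIcc_of_le ht.1] at hs
    exact h2 s hs
  rw [mild, map_add, h1, h5, intervalIntegral.integral_add
    (intervalIntegrable_clm_comp _ hcy.intervalIntegrable) hJ]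
  have h6 : ∫ s in (0 : ℝ)..t, hG.yosida n (mild W y₀ F s) =
      (∫ s in (0 : ℝ)..t, hG.yosida n (W s y₀)) +
        ∫ r in (0 : ℝ)..t, ∫ s in (0 : ℝ)..r, W (r - s) (hG.yosida n (F s)) := by
    rw [← intervalIntegral.integral_add hcW.intervalIntegrable hcc.intervalIntegrable]
    refine intervalIntegral.integral_congr fun s hs => ?_
    rw [uIcc_of_le ht.1] at hs
    simp only [mild, map_add, hY' hs]
  rw [h6]
  abel

lemma IsResolventSolution.sub {hG : IsMaxDissipative G} {T : ℝ} {y₀ z₀ : X} {F F' y z : ℝ → X}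
    [CompleteSpace X]
    (hy : IsResolventSolution hG T y₀ F y) (hz : IsResolventSolution hG T z₀ F' z) :
    IsResolventSolution hG T (y₀ - z₀) (fun t => F t - F' t) (fun t => y t - z t) := by
  refine ⟨hy.continuousOn.sub hz.continuousOn, hy.integrable.sub hz.integrable, fun n t ht => ?_⟩
  have hi : ∀ {x₀ f x}, IsResolventSolution hG T x₀ f x →
      IntervalIntegrable (fun s => hG.yosida n (x s) + hG.J n (f s)) volume 0 t :=
    fun {x₀ f x} hx => by
      refine IntervalIntegrable.add ?_ (intervalIntegrable_clm_comp _
        (intervalIntegrable_initial hx.integrable ht))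
      refine ContinuousOn.intervalIntegrable ?_
      rw [uIcc_of_le ht.1]
      exact (hG.yosida n).continuous.comp_continuousOn
        (hx.continuousOn.mono (Icc_subset_Icc_right ht.2))
  rw [map_sub, hy.eq n t ht, hz.eq n t ht, map_sub, add_sub_add_comm,
    ← intervalIntegral.integral_sub (hi hy) (hi hz)]
  congr 1
  refine intervalIntegral.integral_congr fun s _ => ?_
  simp only [map_sub]
  abel

end

lemma AbsolutelyContinuousOnInterval.of_dist_le {Y Z : Type*} [PseudoMetricSpace Y]
    [PseudoMetricSpace Z] {f : ℝ → Y} {g : ℝ → Z} {a b C : ℝ}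
    (hg : AbsolutelyContinuousOnInterval g a b)
    (h : ∀ x ∈ uIcc a b, ∀ y ∈ uIcc a b, dist (f x) (f y) ≤ C * dist (g x) (g y)) :
    AbsolutelyContinuousOnInterval f a b := by
  rw [absolutelyContinuousOnInterval_iff] at hg ⊢
  intro ε hε
  obtain ⟨δ, hδ, H⟩ := hg (ε / (|C| + 1)) (by positivity)
  refine ⟨δ, hδ, fun E hE hs => ?_⟩
  have h1 := H E hE hs
  calc _ ≤ ∑ i ∈ Finset.range E.1, (|C| + 1) * dist (g (E.2 i).1) (g (E.2 i).2) := by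
        refine Finset.sum_le_sum fun i hi => ?_
        have hm := hE.1 i hi
        refine (h _ hm.1 _ hm.2).trans ?_
        gcongr
        linarith [le_abs_self C]
    _ = (|C| + 1) * ∑ i ∈ Finset.range E.1, dist (g (E.2 i).1) (g (E.2 i).2) := by
        rw [Finset.mul_sum]
    _ < (|C| + 1) * (ε / (|C| + 1)) := by gcongr
    _ = ε := by field_simp

/-- The energy identity for primitives of integrable functions with values in a Hilbert space. -/
lemma inner_self_eq_integral [CompleteSpace X] {z h : ℝ → X} {T : ℝ} (hT : 0 ≤ T)
    (hh : IntervalIntegrable h volume 0 T)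
    (hz : ∀ t ∈ Icc 0 T, z t = z 0 + ∫ s in (0 : ℝ)..t, h s) {P : X →L[ℝ] X}
    (hP : ∀ x y, inner ℝ (P x) y = inner ℝ x (P y)) :
    inner ℝ (P (z T)) (z T) = inner ℝ (P (z 0)) (z 0) +
      2 * ∫ s in (0 : ℝ)..T, inner ℝ (P (z s)) (h s) := by
  set u : ℝ → X := fun t => z 0 + ∫ s in (0 : ℝ)..t, h s with hu
  have hu0 : u 0 = z 0 := by simp [hu]
  have huc : ContinuousOn u (uIcc 0 T) :=
    continuousOn_const.add (intervalIntegral.continuousOn_primitive_interval' hh left_mem_uIcc)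
  obtain ⟨B, hB⟩ := isCompact_uIcc.exists_bound_of_continuousOn huc
  have hnorm := hh.norm.absolutelyContinuousOnInterval_intervalIntegral (c := 0) left_mem_uIcc
  have hsub : ∀ x ∈ uIcc 0 T, ∀ y ∈ uIcc 0 T, IntervalIntegrable h volume x y := fun x hx y hy =>
    hh.mono_set (uIcc_subset_uIcc hx hy)
  have hlip : ∀ x ∈ uIcc 0 T, ∀ y ∈ uIcc 0 T,
      ‖u x - u y‖ ≤ dist (∫ s in (0 : ℝ)..x, ‖h s‖) (∫ s in (0 : ℝ)..y, ‖h s‖) := by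
    intro x hx y hy
    have h0 : (0 : ℝ) ∈ uIcc 0 T := left_mem_uIcc
    rw [dist_eq_norm, intervalIntegral.integral_interval_sub_left (hsub 0 h0 x hx).norm
      (hsub 0 h0 y hy).norm, hu]
    simp only [add_sub_add_left_eq_sub]
    rw [intervalIntegral.integral_interval_sub_left (hsub 0 h0 x hx) (hsub 0 h0 y hy)]
    exact intervalIntegral.norm_integral_le_abs_integral_norm
  -- The quadratic form along the curve oscillates at most as much as `∫ ‖h‖`, up to the factor
  -- `2‖P‖B`. It is therefore absolutely continuous, and its a.e. derivative integrates back to it.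
  have hac : AbsolutelyContinuousOnInterval (fun t => inner ℝ (P (u t)) (u t)) 0 T := by
    refine hnorm.of_dist_le (C := 2 * ‖P‖ * B) fun x hx y hy => ?_
    rw [Real.dist_eq]
    have e : inner ℝ (P (u x)) (u x) - inner ℝ (P (u y)) (u y) =
        inner ℝ (P (u x)) (u x - u y) + inner ℝ (P (u x - u y)) (u y) := by
      rw [map_sub, inner_sub_left, inner_sub_right]; ring
    have hB0 : 0 ≤ B := (norm_nonneg _).trans (hB x hx)
    rw [e]
    calc _ ≤ ‖P‖ * B * ‖u x - u y‖ + ‖P‖ * ‖u x - u y‖ * B := by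
          refine (abs_add_le _ _).trans (add_le_add ?_ ?_)
          · refine (abs_real_inner_le_norm _ _).trans ?_
            gcongr
            exact (P.le_opNorm _).trans (by gcongr; exact hB x hx)
          · refine (abs_real_inner_le_norm _ _).trans ?_
            gcongr
            · exact P.le_opNorm _
            · exact hB y hy
      _ = 2 * ‖P‖ * B * ‖u x - u y‖ := by ring
      _ ≤ _ := by gcongr; exact hlip x hx y hy
  have hmain := hac.integral_deriv_eq_sub
  have hd : ∫ s in (0 : ℝ)..T, deriv (fun t => inner ℝ (P (u t)) (u t)) s =
      2 * ∫ s in (0 : ℝ)..T, inner ℝ (P (z s)) (h s) := by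
    rw [← intervalIntegral.integral_const_mul]
    refine intervalIntegral.integral_congr_ae ?_
    filter_upwards [hh.ae_hasDerivAt_integral] with s hs hsm
    have hs' := hs (uIoc_subset_uIcc hsm) 0 left_mem_uIcc
    have hud : HasDerivAt u (h s) s := hs'.const_add (z 0)
    have hPd : HasDerivAt (fun t => P (u t)) (P (h s)) s := P.hasFDerivAt.comp_hasDerivAt s hud
    rw [(hPd.inner ℝ hud).deriv]
    rw [uIoc_of_le hT] at hsm
    have : u s = z s := (hz s ⟨hsm.1.le, hsm.2⟩).symm
    rw [this, hP (h s), real_inner_comm]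
    ring
  rw [hd] at hmain
  rw [hmain, hu0, hz T (right_mem_Icc.2 hT)]
  simp only [hu]
  ring

end

/-! ### Energy and multiplier identities for regularized KdV solutions. -/

noncomputable section

namespace KdV

variable {L : ℝ}

lemma isMaxDissipative_operatorGraph (L : ℝ) [Fact (0 < L)] :
    IsMaxDissipative (OperatorGraph L) where
  add := by
    intro w z w' z' h h'
    obtain ⟨c, w₂, w₃, h2, h0, rfl, rfl⟩ := operatorGraph_iff.1 h
    obtain ⟨c', w₂', w₃', h2', h0', rfl, rfl⟩ := operatorGraph_iff.1 h'
    refine operatorGraph_iff.2 ⟨c + c', w₂ + w₂', w₃ + w₃', ?_, ?_, ?_, ?_⟩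
    · rw [h2, h2', map_add, add_smul]; abel
    · rw [map_add, inner_add_left, h0, h0', add_zero]
    · simp only [map_add]
    · simp only [map_add]; abel
  smul := by
    intro r w z h
    obtain ⟨c, w₂, w₃, h2, h0, rfl, rfl⟩ := operatorGraph_iff.1 h
    refine operatorGraph_iff.2 ⟨r * c, r • w₂, r • w₃, ?_, ?_, ?_, ?_⟩
    · rw [h2, map_smul, mul_smul, smul_add]
    · rw [map_smul, inner_smul_left, h0, mul_zero]
    · simp only [map_smul]
    · simp only [map_smul, smul_sub, smul_neg]
  single := by
    intro z h
    obtain ⟨c, w₂, w₃, h2, h0, h3, rfl⟩ := operatorGraph_iff.1 h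
    have e1 : volterra L w₂ = 0 := volterra_injective (by rw [← h3, map_zero])
    have e2 : w₂ = 0 := volterra_injective (by rw [e1, map_zero])
    have e3 : IsWeakDeriv L 0 w₃ := isWeakDeriv_iff.2 ⟨c, by rw [← h2, e2]⟩
    rw [e1, e3.eq_zero]; simp
  nonpos := fun h => h.inner_nonpos
  onto := fun hl f => OperatorGraph.exists_resolvent hl f

variable [Fact (0 < L)]

/-- The derivative of a function in the domain of `A`. -/
lemma OperatorGraph.norm_deriv_sq {w z g : L2 L} (h : OperatorGraph L w z)
    (hg : w = volterra L g) :
    inner ℝ g (one L) = 0 ∧ 3 * ‖g‖ ^ 2 = ‖w‖ ^ 2 - 2 * inner ℝ z (mulX L w) := by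
  obtain ⟨g', h1, h2, h3⟩ := h.exists_deriv
  have e : g = g' := volterra_injective (by rw [← hg, h1])
  rw [e]
  exact ⟨h2, by rw [h3]; ring⟩

/-- The resolvents of `A`. -/
abbrev JA (L : ℝ) [Fact (0 < L)] (n : ℕ) : L2 L →L[ℝ] L2 L := (isMaxDissipative_operatorGraph L).J n

/-- The Yosida approximations of `A`. -/
abbrev YA (L : ℝ) [Fact (0 < L)] (n : ℕ) : L2 L →L[ℝ] L2 L :=
  (isMaxDissipative_operatorGraph L).yosida n

/-- The operator `∂_x J_n` is bounded, so `∂_x J_n y(s)` inherits the continuity of `y` in time. -/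
lemma exists_derivJ (n : ℕ) : ∃ D : L2 L →L[ℝ] L2 L, ∀ f, JA L n f = volterra L (D f) := by
  have hL : (0 : ℝ) < L := Fact.out
  have hJ := fun f => (isMaxDissipative_operatorGraph L).J_graph n f
  choose g hg _ _ using fun f => (hJ f).exists_deriv
  refine ⟨LinearMap.mkContinuous
    { toFun := g
      map_add' := fun f f' => volterra_injective (by
        rw [← hg, map_add, map_add, ← hg, ← hg])
      map_smul' := fun c f => volterra_injective (by
        rw [← hg, map_smul, map_smul, ← hg]; rfl) }
    -- The multiplier identity with `‖A J_n f‖ ≤ 2(n + 1)‖f‖` and `‖x J_n f‖ ≤ L‖f‖`.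
    (√(1 + 4 * (n + 1) * L)) fun f => ?_, hg⟩
  refine abs_le_of_sq_le_sq' ?_ (by positivity) |>.2
  rw [mul_pow, Real.sq_sqrt (by positivity)]
  change ‖g f‖ ^ 2 ≤ _
  have h1 := ((hJ f).norm_deriv_sq (hg f)).2
  have h2 := (isMaxDissipative_operatorGraph L).norm_J_le n f
  set w := (isMaxDissipative_operatorGraph L).J n f
  have h3 : ‖((n : ℝ) + 1) • (w - f)‖ ≤ 2 * (n + 1) * ‖f‖ := by
    rw [norm_smul, Real.norm_of_nonneg (by positivity)]
    have : ‖w - f‖ ≤ 2 * ‖f‖ := (norm_sub_le _ _).trans (by linarith)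
    calc _ ≤ ((n : ℝ) + 1) * (2 * ‖f‖) := by gcongr
      _ = _ := by ring
  have h4 : ‖mulX L w‖ ≤ L * ‖f‖ := (norm_mulX_le w).trans (by gcongr)
  have h5 : -inner ℝ (((n : ℝ) + 1) • (w - f)) (mulX L w) ≤ (2 * (n + 1) * ‖f‖) * (L * ‖f‖) := by
    refine (neg_le_abs _).trans ((abs_real_inner_le_norm _ _).trans ?_)
    gcongr
  have h6 : ‖w‖ ^ 2 ≤ ‖f‖ ^ 2 := by gcongr
  nlinarith [sq_nonneg ‖f‖, norm_nonneg f, sq_nonneg ‖g f‖]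

/-- The energy and multiplier identities for a regularized solution `Q y` with `Q` mapping into the
domain of `A`. -/
lemma energy_regularized {T : ℝ} {Q Y D : L2 L →L[ℝ] L2 L} {y₀ : L2 L} {F y : ℝ → L2 L}
    (hQ : ∀ f, OperatorGraph L (Q f) (Y f)) (hD : ∀ f, Q f = volterra L (D f))
    (hT : 0 ≤ T) (hy : ContinuousOn y (Icc 0 T)) (hF : IntervalIntegrable F volume 0 T)
    (he : ∀ t ∈ Icc 0 T, Q (y t) = Q y₀ + ∫ s in (0 : ℝ)..t, (Y (y s) + Q (F s))) :
    ‖Q (y T)‖ ^ 2 ≤ ‖Q y₀‖ ^ 2 + 2 * ∫ s in (0 : ℝ)..T, inner ℝ (Q (y s)) (Q (F s)) ∧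
    inner ℝ (mulX L (Q (y T))) (Q (y T)) + 3 * ∫ s in (0 : ℝ)..T, ‖D (y s)‖ ^ 2 =
      inner ℝ (mulX L (Q y₀)) (Q y₀) + (∫ s in (0 : ℝ)..T, ‖Q (y s)‖ ^ 2) +
        2 * ∫ s in (0 : ℝ)..T, inner ℝ (mulX L (Q (y s))) (Q (F s)) := by
  have hy' : ContinuousOn y (uIcc 0 T) := by rwa [uIcc_of_le hT]
  have hQF := intervalIntegrable_clm_comp Q hF
  have hc : ∀ S : L2 L →L[ℝ] L2 L, ContinuousOn (fun s => S (y s)) (uIcc 0 T) := fun S =>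
    S.continuous.comp_continuousOn hy'
  have hint : IntervalIntegrable (fun s => Y (y s) + Q (F s)) volume 0 T :=
    (hc Y).intervalIntegrable.add hQF
  have h0 : Q (y 0) = Q y₀ := by
    rw [he 0 (left_mem_Icc.2 hT), intervalIntegral.integral_same, add_zero]
  have hz : ∀ t ∈ Icc 0 T, Q (y t) = Q (y 0) + ∫ s in (0 : ℝ)..t, (Y (y s) + Q (F s)) :=
    fun t ht => by rw [h0]; exact he t ht
  have hii : ∀ {u v : ℝ → L2 L}, ContinuousOn u (uIcc 0 T) → IntervalIntegrable v volume 0 T →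
      IntervalIntegrable (fun s => inner ℝ (u s) (v s)) volume 0 T := by
    intro u v hu hv
    obtain ⟨B, hB⟩ := isCompact_uIcc.exists_bound_of_continuousOn hu
    rw [intervalIntegrable_iff_integrableOn_Ioc_of_le hT] at hv ⊢
    have hu' : AEStronglyMeasurable u (volume.restrict (Ioc 0 T)) := by
      rw [uIcc_of_le hT] at hu
      exact (hu.mono Ioc_subset_Icc_self).aestronglyMeasurable measurableSet_Ioc
    refine Integrable.mono' (hv.norm.const_mul B) (hu'.inner hv.aestronglyMeasurable) ?_
    filter_upwards [ae_restrict_mem measurableSet_Ioc] with s hs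
    refine (norm_inner_le_norm _ _).trans ?_
    gcongr
    exact hB s (by rw [uIcc_of_le hT]; exact Ioc_subset_Icc_self hs)
  constructor
  · have h1 := inner_self_eq_integral hT hint hz (P := ContinuousLinearMap.id ℝ (L2 L))
      (fun x y => rfl)
    simp only [ContinuousLinearMap.id_apply, real_inner_self_eq_norm_sq, h0] at h1
    rw [h1]
    gcongr
    refine intervalIntegral.integral_mono_on hT (hii (hc Q) hint) (hii (hc Q) hQF) fun s _ => ?_
    rw [inner_add_right]
    have := (hQ (y s)).inner_nonpos
    rw [real_inner_comm] at this
    linarith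
  · have h1 := inner_self_eq_integral hT hint hz (P := mulX L) inner_mulX_left
    have hcM : ContinuousOn (fun s => mulX L (Q (y s))) (uIcc 0 T) :=
      (mulX L).continuous.comp_continuousOn (hc Q)
    have h2 : ∀ s, 2 * inner ℝ (mulX L (Q (y s))) (Y (y s) + Q (F s)) =
        ‖Q (y s)‖ ^ 2 + 2 * inner ℝ (mulX L (Q (y s))) (Q (F s)) - 3 * ‖D (y s)‖ ^ 2 := fun s => by
      have := ((hQ (y s)).norm_deriv_sq (hD (y s))).2
      rw [inner_add_right, this, real_inner_comm]
      ring
    have i1 : IntervalIntegrable (fun s => ‖Q (y s)‖ ^ 2) volume 0 T :=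
      ((hc Q).norm.pow 2).intervalIntegrable
    have i2 : IntervalIntegrable (fun s => ‖D (y s)‖ ^ 2) volume 0 T :=
      ((hc D).norm.pow 2).intervalIntegrable
    have i3 := hii hcM hQF
    rw [← intervalIntegral.integral_const_mul, intervalIntegral.integral_congr (fun s _ => h2 s),
      intervalIntegral.integral_sub (i1.add (i3.const_mul 2)) (i2.const_mul 3),
      intervalIntegral.integral_add i1 (i3.const_mul 2), intervalIntegral.integral_const_mul,
      intervalIntegral.integral_const_mul, h0] at h1
    rw [h1]
    ring

end KdV
end

/-! ### Passage to the limit in the resolvents and the Kato smoothing effect. -/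

noncomputable section

lemma aestronglyMeasurable_of_continuousOn {X : Type*} [NormedAddCommGroup X] {u : ℝ → X}
    {T : ℝ} (hu : ContinuousOn u (Icc 0 T)) :
    AEStronglyMeasurable u (volume.restrict (Ioc 0 T)) := by
  rw [restrict_Ioc_eq_restrict_Icc]
  exact hu.aestronglyMeasurable_of_isCompact isCompact_Icc measurableSet_Icc

section

variable {X : Type*} [NormedAddCommGroup X] [InnerProductSpace ℝ X]

lemma intervalIntegrable_inner {T : ℝ} (hT : 0 ≤ T) {u v : ℝ → X} (hu : ContinuousOn u (Icc 0 T))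
    (hv : IntervalIntegrable v volume 0 T) :
    IntervalIntegrable (fun s => inner ℝ (u s) (v s)) volume 0 T := by
  obtain ⟨B, hB⟩ := isCompact_Icc.exists_bound_of_continuousOn hu
  rw [intervalIntegrable_iff_integrableOn_Ioc_of_le hT] at hv ⊢
  refine Integrable.mono' (hv.norm.const_mul B)
    ((aestronglyMeasurable_of_continuousOn hu).inner hv.aestronglyMeasurable) ?_
  filter_upwards [ae_restrict_mem measurableSet_Ioc] with s hs
  refine (norm_inner_le_norm _ _).trans ?_
  gcongr
  exact hB s (Ioc_subset_Icc_self hs)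

/-- Dominated convergence for pairings of strongly convergent operators. -/
lemma tendsto_integral_inner {ι : Type*} {l : Filter ι} [l.IsCountablyGenerated]
    {Q : ι → X →L[ℝ] X} {Q₀ P : X →L[ℝ] X} (hQ : ∀ i x, ‖Q i x‖ ≤ 2 * ‖x‖)
    (hlim : ∀ x, Tendsto (fun i => Q i x) l (𝓝 (Q₀ x))) {T : ℝ} (hT : 0 ≤ T) {u v : ℝ → X}
    (hu : ContinuousOn u (Icc 0 T)) (hv : IntervalIntegrable v volume 0 T) :
    Tendsto (fun i => ∫ s in (0 : ℝ)..T, inner ℝ (P (Q i (u s))) (Q i (v s))) l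
      (𝓝 (∫ s in (0 : ℝ)..T, inner ℝ (P (Q₀ (u s))) (Q₀ (v s)))) := by
  obtain ⟨B, hB⟩ := isCompact_Icc.exists_bound_of_continuousOn hu
  have hvm : AEStronglyMeasurable v (volume.restrict (uIoc 0 T)) := by
    rw [uIoc_of_le hT]
    exact ((intervalIntegrable_iff_integrableOn_Ioc_of_le hT).1 hv).aestronglyMeasurable
  have hum : AEStronglyMeasurable u (volume.restrict (uIoc 0 T)) := by
    rw [uIoc_of_le hT]
    exact aestronglyMeasurable_of_continuousOn hu
  refine intervalIntegral.tendsto_integral_filter_of_dominated_convergence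
    (fun s => (‖P‖ * (2 * B)) * (2 * ‖v s‖)) (Eventually.of_forall fun i => ?_)
    (Eventually.of_forall fun i => Eventually.of_forall fun s hs => ?_)
    ((hv.norm.const_mul 2).const_mul _) (Eventually.of_forall fun s _ => ?_)
  · exact (P.continuous.comp_aestronglyMeasurable
      ((Q i).continuous.comp_aestronglyMeasurable hum)).inner
      ((Q i).continuous.comp_aestronglyMeasurable hvm)
  · rw [uIoc_of_le hT] at hs
    have hBs := hB s (Ioc_subset_Icc_self hs)
    have hB0 : 0 ≤ B := (norm_nonneg _).trans hBs
    refine (norm_inner_le_norm _ _).trans ?_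
    gcongr
    · exact (P.le_opNorm _).trans (by gcongr; exact (hQ i _).trans (by gcongr))
    · exact hQ i _
  · exact ((P.continuous.tendsto _).comp (hlim _)).inner (hlim _)

lemma L2_norm_sq_eq_integral {T : ℝ} (hT : 0 ≤ T) (f : Lp X 2 (volume.restrict (Ioc 0 T))) :
    ‖f‖ ^ 2 = ∫ s in (0 : ℝ)..T, ‖f s‖ ^ 2 := by
  rw [← real_inner_self_eq_norm_sq, L2.inner_def, intervalIntegral.integral_of_le hT]
  simp only [real_inner_self_eq_norm_sq]

lemma IsResolventSolution.mono {G : X → X → Prop} {hG : IsMaxDissipative G} {T : ℝ} {y₀ : X}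
    {F y : ℝ → X} (hy : IsResolventSolution hG T y₀ F y) {t : ℝ} (ht : t ∈ Icc 0 T) :
    IsResolventSolution hG t y₀ F y :=
  ⟨hy.continuousOn.mono (Icc_subset_Icc_right ht.2), intervalIntegrable_initial hy.integrable ht,
    fun n s hs => hy.eq n s ⟨hs.1, hs.2.trans ht.2⟩⟩

end

namespace KdV

variable {L : ℝ} [Fact (0 < L)]

lemma intervalIntegrable_resolventSolution {T : ℝ} {y₀ : L2 L} {F y : ℝ → L2 L}
    (hy : IsResolventSolution (isMaxDissipative_operatorGraph L) T y₀ F y) (n : ℕ) {t : ℝ}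
    (ht : t ∈ Icc 0 T) :
    IntervalIntegrable (fun s => YA L n (y s) + JA L n (F s)) volume 0 t := by
  refine IntervalIntegrable.add (intervalIntegrable_clm_comp _ ?_)
    (intervalIntegrable_clm_comp _ (intervalIntegrable_initial hy.integrable ht))
  refine ContinuousOn.intervalIntegrable ?_
  rw [uIcc_of_le ht.1]
  exact hy.continuousOn.mono (Icc_subset_Icc_right ht.2)

/-- The energy inequality. -/
lemma norm_sq_le_of_resolventSolution {T : ℝ} {y₀ : L2 L} {F y : ℝ → L2 L}
    (hy : IsResolventSolution (isMaxDissipative_operatorGraph L) T y₀ F y) {t : ℝ}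
    (ht : t ∈ Icc 0 T) :
    ‖y t‖ ^ 2 ≤ ‖y₀‖ ^ 2 + 2 * ∫ s in (0 : ℝ)..t, inner ℝ (y s) (F s) := by
  set hG := isMaxDissipative_operatorGraph L
  choose D hD using fun n => exists_derivJ (L := L) n
  have hy := hy.mono ht
  have h1 := fun n => (energy_regularized (hG.J_graph n) (hD n) ht.1 hy.continuousOn hy.integrable
    (hy.eq n)).1
  have h2 := tendsto_integral_inner (Q := hG.J) (Q₀ := ContinuousLinearMap.id ℝ _)
    (P := ContinuousLinearMap.id ℝ _)
    (fun i x => (hG.norm_J_le i x).trans (by linarith [norm_nonneg x])) hG.tendsto_J ht.1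
    hy.continuousOn hy.integrable
  exact le_of_tendsto_of_tendsto' ((hG.tendsto_J (y t)).norm.pow 2)
    (((hG.tendsto_J y₀).norm.pow 2).add (h2.const_mul 2)) h1

/-- The Kato smoothing effect: a solution with integrable forcing has a square integrable space
derivative. -/
theorem exists_deriv_of_resolventSolution {T : ℝ} (hT : 0 ≤ T) {y₀ : L2 L} {F y : ℝ → L2 L}
    (hy : IsResolventSolution (isMaxDissipative_operatorGraph L) T y₀ F y) :
    ∃ g : ℝ → L2 L, MemLp g 2 (volume.restrict (Ioc 0 T)) ∧
      (∀ᵐ t ∂(volume.restrict (Ioc 0 T)), y t = volterra L (g t) ∧ inner ℝ (g t) (one L) = 0) ∧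
      ∀ t ∈ Icc 0 T, 3 / 2 * ∫ s in (0 : ℝ)..t, ‖g s‖ ^ 2 ≤ inner ℝ (mulX L y₀) y₀ +
        (∫ s in (0 : ℝ)..t, ‖y s‖ ^ 2) + 2 * ∫ s in (0 : ℝ)..t, inner ℝ (mulX L (y s)) (F s) := by
  set hG := isMaxDissipative_operatorGraph L
  have hTm := right_mem_Icc.2 hT
  choose D hD using fun n => exists_derivJ (L := L) n
  have hyi : IntervalIntegrable y volume 0 T := by
    refine ContinuousOn.intervalIntegrable ?_
    rw [uIcc_of_le hT]; exact hy.continuousOn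
  have hDc : ∀ n, ContinuousOn (fun s => D n (y s)) (Icc 0 T) := fun n =>
    (D n).continuous.comp_continuousOn hy.continuousOn
  have hDm : ∀ n, MemLp (fun s => D n (y s)) 2 (volume.restrict (Ioc 0 T)) := fun n => by
    obtain ⟨B, hB⟩ := isCompact_Icc.exists_bound_of_continuousOn (hDc n)
    refine MemLp.of_bound (aestronglyMeasurable_of_continuousOn (hDc n)) B ?_
    filter_upwards [ae_restrict_mem measurableSet_Ioc] with s hs
    exact hB s (Ioc_subset_Icc_self hs)
  have hdiff : Tendsto (fun p : ℕ × ℕ => ∫ s in (0 : ℝ)..T, ‖D p.1 (y s) - D p.2 (y s)‖ ^ 2) atTop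
      (𝓝 0) := by
    -- The multiplier identity is applied to `J_n y - J_m y`. Every term on its right side tends to
    -- zero by dominated convergence, so the derivatives `∂_x J_n y` form a Cauchy sequence in
    -- `L²(0, T; L²)`.
    set Q : ℕ × ℕ → L2 L →L[ℝ] L2 L := fun p => hG.J p.1 - hG.J p.2 with hQ
    have hQn : ∀ p x, ‖Q p x‖ ≤ 2 * ‖x‖ := fun p x => by
      refine (norm_sub_le _ _).trans ?_
      have h1 := hG.norm_J_le p.1 x
      have h2 := hG.norm_J_le p.2 x
      change ‖hG.J p.1 x‖ + ‖hG.J p.2 x‖ ≤ 2 * ‖x‖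
      linarith
    have hQl : ∀ x, Tendsto (fun p => Q p x) atTop (𝓝 ((0 : L2 L →L[ℝ] L2 L) x)) := fun x => by
      have h1 : Tendsto (fun p : ℕ × ℕ => hG.J p.1 x) atTop (𝓝 x) :=
        (hG.tendsto_J x).comp (tendsto_fst.mono_left (prod_atTop_atTop_eq (α := ℕ) (β := ℕ)).ge)
      have h2 : Tendsto (fun p : ℕ × ℕ => hG.J p.2 x) atTop (𝓝 x) :=
        (hG.tendsto_J x).comp (tendsto_snd.mono_left (prod_atTop_atTop_eq (α := ℕ) (β := ℕ)).ge)
      have h3 := h1.sub h2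
      rw [sub_self] at h3
      exact h3
    have e1 := tendsto_integral_inner (P := ContinuousLinearMap.id ℝ _) hQn hQl hT hy.continuousOn
      hyi
    have e2 := tendsto_integral_inner (P := mulX L) hQn hQl hT hy.continuousOn hy.integrable
    have e3 : Tendsto (fun p => inner ℝ (mulX L (Q p y₀)) (Q p y₀)) atTop (𝓝 0) := by
      have := (((mulX L).continuous.tendsto _).comp (hQl y₀)).inner (𝕜 := ℝ) (hQl y₀)
      simpa using this
    have e4 := (e3.add e1).add (e2.const_mul 2)
    simp only [zero_apply, inner_zero_right, intervalIntegral.integral_zero,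
      mul_zero, add_zero] at e4
    refine squeeze_zero (fun p => ?_) (fun p => ?_) e4
    · exact intervalIntegral.integral_nonneg hT fun s _ => by positivity
    · have h := (energy_regularized (Q := Q p) (Y := hG.yosida p.1 - hG.yosida p.2)
        (D := D p.1 - D p.2) (y₀ := y₀) (F := F) (y := y)
        (fun f => hG.sub (hG.J_graph p.1 f) (hG.J_graph p.2 f))
        (fun f => by
          change hG.J p.1 f - hG.J p.2 f = volterra L (D p.1 f - D p.2 f)
          rw [map_sub, ← hD, ← hD])
        hT hy.continuousOn hy.integrable (fun t ht => by
          change hG.J p.1 (y t) - hG.J p.2 (y t) = hG.J p.1 y₀ - hG.J p.2 y₀ + _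
          rw [hy.eq p.1 t ht, hy.eq p.2 t ht, add_sub_add_comm, ← intervalIntegral.integral_sub
            (intervalIntegrable_resolventSolution hy p.1 ht)
            (intervalIntegrable_resolventSolution hy p.2 ht)]
          congr 1
          refine intervalIntegral.integral_congr fun s _ => ?_
          simp only [hQ, sub_apply]
          abel)).2
      simp only [ContinuousLinearMap.id_apply, real_inner_self_eq_norm_sq]
      have h2 := inner_mulX_nonneg (Q p (y T))
      have h3 : 0 ≤ ∫ s in (0 : ℝ)..T, ‖D p.1 (y s) - D p.2 (y s)‖ ^ 2 :=
        intervalIntegral.integral_nonneg hT fun s _ => by positivity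
      simp only [sub_apply] at h
      linarith
  let gn : ℕ → Lp (L2 L) 2 (volume.restrict (Ioc 0 T)) := fun n => (hDm n).toLp
  have hgn : ∀ n, gn n =ᵐ[volume.restrict (Ioc 0 T)] fun s => D n (y s) := fun n =>
    (hDm n).coeFn_toLp
  have hcauchy : CauchySeq gn := by
    rw [cauchySeq_iff_tendsto_dist_atTop_0]
    have h := (Real.continuous_sqrt.tendsto 0).comp hdiff
    rw [Real.sqrt_zero] at h
    refine h.congr fun p => ?_
    simp only [Function.comp_apply]
    rw [dist_eq_norm, Real.sqrt_eq_iff_mul_self_eq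
      (intervalIntegral.integral_nonneg hT fun s _ => by positivity) (norm_nonneg _), ← sq,
      L2_norm_sq_eq_integral hT, intervalIntegral.integral_of_le hT,
      intervalIntegral.integral_of_le hT]
    refine integral_congr_ae ?_
    filter_upwards [Lp.coeFn_sub (gn p.1) (gn p.2), hgn p.1, hgn p.2] with s h1 h2 h3
    rw [h1, Pi.sub_apply, h2, h3]
  obtain ⟨g, hg⟩ := cauchySeq_tendsto_of_complete hcauchy
  -- Along a subsequence the derivatives converge for almost every time, which lets `J_n y = V (D_n
  -- y)` and the zero mean pass to the limit pointwise.
  obtain ⟨ns, hns, hae⟩ := (tendstoInMeasure_of_tendsto_Lp hg).exists_seq_tendsto_ae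
  refine ⟨g, Lp.memLp g, ?_, fun t ht => ?_⟩
  · have hall : ∀ᵐ s ∂(volume.restrict (Ioc 0 T)), ∀ n, gn n s = D n (y s) :=
      ae_all_iff.2 hgn
    filter_upwards [hae, hall] with s h1 h2
    simp only [h2] at h1
    constructor
    · refine tendsto_nhds_unique ((hG.tendsto_J (y s)).comp hns.tendsto_atTop) ?_
      refine (((volterra L).continuous.tendsto _).comp h1).congr fun k => ?_
      simp only [Function.comp_apply]
      rw [← hD]
    · have h3 := h1.inner (𝕜 := ℝ) (tendsto_const_nhds (x := one L))
      refine tendsto_nhds_unique h3 ?_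
      have h4 : ∀ k, inner ℝ (D (ns k) (y s)) (one L) = 0 := fun k =>
        ((hG.J_graph (ns k) (y s)).norm_deriv_sq (hD _ _)).1
      simp only [h4]
      exact tendsto_const_nhds
  · have hyt := hy.mono ht
    have hE := fun n => (energy_regularized (hG.J_graph n) (hD n) ht.1 hyt.continuousOn
      hyt.integrable (hyt.eq n)).2
    have hJ2 : ∀ i x, ‖hG.J i x‖ ≤ 2 * ‖x‖ := fun i x =>
      (hG.norm_J_le i x).trans (by linarith [norm_nonneg x])
    have e1 := tendsto_integral_inner (P := ContinuousLinearMap.id ℝ _)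
      (Q₀ := ContinuousLinearMap.id ℝ _) hJ2 hG.tendsto_J ht.1 hyt.continuousOn
      (intervalIntegrable_initial hyi ht)
    have e2 := tendsto_integral_inner (P := mulX L) (Q₀ := ContinuousLinearMap.id ℝ _) hJ2
      hG.tendsto_J ht.1 hyt.continuousOn hyt.integrable
    have e3 : Tendsto (fun n => inner ℝ (mulX L (hG.J n y₀)) (hG.J n y₀)) atTop
        (𝓝 (inner ℝ (mulX L y₀) y₀)) :=
      (((mulX L).continuous.tendsto _).comp (hG.tendsto_J y₀)).inner (hG.tendsto_J y₀)
    have e4 := (e3.add e1).add (e2.const_mul 2)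
    simp only [ContinuousLinearMap.id_apply, real_inner_self_eq_norm_sq] at e4
    have e5 : Tendsto (fun n => ‖g - gn n‖ ^ 2) atTop (𝓝 0) := by
      have := ((tendsto_const_nhds (x := g)).sub hg).norm.pow 2
      simpa using this
    have e6 := e4.add (e5.const_mul 3)
    rw [mul_zero, add_zero] at e6
    refine ge_of_tendsto' e6 fun n => ?_
    have i0 : IntervalIntegrable (fun s => ‖g s‖ ^ 2) volume 0 T := by
      rw [intervalIntegrable_iff_integrableOn_Ioc_of_le hT]
      exact (Lp.memLp g).norm.integrable_sq
    have i1 : IntervalIntegrable (fun s => ‖(g - gn n : Lp (L2 L) 2 _) s‖ ^ 2) volume 0 T := by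
      rw [intervalIntegrable_iff_integrableOn_Ioc_of_le hT]
      exact (Lp.memLp (g - gn n)).norm.integrable_sq
    have i2 : IntervalIntegrable (fun s => ‖D n (y s)‖ ^ 2) volume 0 T := by
      refine ContinuousOn.intervalIntegrable ?_
      rw [uIcc_of_le hT]
      exact (hDc n).norm.pow 2
    have i3 := intervalIntegrable_initial i1 ht
    have i4 := intervalIntegrable_initial i2 ht
    -- The identity carries the factor `3`; half of it is spent on `‖g‖² ≤ 2‖g_n‖² + 2‖g - g_n‖²`,
    -- whence the `3/2`.
    have h1 : ∫ s in (0 : ℝ)..t, ‖g s‖ ^ 2 ≤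
        ∫ s in (0 : ℝ)..t, (2 * ‖D n (y s)‖ ^ 2 + 2 * ‖(g - gn n : Lp (L2 L) 2 _) s‖ ^ 2) := by
      refine intervalIntegral.integral_mono_ae_restrict ht.1 (intervalIntegrable_initial i0 ht)
        ((i4.const_mul 2).add (i3.const_mul 2)) ?_
      rw [← restrict_Ioc_eq_restrict_Icc]
      refine ae_restrict_of_ae_restrict_of_subset (Ioc_subset_Ioc_right ht.2) ?_
      filter_upwards [Lp.coeFn_sub g (gn n), hgn n] with s h1 h2
      rw [h1, Pi.sub_apply, h2]
      have h3 : ‖g s‖ ≤ ‖D n (y s)‖ + ‖g s - D n (y s)‖ := by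
        calc ‖g s‖ = ‖D n (y s) + (g s - D n (y s))‖ := by rw [add_sub_cancel]
          _ ≤ _ := norm_add_le _ _
      nlinarith [sq_nonneg (‖D n (y s)‖ - ‖g s - D n (y s)‖), norm_nonneg (g s),
        norm_nonneg (D n (y s)), norm_nonneg (g s - D n (y s))]
    rw [intervalIntegral.integral_add (i4.const_mul 2) (i3.const_mul 2),
      intervalIntegral.integral_const_mul, intervalIntegral.integral_const_mul] at h1
    have h2 : ∫ s in (0 : ℝ)..t, ‖(g - gn n : Lp (L2 L) 2 _) s‖ ^ 2 ≤ ‖g - gn n‖ ^ 2 := by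
      rw [L2_norm_sq_eq_integral hT]
      exact intervalIntegral.integral_mono_interval le_rfl ht.1 ht.2
        (Eventually.of_forall fun s => by positivity) i1
    have h3 := hE n
    have h4 := inner_mulX_nonneg (hG.J n (y t))
    linarith

end KdV
end

/-! ### Gronwall's lemma and estimates for the nonlinearity. -/

noncomputable section

/-- Gronwall's lemma with an integrable kernel. -/
lemma eq_zero_of_le_integral {φ k : ℝ → ℝ} {T : ℝ} (hT : 0 ≤ T) (hφ : ContinuousOn φ (Icc 0 T))
    (hφ0 : ∀ t ∈ Icc 0 T, 0 ≤ φ t) (hk : IntervalIntegrable k volume 0 T) (hk0 : ∀ t, 0 ≤ k t)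
    (h : ∀ t ∈ Icc 0 T, φ t ≤ ∫ s in (0 : ℝ)..t, k s * φ s) : ∀ t ∈ Icc 0 T, φ t = 0 := by
  have hkφ : IntervalIntegrable (fun s => k s * φ s) volume 0 T :=
    hk.mul_continuousOn (by rwa [uIcc_of_le hT])
  have h0m : (0 : ℝ) ∈ uIcc 0 T := left_mem_uIcc
  have hsub : ∀ {f : ℝ → ℝ}, IntervalIntegrable f volume 0 T → ∀ {x y}, x ∈ Icc 0 T → y ∈ Icc 0 T →
      IntervalIntegrable f volume x y := fun {f} hf {x y} hx hy => by
    rw [← uIcc_of_le hT] at hx hy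
    exact hf.mono_set (uIcc_subset_uIcc hx hy)
  set Ψ : ℝ → ℝ := fun t => ∫ s in (0 : ℝ)..t, k s * φ s with hΨ
  have hΨc : ContinuousOn Ψ (Icc 0 T) := by
    have := intervalIntegral.continuousOn_primitive_interval' hkφ h0m
    rwa [uIcc_of_le hT] at this
  have hkc : ContinuousOn (fun t => ∫ s in (0 : ℝ)..t, k s) (Icc 0 T) := by
    have := intervalIntegral.continuousOn_primitive_interval' hk h0m
    rwa [uIcc_of_le hT] at this
  -- Continuous induction: if `Ψ` vanishes at `x`, choose `z > x` with `∫_x^z k ≤ 1/2`. The maximum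
  -- of `φ` on `[x, z]` is then at most half of itself, so `Ψ` still vanishes at `z`.
  have key : Icc 0 T ⊆ {t | Ψ t = 0} := by
    refine IsClosed.Icc_subset_of_forall_exists_gt ?_ (by simp [hΨ]) ?_
    · have := hΨc.preimage_isClosed_of_isClosed isClosed_Icc (isClosed_singleton (x := (0 : ℝ)))
      rwa [inter_comm] at this
    · rintro x ⟨hx0, hx⟩ y hy
      have hxm : x ∈ Icc 0 T := Ico_subset_Icc_self hx
      have hx0 : Ψ x = 0 := hx0
      have hcx : ContinuousWithinAt (fun t => ∫ s in (0 : ℝ)..t, k s) (Icc x T) x :=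
        (hkc x hxm).mono (Icc_subset_Icc_left hx.1)
      have hev : ∀ᶠ z in 𝓝[Icc x T] x,
          (∫ s in (0 : ℝ)..z, k s) < (∫ s in (0 : ℝ)..x, k s) + 1 / 2 :=
        hcx.eventually (gt_mem_nhds (by linarith))
      have hev' : ∀ᶠ z in 𝓝[>] x, (∫ s in (0 : ℝ)..z, k s) < (∫ s in (0 : ℝ)..x, k s) + 1 / 2 := by
        have hle : 𝓝[>] x ≤ 𝓝[Icc x T] x := by
          rw [← nhdsWithin_Ioc_eq_nhdsGT hx.2]
          exact nhdsWithin_mono _ Ioc_subset_Icc_self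
        exact hle hev
      obtain ⟨z, hz1, hz2⟩ := (hev'.and (Ioc_mem_nhdsGT (lt_min hy hx.2))).exists
      have hzT : z ∈ Icc 0 T := ⟨hx.1.trans hz2.1.le, hz2.2.trans (min_le_right _ _)⟩
      have hxz : ∀ s ∈ Icc x z, s ∈ Icc 0 T := fun s hs => ⟨hx.1.trans hs.1, hs.2.trans hzT.2⟩
      obtain ⟨m, hm, hmax⟩ := isCompact_Icc.exists_isMaxOn (nonempty_Icc.2 hz2.1.le)
        (hφ.mono hxz)
      have hadd : ∀ s ∈ Icc x z, Ψ s = ∫ r in x..s, k r * φ r := fun s hs => by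
        have := intervalIntegral.integral_add_adjacent_intervals
          (hsub hkφ (left_mem_Icc.2 hT) hxm) (hsub hkφ hxm (hxz s hs))
        rw [hΨ] at hx0 ⊢
        simp only at hx0 ⊢
        rw [← this, hx0, zero_add]
      have hkxz : ∫ r in x..z, k r ≤ 1 / 2 := by
        have := intervalIntegral.integral_add_adjacent_intervals
          (hsub hk (left_mem_Icc.2 hT) hxm) (hsub hk hxm hzT)
        linarith
      have hm0 := hφ0 m (hxz m hm)
      have h1 : φ m ≤ 1 / 2 * φ m := by
        calc φ m ≤ Ψ m := h m (hxz m hm)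
          _ = ∫ r in x..m, k r * φ r := hadd m hm
          _ ≤ ∫ r in x..m, k r * φ m := by
              refine intervalIntegral.integral_mono_on hm.1 (hsub hkφ hxm (hxz m hm))
                ((hsub hk hxm (hxz m hm)).mul_const _) fun r hr => ?_
              exact mul_le_mul_of_nonneg_left (hmax ⟨hr.1, hr.2.trans hm.2⟩) (hk0 r)
          _ = (∫ r in x..m, k r) * φ m := intervalIntegral.integral_mul_const _ _
          _ ≤ (∫ r in x..z, k r) * φ m := by
              gcongr
              exact intervalIntegral.integral_mono_interval le_rfl hm.1 hm.2
                (Eventually.of_forall hk0) (hsub hk hxm hzT)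
          _ ≤ _ := by gcongr
      have hφz : ∀ s ∈ Icc x z, φ s = 0 := fun s hs =>
        le_antisymm ((hmax hs).trans (by linarith)) (hφ0 s (hxz s hs))
      refine ⟨z, ?_, hz2.1, hz2.2.trans (min_le_left _ _)⟩
      change Ψ z = 0
      rw [hadd z (right_mem_Icc.2 hz2.1.le), intervalIntegral.integral_congr (g := fun _ => 0),
        intervalIntegral.integral_zero]
      intro r hr
      rw [uIcc_of_le hz2.1.le] at hr
      simp only [hφz r hr, mul_zero]
  intro t ht
  exact le_antisymm ((h t ht).trans (key ht).le) (hφ0 t ht)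

namespace KdV

variable {L : ℝ}

/-- A Lipschitz damping term: `Φ 0 = 0` and `⟨u, Φ u⟩ ≥ 0`. -/
structure IsDamping (L K : ℝ) (Φ : L2 L → L2 L) : Prop where
  nonneg : 0 ≤ K
  zero : Φ 0 = 0
  lipschitz : ∀ u v, ‖Φ u - Φ v‖ ≤ K * ‖u - v‖
  inner_nonneg : ∀ u, 0 ≤ inner ℝ u (Φ u)

lemma IsDamping.continuous {K : ℝ} {Φ : L2 L → L2 L} (h : IsDamping L K Φ) : Continuous Φ :=
  (LipschitzWith.of_dist_le_mul (K := ⟨K, h.nonneg⟩) fun u v => by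
    rw [dist_eq_norm, dist_eq_norm]; exact h.lipschitz u v).continuous

variable [Fact (0 < L)]

/-- The nonlinearity `u u_x + Φ(u)` for `u = Vg`, in terms of `g = u_x`. -/
def nonlinearity (Φ : L2 L → L2 L) (g : L2 L) : L2 L :=
  mulTop L (volterraTop L g) g + Φ (volterra L g)

variable {K : ℝ} {Φ : L2 L → L2 L}

lemma continuous_nonlinearity (hΦ : IsDamping L K Φ) : Continuous (nonlinearity Φ) := by
  refine Continuous.add ?_ (hΦ.continuous.comp (volterra L).continuous)
  exact ((mulTop L).continuous.comp (volterraTop L).continuous).clm_apply continuous_id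

/-- The splitting `u u' - v v' = (u - v) u' + v (u - v)'`, with the undifferentiated factor measured
in `L^∞`. -/
lemma norm_nonlinearity_sub_le (hΦ : IsDamping L K Φ) (g h : L2 L) :
    ‖nonlinearity Φ g - nonlinearity Φ h‖ ≤ ‖volterraTop L (g - h)‖ * ‖g‖ +
      ‖volterraTop L h‖ * ‖g - h‖ + K * ‖volterra L (g - h)‖ := by
  have e : nonlinearity Φ g - nonlinearity Φ h = mulTop L (volterraTop L (g - h)) g +
      mulTop L (volterraTop L h) (g - h) + (Φ (volterra L g) - Φ (volterra L h)) := by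
    simp only [nonlinearity, map_sub, sub_apply]
    abel
  rw [e]
  refine (norm_add₃_le).trans ?_
  gcongr
  · exact norm_mulTop_le _ _
  · exact norm_mulTop_le _ _
  · rw [map_sub]; exact hΦ.lipschitz _ _

lemma nonlinearity_zero (hΦ : IsDamping L K Φ) : nonlinearity Φ 0 = 0 := by
  simp [nonlinearity, hΦ.zero]

lemma inner_nonlinearity_nonneg (hΦ : IsDamping L K Φ) {g : L2 L} (hg : inner ℝ g (one L) = 0) :
    0 ≤ inner ℝ (volterra L g) (nonlinearity Φ g) := by
  rw [nonlinearity, inner_add_right, real_inner_comm, inner_convection_eq_zero g hg, zero_add]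
  exact hΦ.inner_nonneg _

/-- The multiplier `1 + x` combines the energy and smoothing estimates. By Young's inequality the
derivative of the difference appears with exactly the coefficient `3/2` that smoothing controls; the
remaining coefficient is integrable in time when `g` and `h` are square integrable. -/
lemma inner_nonlinearity_sub_le (hΦ : IsDamping L K Φ) (g h : L2 L) :
    -(2 * inner ℝ (volterra L (g - h) + mulX L (volterra L (g - h)))
      (nonlinearity Φ g - nonlinearity Φ h)) ≤ 3 / 2 * ‖g - h‖ ^ 2 +
      (4 * (1 + L) ^ 2 * L * (‖g‖ ^ 2 + ‖h‖ ^ 2) + 2 * (1 + L) * K) * ‖volterra L (g - h)‖ ^ 2 := by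
  have hL : (0 : ℝ) < L := Fact.out
  have hK := hΦ.nonneg
  set w := volterra L (g - h)
  have h1 : ‖w + mulX L w‖ ≤ (1 + L) * ‖w‖ :=
    (norm_add_le _ _).trans (by linarith [norm_mulX_le w])
  have h2 := norm_nonlinearity_sub_le hΦ g h
  have h3 := norm_volterraTop_le (g - h)
  have h4 := norm_volterraTop_le h
  have h5 : ‖nonlinearity Φ g - nonlinearity Φ h‖ ≤
      √L * ‖g - h‖ * (‖g‖ + ‖h‖) + K * ‖w‖ := by
    refine h2.trans ?_
    have e1 : ‖volterraTop L (g - h)‖ * ‖g‖ ≤ √L * ‖g - h‖ * ‖g‖ := by gcongr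
    have e2 : ‖volterraTop L h‖ * ‖g - h‖ ≤ √L * ‖h‖ * ‖g - h‖ := by gcongr
    linarith
  have h6 : -(2 * inner ℝ (w + mulX L w) (nonlinearity Φ g - nonlinearity Φ h)) ≤
      2 * (((1 + L) * ‖w‖) * (√L * ‖g - h‖ * (‖g‖ + ‖h‖) + K * ‖w‖)) := by
    have := (neg_le_abs _).trans
      ((abs_real_inner_le_norm (w + mulX L w) (nonlinearity Φ g - nonlinearity Φ h)).trans
        (mul_le_mul h1 h5 (norm_nonneg _) (by positivity)))
    linarith
  refine h6.trans ?_
  have hs : √L ^ 2 = L := Real.sq_sqrt hL.le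
  set a := ‖g - h‖
  set b := (1 + L) * ‖w‖ * √L * (‖g‖ + ‖h‖) with hb
  have h7 : b ^ 2 ≤ (1 + L) ^ 2 * ‖w‖ ^ 2 * L * (2 * (‖g‖ ^ 2 + ‖h‖ ^ 2)) := by
    have : (‖g‖ + ‖h‖) ^ 2 ≤ 2 * (‖g‖ ^ 2 + ‖h‖ ^ 2) := by nlinarith [sq_nonneg (‖g‖ - ‖h‖)]
    rw [hb, mul_pow, mul_pow, mul_pow, hs]
    gcongr
  have h8 : 2 * a * b ≤ 3 / 2 * a ^ 2 + b ^ 2 := by nlinarith [sq_nonneg (a - b), sq_nonneg a]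
  have h9 : 0 ≤ (1 + L) ^ 2 * ‖w‖ ^ 2 * L * (2 * (‖g‖ ^ 2 + ‖h‖ ^ 2)) := by positivity
  nlinarith

end KdV
end

/-! ### Uniqueness and energy decay for the nonlinear equation. -/

noncomputable section

lemma IsResolventSolution.congr {X : Type*} [NormedAddCommGroup X] [InnerProductSpace ℝ X]
    {G : X → X → Prop} {hG : IsMaxDissipative G} {T : ℝ} {y₀ : X} {F y z : ℝ → X}
    (hy : IsResolventSolution hG T y₀ F y) (h : EqOn z y (Icc 0 T)) :
    IsResolventSolution hG T y₀ F z := by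
  refine ⟨hy.continuousOn.congr h, hy.integrable, fun n t ht => ?_⟩
  rw [h ht, hy.eq n t ht]
  congr 1
  refine intervalIntegral.integral_congr fun s hs => ?_
  rw [uIcc_of_le ht.1] at hs
  simp only [h ⟨hs.1, hs.2.trans ht.2⟩]

namespace KdV

variable {L K : ℝ} [Fact (0 < L)] {Φ : L2 L → L2 L}

/-- Two solutions of the nonlinear equation with the same initial value agree. -/
theorem eqOn_of_nonlinear (hΦ : IsDamping L K Φ) {T : ℝ} (hT : 0 ≤ T) {y₀ : L2 L}
    {F F' y z : ℝ → L2 L}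
    (hy : IsResolventSolution (isMaxDissipative_operatorGraph L) T y₀ F y)
    (hz : IsResolventSolution (isMaxDissipative_operatorGraph L) T y₀ F' z)
    (hyF : ∀ᵐ t ∂(volume.restrict (Ioc 0 T)), ∃ g, y t = volterra L g ∧ F t = -nonlinearity Φ g)
    (hzF : ∀ᵐ t ∂(volume.restrict (Ioc 0 T)), ∃ g, z t = volterra L g ∧ F' t = -nonlinearity Φ g) :
    EqOn z y (Icc 0 T) := by
  have hL : (0 : ℝ) < L := Fact.out
  have hw := hy.sub hz
  rw [sub_self] at hw
  obtain ⟨gy, hgy, hgy', -⟩ := exists_deriv_of_resolventSolution hT hy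
  obtain ⟨gz, hgz, hgz', -⟩ := exists_deriv_of_resolventSolution hT hz
  obtain ⟨gw, hgw, hgw', hE⟩ := exists_deriv_of_resolventSolution hT hw
  set w : ℝ → L2 L := fun t => y t - z t
  set Fw : ℝ → L2 L := fun t => F t - F' t
  -- This bounds the sum of the integrands of the energy and smoothing inequalities. The extra `1`
  -- in the kernel accounts for the term `∫ ‖w‖²` of smoothing, and `(3/2)∫ ‖gw‖²` cancels once they
  -- are added.
  have hbound : ∀ᵐ t ∂(volume.restrict (Ioc 0 T)),
      ‖w t‖ ^ 2 + (2 * inner ℝ (w t) (Fw t) + 2 * inner ℝ (mulX L (w t)) (Fw t)) ≤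
        3 / 2 * ‖gw t‖ ^ 2 + (4 * (1 + L) ^ 2 * L * (‖gy t‖ ^ 2 + ‖gz t‖ ^ 2) +
          2 * (1 + L) * K + 1) * ‖w t‖ ^ 2 := by
    filter_upwards [hyF, hzF, hgy', hgz', hgw'] with t ⟨g1, h1, h1'⟩ ⟨g2, h2, h2'⟩ h3 h4 h5
    have e1 : g1 = gy t := volterra_injective (h1.symm.trans h3.1)
    have e2 : g2 = gz t := volterra_injective (h2.symm.trans h4.1)
    have e4 : w t = volterra L (gy t - gz t) := by rw [map_sub, ← h3.1, ← h4.1]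
    have e3 : gw t = gy t - gz t := volterra_injective (h5.1.symm.trans e4)
    have e5 : Fw t = -(nonlinearity Φ (gy t) - nonlinearity Φ (gz t)) := by
      simp only [Fw, h1', h2', e1, e2]; abel
    have h := inner_nonlinearity_sub_le hΦ (gy t) (gz t)
    rw [← e4, ← e3, inner_add_left] at h
    rw [e5, inner_neg_right, inner_neg_right]
    linarith
  have isq : ∀ {g : ℝ → L2 L}, MemLp g 2 (volume.restrict (Ioc 0 T)) →
      IntervalIntegrable (fun s => ‖g s‖ ^ 2) volume 0 T := fun {g} hg => by
    rw [intervalIntegrable_iff_integrableOn_Ioc_of_le hT]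
    exact hg.norm.integrable_sq
  set k : ℝ → ℝ := fun t => 4 * (1 + L) ^ 2 * L * (‖gy t‖ ^ 2 + ‖gz t‖ ^ 2) +
          2 * (1 + L) * K + 1 with hk
  have hki : IntervalIntegrable k volume 0 T :=
    ((((isq hgy).add (isq hgz)).const_mul _).add intervalIntegrable_const).add
      intervalIntegrable_const
  have hK := hΦ.nonneg
  have hzero := eq_zero_of_le_integral (φ := fun t => ‖w t‖ ^ 2) (k := k) hT
    (hw.continuousOn.norm.pow 2) (fun t _ => by positivity) hki (fun t => by positivity)
    (fun t ht => by
      have h1 := norm_sq_le_of_resolventSolution hw ht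
      have h2 := hE t ht
      have hwt := hw.mono ht
      have i1 := intervalIntegrable_inner ht.1 hwt.continuousOn hwt.integrable
      have i2 := intervalIntegrable_inner ht.1
        ((mulX L).continuous.comp_continuousOn hwt.continuousOn) hwt.integrable
      have hcw : ContinuousOn (fun s => ‖w s‖ ^ 2) (uIcc 0 t) := by
        rw [uIcc_of_le ht.1]
        exact hwt.continuousOn.norm.pow 2
      have i3 := hcw.intervalIntegrable (μ := volume)
      have i4 := intervalIntegrable_initial (isq hgw) ht
      have i5 : IntervalIntegrable (fun s => k s * ‖w s‖ ^ 2) volume 0 t :=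
        (intervalIntegrable_initial hki ht).mul_continuousOn hcw
      have h3 := intervalIntegral.integral_mono_ae_restrict ht.1
        (i3.add ((i1.const_mul 2).add (i2.const_mul 2))) ((i4.const_mul (3 / 2)).add i5) (by
          rw [← restrict_Ioc_eq_restrict_Icc]
          exact ae_restrict_of_ae_restrict_of_subset (Ioc_subset_Ioc_right ht.2) hbound)
      rw [intervalIntegral.integral_add i3 ((i1.const_mul 2).add (i2.const_mul 2)),
        intervalIntegral.integral_add (i1.const_mul 2) (i2.const_mul 2),
        intervalIntegral.integral_add (i4.const_mul (3 / 2)) i5,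
        intervalIntegral.integral_const_mul, intervalIntegral.integral_const_mul,
        intervalIntegral.integral_const_mul] at h3
      simp only [map_zero, inner_zero_left, norm_zero, ne_eq, OfNat.ofNat_ne_zero,
        not_false_eq_true, zero_pow, zero_add] at h1 h2
      simp only [Function.comp_apply] at h3
      linarith)
  intro t ht
  have := hzero t ht
  simp only [ne_eq, OfNat.ofNat_ne_zero, not_false_eq_true, pow_eq_zero_iff, norm_eq_zero] at this
  exact (sub_eq_zero.1 this).symm

/-- Solutions of the nonlinear equation do not gain energy. -/
lemma norm_le_of_nonlinear (hΦ : IsDamping L K Φ) {T : ℝ} {y₀ : L2 L} {F y : ℝ → L2 L}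
    (hy : IsResolventSolution (isMaxDissipative_operatorGraph L) T y₀ F y)
    (hyF : ∀ᵐ t ∂(volume.restrict (Ioc 0 T)), ∃ g, y t = volterra L g ∧ inner ℝ g (one L) = 0 ∧
      F t = -nonlinearity Φ g) {t : ℝ} (ht : t ∈ Icc 0 T) : ‖y t‖ ≤ ‖y₀‖ := by
  have h1 := norm_sq_le_of_resolventSolution hy ht
  have h2 : ∫ s in (0 : ℝ)..t, inner ℝ (y s) (F s) ≤ 0 := by
    rw [← neg_nonneg, ← intervalIntegral.integral_neg]
    refine intervalIntegral.integral_nonneg_of_ae_restrict ht.1 ?_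
    rw [← restrict_Ioc_eq_restrict_Icc]
    refine ae_restrict_of_ae_restrict_of_subset (Ioc_subset_Ioc_right ht.2) ?_
    filter_upwards [hyF] with s ⟨g, e1, e2, e3⟩
    rw [e1, e3, inner_neg_right, neg_neg]
    exact inner_nonlinearity_nonneg hΦ e2
  exact le_of_sq_le_sq (by linarith) (norm_nonneg _)

end KdV
end

/-! ### Local existence by a fixed point on the forcing term. -/

noncomputable section

/-- The Cauchy–Schwarz inequality for real functions. -/
lemma integral_mul_le_sqrt_mul_sqrt {α : Type*} [MeasurableSpace α] {μ : Measure α} {f g : α → ℝ}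
    (hf : MemLp f 2 μ) (hg : MemLp g 2 μ) :
    ∫ x, f x * g x ∂μ ≤ √(∫ x, f x ^ 2 ∂μ) * √(∫ x, g x ^ 2 ∂μ) := by
  have hn : ∀ {u : α → ℝ} (hu : MemLp u 2 μ), √(∫ x, u x ^ 2 ∂μ) = ‖hu.toLp‖ := fun {u} hu => by
    rw [Real.sqrt_eq_iff_mul_self_eq (integral_nonneg fun x => sq_nonneg _) (norm_nonneg _),
      ← real_inner_self_eq_norm_mul_norm, L2.inner_def]
    refine integral_congr_ae ?_
    filter_upwards [hu.coeFn_toLp] with x hx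
    rw [hx]; simp [sq]
  rw [hn hf, hn hg]
  refine le_trans (le_of_eq ?_) (real_inner_le_norm _ _)
  rw [L2.inner_def]
  refine integral_congr_ae ?_
  filter_upwards [hf.coeFn_toLp, hg.coeFn_toLp] with x h1 h2
  rw [h1, h2]; simp [mul_comm]

namespace KdV

variable {L K : ℝ} [Fact (0 < L)] {Φ : L2 L → L2 L} {W : ℝ → L2 L →L[ℝ] L2 L}

/-- Bounds for the linear problem on a short time interval. -/
lemma mild_estimates (hW : IsContractionSemigroup W) (hA : IsGenerator (OperatorGraph L) W)
    {δ d : ℝ} (h0 : 0 ≤ δ) (h1 : δ ≤ 1) {y₀ : L2 L} {F g : ℝ → L2 L}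
    (hF : IntervalIntegrable F volume 0 δ) (hg : MemLp g 2 (volume.restrict (Ioc 0 δ)))
    (hyg : ∀ᵐ t ∂(volume.restrict (Ioc 0 δ)), mild W y₀ F t = volterra L (g t))
    (hd : ‖y₀‖ + ∫ s in (0 : ℝ)..δ, ‖F s‖ ≤ d) :
    (∀ᵐ t ∂(volume.restrict (Ioc 0 δ)), ‖volterra L (g t)‖ ≤ d) ∧
    ∫ s in Ioc 0 δ, ‖g s‖ ^ 2 ≤ (√(1 + 2 * L) * d) ^ 2 ∧
    ∫ s in Ioc 0 δ, ‖volterraTop L (g s)‖ ^ 2 ≤ (√(2 * √(1 + 2 * L) * √δ) * d) ^ 2 := by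
  have hL : (0 : ℝ) < L := Fact.out
  set κ := √(1 + 2 * L) with hκ
  have hκ2 : κ ^ 2 = 1 + 2 * L := Real.sq_sqrt (by positivity)
  have hF0 : 0 ≤ ∫ s in (0 : ℝ)..δ, ‖F s‖ :=
    intervalIntegral.integral_nonneg h0 fun s _ => norm_nonneg _
  have hd0 : 0 ≤ d := (add_nonneg (norm_nonneg _) hF0).trans hd
  have hsup : ∀ t ∈ Icc 0 δ, ‖mild W y₀ F t‖ ≤ d := fun t ht => by
    refine (hW.norm_mild_le y₀ ht.1 (intervalIntegrable_initial hF ht)).trans (le_trans ?_ hd)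
    gcongr
    exact intervalIntegral.integral_mono_interval le_rfl ht.1 ht.2
      (Eventually.of_forall fun s => norm_nonneg _) hF.norm
  have hV : ∀ᵐ t ∂(volume.restrict (Ioc 0 δ)), ‖volterra L (g t)‖ ≤ d := by
    filter_upwards [hyg, ae_restrict_mem measurableSet_Ioc] with t ht htm
    rw [← ht]
    exact hsup t (Ioc_subset_Icc_self htm)
  have hsol := isResolventSolution_mild (isMaxDissipative_operatorGraph L) hW hA h0 y₀ hF
  obtain ⟨g', -, hg', hE⟩ := exists_deriv_of_resolventSolution h0 hsol
  have hgg : ∫ s in Ioc 0 δ, ‖g s‖ ^ 2 = ∫ s in (0 : ℝ)..δ, ‖g' s‖ ^ 2 := by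
    rw [intervalIntegral.integral_of_le h0]
    refine integral_congr_ae ?_
    filter_upwards [hyg, hg'] with t e1 e2
    rw [volterra_injective (e1.symm.trans e2.1)]
  have hδm := right_mem_Icc.2 h0
  have hgd : ∫ s in Ioc 0 δ, ‖g s‖ ^ 2 ≤ (κ * d) ^ 2 := by
    have e := hE δ hδm
    rw [← hgg] at e
    have hcu : ContinuousOn (mild W y₀ F) (uIcc 0 δ) := by
      rw [uIcc_of_le h0]; exact hsol.continuousOn
    have hy0 : ‖y₀‖ ≤ d := by linarith
    have e1 : inner ℝ (mulX L y₀) y₀ ≤ L * d ^ 2 := by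
      refine (real_inner_le_norm _ _).trans ?_
      calc _ ≤ (L * ‖y₀‖) * ‖y₀‖ := by gcongr; exact norm_mulX_le _
        _ ≤ (L * d) * d := by gcongr
        _ = _ := by ring
    have e2 : ∫ s in (0 : ℝ)..δ, ‖mild W y₀ F s‖ ^ 2 ≤ d ^ 2 := by
      calc _ ≤ ∫ s in (0 : ℝ)..δ, d ^ 2 := by
            refine intervalIntegral.integral_mono_on h0 (hcu.norm.pow 2).intervalIntegrable
              intervalIntegrable_const fun s hs => ?_
            have := hsup s hs
            gcongr
        _ = δ * d ^ 2 := by simp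
        _ ≤ 1 * d ^ 2 := by gcongr
        _ = _ := one_mul _
    have e3 : ∫ s in (0 : ℝ)..δ, inner ℝ (mulX L (mild W y₀ F s)) (F s) ≤ L * d ^ 2 := by
      calc _ ≤ ∫ s in (0 : ℝ)..δ, (L * d) * ‖F s‖ := by
            refine intervalIntegral.integral_mono_on h0 (intervalIntegrable_inner h0
              ((mulX L).continuous.comp_continuousOn hsol.continuousOn) hF)
              (hF.norm.const_mul _) fun s hs => ?_
            refine (real_inner_le_norm _ _).trans ?_
            gcongr
            exact (norm_mulX_le _).trans (by gcongr; exact hsup s hs)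
        _ = L * d * ∫ s in (0 : ℝ)..δ, ‖F s‖ := intervalIntegral.integral_const_mul _ _
        _ ≤ L * d * d := by gcongr; linarith [norm_nonneg y₀]
        _ = _ := by ring
    -- The bounds add up to `(3/2)∫‖g‖² ≤ (1 + 3L) d²`, and `2/3 + 2L ≤ 1 + 2L`.
    rw [mul_pow, hκ2]
    nlinarith [sq_nonneg d]
  refine ⟨hV, hgd, ?_⟩
  have hgn : MemLp (fun s => ‖g s‖) 2 (volume.restrict (Ioc 0 δ)) := hg.norm
  have hgi : Integrable (fun s => ‖g s‖) (volume.restrict (Ioc 0 δ)) := hgn.integrable one_le_two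
  have hVm : MemLp (fun s => ‖volterraTop L (g s)‖) 2 (volume.restrict (Ioc 0 δ)) :=
    ((volterraTop L).comp_memLp' hg).norm
  have hcs : ∫ s in Ioc 0 δ, ‖g s‖ ≤ (κ * d) * √δ := by
    have := integral_mul_le_sqrt_mul_sqrt hgn (memLp_const (1 : ℝ))
    simp only [mul_one, one_pow, integral_const, smul_eq_mul] at this
    refine this.trans ?_
    have e : (volume.restrict (Ioc 0 δ)).real univ = δ := by
      simp [measureReal_def, h0]
    rw [e]
    gcongr
    exact Real.sqrt_le_iff.2 ⟨by positivity, hgd⟩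
  -- The gain in `δ`: by Agmon only one power of `‖g‖` is integrated, and Cauchy–Schwarz in time
  -- yields the factor `√δ`.
  calc ∫ s in Ioc 0 δ, ‖volterraTop L (g s)‖ ^ 2 ≤ ∫ s in Ioc 0 δ, (2 * d) * ‖g s‖ := by
        refine integral_mono_ae hVm.integrable_sq (hgi.const_mul _) ?_
        filter_upwards [hV] with s hs
        refine (norm_volterraTop_sq_le (g s)).trans ?_
        gcongr
    _ = 2 * d * ∫ s in Ioc 0 δ, ‖g s‖ := integral_const_mul _ _
    _ ≤ 2 * d * ((κ * d) * √δ) := by gcongr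
    _ = _ := by
        rw [mul_pow, Real.sq_sqrt (by positivity)]
        ring

lemma integrable_nonlinearity (hΦ : IsDamping L K Φ) {δ : ℝ} {g : ℝ → L2 L}
    (hg : MemLp g 2 (volume.restrict (Ioc 0 δ))) :
    Integrable (fun t => nonlinearity Φ (g t)) (volume.restrict (Ioc 0 δ)) := by
  have hgi : Integrable (fun s => ‖volterra L (g s)‖) (volume.restrict (Ioc 0 δ)) :=
    (((volterra L).comp_memLp' hg).integrable one_le_two).norm
  have hg2 : Integrable (fun s => ‖g s‖ ^ 2) (volume.restrict (Ioc 0 δ)) := hg.norm.integrable_sq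
  refine Integrable.mono' ((hg2.const_mul √L).add (hgi.const_mul K))
    ((continuous_nonlinearity hΦ).comp_aestronglyMeasurable hg.aestronglyMeasurable)
    (Eventually.of_forall fun t => ?_)
  have h := norm_nonlinearity_sub_le hΦ (g t) 0
  rw [nonlinearity_zero hΦ] at h
  simp only [sub_zero, map_zero, norm_zero, zero_mul, add_zero] at h
  refine h.trans ?_
  have := norm_volterraTop_le (g t)
  have h2 : ‖volterraTop L (g t)‖ * ‖g t‖ ≤ √L * ‖g t‖ * ‖g t‖ := by gcongr
  change _ ≤ √L * ‖g t‖ ^ 2 + K * ‖volterra L (g t)‖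
  rw [sq, ← mul_assoc]
  linarith

/-- The nonlinearity is a contraction on short time intervals. -/
lemma integral_nonlinearity_sub_le (hΦ : IsDamping L K Φ) (hW : IsContractionSemigroup W)
    (hA : IsGenerator (OperatorGraph L) W) {δ R d : ℝ} (h0 : 0 ≤ δ) (h1 : δ ≤ 1)
    {y₀ z₀ : L2 L} {F F' g g' : ℝ → L2 L}
    (hF : IntervalIntegrable F volume 0 δ) (hF' : IntervalIntegrable F' volume 0 δ)
    (hg : MemLp g 2 (volume.restrict (Ioc 0 δ))) (hg' : MemLp g' 2 (volume.restrict (Ioc 0 δ)))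
    (hyg : ∀ᵐ t ∂(volume.restrict (Ioc 0 δ)), mild W y₀ F t = volterra L (g t))
    (hzg : ∀ᵐ t ∂(volume.restrict (Ioc 0 δ)), mild W z₀ F' t = volterra L (g' t))
    (hR : ‖y₀‖ + ∫ s in (0 : ℝ)..δ, ‖F s‖ ≤ R) (hR' : ‖z₀‖ + ∫ s in (0 : ℝ)..δ, ‖F' s‖ ≤ R)
    (hd : ‖y₀ - z₀‖ + ∫ s in (0 : ℝ)..δ, ‖F s - F' s‖ ≤ d) :
    ∫ s in Ioc 0 δ, ‖nonlinearity Φ (g s) - nonlinearity Φ (g' s)‖ ≤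
      (2 * √(2 * √(1 + 2 * L) * √δ) * √(1 + 2 * L) * R + K * δ) * d := by
  have hL : (0 : ℝ) < L := Fact.out
  have hK := hΦ.nonneg
  set κ := √(1 + 2 * L)
  set ε := √(2 * κ * √δ)
  have hgw : MemLp (fun s => g s - g' s) 2 (volume.restrict (Ioc 0 δ)) := hg.sub hg'
  have hwg : ∀ᵐ t ∂(volume.restrict (Ioc 0 δ)),
      mild W (y₀ - z₀) (fun s => F s - F' s) t = volterra L (g t - g' t) := by
    filter_upwards [hyg, hzg, ae_restrict_mem measurableSet_Ioc] with t e1 e2 ht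
    have ht' := Ioc_subset_Icc_self ht
    rw [hW.mild_sub y₀ z₀ ht'.1 (intervalIntegrable_initial hF ht')
      (intervalIntegrable_initial hF' ht'), e1, e2, map_sub]
  have hI0 : ∀ f : ℝ → L2 L, 0 ≤ ∫ s in (0 : ℝ)..δ, ‖f s‖ := fun f =>
    intervalIntegral.integral_nonneg h0 fun s _ => norm_nonneg _
  have hR0 : 0 ≤ R := (add_nonneg (norm_nonneg _) (hI0 _)).trans hR
  have hd0 : 0 ≤ d := (add_nonneg (norm_nonneg _) (hI0 _)).trans hd
  obtain ⟨-, a2, -⟩ := mild_estimates hW hA h0 h1 hF hg hyg hR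
  obtain ⟨-, -, b3⟩ := mild_estimates hW hA h0 h1 hF' hg' hzg hR'
  obtain ⟨c1, c2, c3⟩ := mild_estimates hW hA h0 h1 (hF.sub hF') hgw hwg hd
  have n1 : MemLp (fun s => ‖g s‖) 2 (volume.restrict (Ioc 0 δ)) := hg.norm
  have n2 : MemLp (fun s => ‖g s - g' s‖) 2 (volume.restrict (Ioc 0 δ)) := hgw.norm
  have n3 : MemLp (fun s => ‖volterraTop L (g s - g' s)‖) 2 (volume.restrict (Ioc 0 δ)) :=
    ((volterraTop L).comp_memLp' hgw).norm
  have n4 : MemLp (fun s => ‖volterraTop L (g' s)‖) 2 (volume.restrict (Ioc 0 δ)) :=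
    ((volterraTop L).comp_memLp' hg').norm
  have i1 : Integrable (fun s => ‖volterraTop L (g s - g' s)‖ * ‖g s‖)
      (volume.restrict (Ioc 0 δ)) := n3.integrable_mul n1
  have i2 : Integrable (fun s => ‖volterraTop L (g' s)‖ * ‖g s - g' s‖)
      (volume.restrict (Ioc 0 δ)) := n4.integrable_mul n2
  have i12 : Integrable (fun s => ‖volterraTop L (g s - g' s)‖ * ‖g s‖ +
      ‖volterraTop L (g' s)‖ * ‖g s - g' s‖) (volume.restrict (Ioc 0 δ)) := i1.add i2
  have hN : Integrable (fun s => ‖nonlinearity Φ (g s) - nonlinearity Φ (g' s)‖)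
      (volume.restrict (Ioc 0 δ)) :=
    ((integrable_nonlinearity hΦ hg).sub (integrable_nonlinearity hΦ hg')).norm
  have sq_le : ∀ {A b : ℝ}, 0 ≤ b → A ≤ b ^ 2 → √A ≤ b := fun hb h =>
    Real.sqrt_le_iff.2 ⟨hb, h⟩
  have hκ0 : 0 ≤ κ := Real.sqrt_nonneg _
  have hε0 : 0 ≤ ε := Real.sqrt_nonneg _
  have j1 : ∫ s in Ioc 0 δ, ‖volterraTop L (g s - g' s)‖ * ‖g s‖ ≤ (ε * d) * (κ * R) :=
    (integral_mul_le_sqrt_mul_sqrt n3 n1).trans (by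
      gcongr
      · exact sq_le (by positivity) c3
      · exact sq_le (by positivity) a2)
  have j2 : ∫ s in Ioc 0 δ, ‖volterraTop L (g' s)‖ * ‖g s - g' s‖ ≤ (ε * R) * (κ * d) :=
    (integral_mul_le_sqrt_mul_sqrt n4 n2).trans (by
      gcongr
      · exact sq_le (by positivity) b3
      · exact sq_le (by positivity) c2)
  calc _ ≤ ∫ s in Ioc 0 δ, (‖volterraTop L (g s - g' s)‖ * ‖g s‖ +
        ‖volterraTop L (g' s)‖ * ‖g s - g' s‖ + K * d) := by
        refine integral_mono_ae hN (i12.add (integrable_const _)) ?_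
        filter_upwards [c1] with s hs
        refine (norm_nonlinearity_sub_le hΦ (g s) (g' s)).trans ?_
        gcongr
    _ = (∫ s in Ioc 0 δ, ‖volterraTop L (g s - g' s)‖ * ‖g s‖) +
        (∫ s in Ioc 0 δ, ‖volterraTop L (g' s)‖ * ‖g s - g' s‖) + δ * (K * d) := by
        have e : (volume.restrict (Ioc 0 δ)).real univ = δ := by
          simp [measureReal_def, h0]
        rw [integral_add i12 (integrable_const _), integral_add i1 i2, integral_const, e,
          smul_eq_mul]
    _ ≤ (ε * d) * (κ * R) + (ε * R) * (κ * d) + δ * (K * d) := by gcongr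
    _ = _ := by ring

/-- `F` is the forcing term of a solution of the nonlinear equation on `[0, T]`. -/
def IsNonlinearForcing (W : ℝ → L2 L →L[ℝ] L2 L) (Φ : L2 L → L2 L) (T : ℝ) (y₀ : L2 L)
    (F : ℝ → L2 L) : Prop :=
  IntervalIntegrable F volume 0 T ∧ ∀ᵐ t ∂(volume.restrict (Ioc 0 T)),
    ∃ g, mild W y₀ F t = volterra L g ∧ inner ℝ g (one L) = 0 ∧ F t = -nonlinearity Φ g

/-- Local existence, on a time interval that depends only on the size of the initial value. -/
theorem exists_local_forcing (hΦ : IsDamping L K Φ) (hW : IsContractionSemigroup W)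
    (hA : IsGenerator (OperatorGraph L) W) {R : ℝ} (hR : 0 ≤ R) :
    ∃ δ > 0, ∀ y₀ : L2 L, ‖y₀‖ ≤ R → ∃ F, IsNonlinearForcing W Φ δ y₀ F := by
  have hL : (0 : ℝ) < L := Fact.out
  set θ : ℝ → ℝ := fun δ =>
    2 * √(2 * √(1 + 2 * L) * √δ) * √(1 + 2 * L) * (R + 1) + K * δ with hθ
  have hθc : Continuous θ := by fun_prop
  have hθ0 : θ 0 = 0 := by simp [hθ]
  -- `θ` is the Lipschitz constant for data of total size `R + 1`. The threshold `1/(R + 2)` gives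
  -- both `θ (R + 1) ≤ 1`, so the unit ball is preserved, and `θ ≤ 1/2`.
  have hev : ∀ᶠ δ in 𝓝[>] (0 : ℝ), θ δ < 1 / (R + 2) := by
    refine (hθc.tendsto 0).mono_left nhdsWithin_le_nhds |>.eventually (gt_mem_nhds ?_)
    rw [hθ0]; positivity
  obtain ⟨δ, hδθ, hδ⟩ := (hev.and (Ioc_mem_nhdsGT one_pos)).exists
  have h0 := hδ.1.le
  have hK := hΦ.nonneg
  have hθn : 0 ≤ θ δ := by positivity
  refine ⟨δ, hδ.1, fun y₀ hy₀ => ?_⟩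
  have hFi : ∀ f : Lp (L2 L) 1 (volume.restrict (Ioc 0 δ)), IntervalIntegrable f volume 0 δ :=
    fun f => by
      rw [intervalIntegrable_iff_integrableOn_Ioc_of_le h0]
      exact L1.integrable_coeFn f
  choose g hg hgy _ using fun f : Lp (L2 L) 1 (volume.restrict (Ioc 0 δ)) =>
    exists_deriv_of_resolventSolution h0
      (isResolventSolution_mild (isMaxDissipative_operatorGraph L) hW hA h0 y₀ (hFi f))
  have hgV : ∀ f : Lp (L2 L) 1 (volume.restrict (Ioc 0 δ)),
      ∀ᵐ t ∂(volume.restrict (Ioc 0 δ)), mild W y₀ f t = volterra L (g f t) :=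
    fun f => (hgy f).mono fun t ht => ht.1
  have hm : ∀ f, MemLp (fun t => -nonlinearity Φ (g f t)) 1 (volume.restrict (Ioc 0 δ)) := fun f =>
    memLp_one_iff_integrable.2 (integrable_nonlinearity hΦ (hg f)).neg
  -- The iteration runs on `f ∈ L¹(0, δ; L²)`: solve the linear problem with forcing `f`, take its
  -- space derivative, and return minus the nonlinearity.
  let S : Lp (L2 L) 1 (volume.restrict (Ioc 0 δ)) → Lp (L2 L) 1 (volume.restrict (Ioc 0 δ)) :=
    fun f => (hm f).toLp
  have hS : ∀ f, S f =ᵐ[volume.restrict (Ioc 0 δ)] fun t => -nonlinearity Φ (g f t) := fun f =>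
    (hm f).coeFn_toLp
  have hnorm : ∀ f : Lp (L2 L) 1 (volume.restrict (Ioc 0 δ)),
      ∫ s in (0 : ℝ)..δ, ‖f s‖ = ‖f‖ := fun f => by
    rw [L1.norm_eq_integral_norm, intervalIntegral.integral_of_le h0]
  have hball : ∀ f ∈ Metric.closedBall (0 : Lp (L2 L) 1 (volume.restrict (Ioc 0 δ))) 1,
      ‖y₀‖ + ∫ s in (0 : ℝ)..δ, ‖f s‖ ≤ R + 1 := fun f hf => by
    rw [hnorm]
    rw [mem_closedBall_zero_iff] at hf
    linarith
  have hθ1 : θ δ * (R + 1) ≤ 1 := by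
    calc θ δ * (R + 1) ≤ 1 / (R + 2) * (R + 2) := by gcongr; linarith
      _ = 1 := by field_simp
  have hθ2 : θ δ ≤ 1 / 2 := hδθ.le.trans (by gcongr; linarith)
  have hmaps : MapsTo S (Metric.closedBall 0 1) (Metric.closedBall 0 1) := fun f hf => by
    have hz : ∀ t, mild W (0 : L2 L) (fun _ => 0) t = 0 := fun t => by simp [mild]
    -- Comparison with the zero solution turns the Lipschitz estimate into a bound on `S f`.
    have h := integral_nonlinearity_sub_le (d := R + 1) hΦ hW hA h0 hδ.2 (hFi f)
      (intervalIntegrable_const (c := (0 : L2 L))) (hg f) (g' := fun _ => 0) MemLp.zero' (hgV f)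
      (Eventually.of_forall fun t => by rw [hz, map_zero]) (hball f hf)
      (z₀ := 0) (by simp; linarith) (by simpa using hball f hf)
    rw [mem_closedBall_zero_iff, L1.norm_eq_integral_norm]
    refine le_trans (le_of_eq ?_) (h.trans hθ1)
    refine integral_congr_ae ?_
    filter_upwards [hS f] with s hs
    rw [hs, norm_neg, nonlinearity_zero hΦ, sub_zero]
  have hlip : ∀ f ∈ Metric.closedBall (0 : Lp (L2 L) 1 (volume.restrict (Ioc 0 δ))) 1,
      ∀ f' ∈ Metric.closedBall (0 : Lp (L2 L) 1 (volume.restrict (Ioc 0 δ))) 1,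
      dist (S f) (S f') ≤ 1 / 2 * dist f f' := fun f hf f' hf' => by
    have h := integral_nonlinearity_sub_le (d := dist f f') hΦ hW hA h0 hδ.2 (hFi f) (hFi f')
      (hg f) (hg f') (hgV f) (hgV f') (hball f hf) (hball f' hf') (by
        rw [sub_self, norm_zero, zero_add, dist_eq_norm, ← hnorm]
        refine le_of_eq ?_
        rw [intervalIntegral.integral_of_le h0, intervalIntegral.integral_of_le h0]
        refine integral_congr_ae ?_
        filter_upwards [Lp.coeFn_sub f f'] with s hs
        rw [hs, Pi.sub_apply])
    rw [dist_eq_norm, L1.norm_eq_integral_norm]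
    refine le_trans (le_of_eq ?_) (h.trans (by gcongr))
    refine integral_congr_ae ?_
    filter_upwards [Lp.coeFn_sub (S f) (S f'), hS f, hS f'] with s e1 e2 e3
    rw [e1, Pi.sub_apply, e2, e3, neg_sub_neg, norm_sub_rev]
  have hcontr : ContractingWith (1 / 2) (hmaps.restrict S _ _) := by
    refine ⟨by norm_num, LipschitzWith.of_dist_le_mul fun f f' => ?_⟩
    have := hlip f.1 f.2 f'.1 f'.2
    simpa [Subtype.dist_eq] using this
  obtain ⟨f, -, hfix, -⟩ := hcontr.exists_fixedPoint' Metric.isClosed_closedBall.isComplete hmaps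
    (x := 0) (by simp) (edist_ne_top _ _)
  refine ⟨f, hFi f, ?_⟩
  have hfe := hS f
  rw [hfix.eq] at hfe
  filter_upwards [hfe, hgy f] with t e1 e2
  exact ⟨g f t, e2.1, e2.2, e1⟩

end KdV
end

/-! ### Concatenation of solutions and global existence. -/

noncomputable section

lemma mild_congr {X : Type*} [NormedAddCommGroup X] [InnerProductSpace ℝ X] (W : ℝ → X →L[ℝ] X)
    (y₀ : X) {F F' : ℝ → X} {t : ℝ} (ht : 0 ≤ t)
    (h : ∀ᵐ s ∂(volume.restrict (Ioc 0 t)), F s = F' s) :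
    mild W y₀ F t = mild W y₀ F' t := by
  unfold mild
  rw [intervalIntegral.integral_of_le ht, intervalIntegral.integral_of_le ht]
  congr 1
  refine integral_congr_ae ?_
  filter_upwards [h] with s hs
  rw [hs]

namespace KdV

variable {L K : ℝ} [Fact (0 < L)] {Φ : L2 L → L2 L} {W : ℝ → L2 L →L[ℝ] L2 L}

namespace IsNonlinearForcing

lemma mono {S T : ℝ} {y₀ : L2 L} {F : ℝ → L2 L} (hF : IsNonlinearForcing W Φ T y₀ F) (h0 : 0 ≤ S)
    (hST : S ≤ T) : IsNonlinearForcing W Φ S y₀ F :=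
  ⟨intervalIntegrable_initial hF.1 ⟨h0, hST⟩,
    ae_restrict_of_ae_restrict_of_subset (Ioc_subset_Ioc_right hST) hF.2⟩

lemma norm_le (hΦ : IsDamping L K Φ) (hW : IsContractionSemigroup W)
    (hA : IsGenerator (OperatorGraph L) W) {T : ℝ} (hT : 0 ≤ T) {y₀ : L2 L} {F : ℝ → L2 L}
    (hF : IsNonlinearForcing W Φ T y₀ F) : ‖mild W y₀ F T‖ ≤ ‖y₀‖ :=
  norm_le_of_nonlinear hΦ
    (isResolventSolution_mild (isMaxDissipative_operatorGraph L) hW hA hT y₀ hF.1) hF.2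
    (right_mem_Icc.2 hT)

/-- Concatenation of solutions. -/
lemma append (hW : IsContractionSemigroup W) {S T : ℝ} (hS : 0 ≤ S) (hT : 0 ≤ T) {y₀ : L2 L}
    {F F' : ℝ → L2 L} (hF : IsNonlinearForcing W Φ S y₀ F)
    (hF' : IsNonlinearForcing W Φ T (mild W y₀ F S) F') :
    IsNonlinearForcing W Φ (S + T) y₀ fun t => if t ≤ S then F t else F' (t - S) := by
  set H : ℝ → L2 L := fun t => if t ≤ S then F t else F' (t - S) with hH
  have e1 : ∀ t ∈ Ioc 0 S, H t = F t := fun t ht => if_pos ht.2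
  have e2 : ∀ t, 0 < t → H (S + t) = F' t := fun t ht => by
    rw [hH]
    simp only
    rw [if_neg (by linarith), add_sub_cancel_left]
  have hST : S ≤ S + T := by linarith
  have i1 : IntervalIntegrable H volume 0 S := by
    refine hF.1.congr ?_
    rw [uIoc_of_le hS]
    exact fun t ht => (e1 t ht).symm
  have i2 : IntervalIntegrable H volume S (S + T) := by
    have h := hF'.1.comp_sub_right S
    rw [zero_add, add_comm T S] at h
    refine h.congr ?_
    rw [uIoc_of_le hST]
    intro t ht
    rw [hH]
    simp only
    rw [if_neg (not_le.2 ht.1)]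
  have i := i1.trans i2
  have m1 : ∀ t ∈ Icc 0 S, mild W y₀ H t = mild W y₀ F t := fun t ht =>
    mild_congr W y₀ ht.1 <| (ae_restrict_mem measurableSet_Ioc).mono fun s hs =>
      e1 s ⟨hs.1, hs.2.trans ht.2⟩
  have m2 : ∀ t ∈ Icc 0 T, mild W y₀ H (S + t) = mild W (mild W y₀ F S) F' t := fun t ht => by
    rw [hW.mild_add y₀ hS ht.1 (intervalIntegrable_initial i ⟨by linarith [ht.1], by
      linarith [ht.2]⟩), m1 S (right_mem_Icc.2 hS)]
    exact mild_congr W _ ht.1 <| (ae_restrict_mem measurableSet_Ioc).mono fun s hs => e2 s hs.1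
  refine ⟨i, ?_⟩
  rw [← Ioc_union_Ioc_eq_Ioc hS hST]
  refine ae_restrict_union_iff _ _ _ |>.2 ⟨?_, ?_⟩
  · filter_upwards [hF.2, ae_restrict_mem measurableSet_Ioc] with t ht htm
    rw [m1 t (Ioc_subset_Icc_self htm), e1 t htm]
    exact ht
  · rw [ae_restrict_iff' measurableSet_Ioc]
    have h := (measurePreserving_sub_right volume S).quasiMeasurePreserving.ae
      ((ae_restrict_iff' measurableSet_Ioc).1 hF'.2)
    filter_upwards [h] with t ht htm
    have htm' : t - S ∈ Ioc 0 T := ⟨by linarith [htm.1], by linarith [htm.2]⟩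
    have et : t = S + (t - S) := by ring
    rw [et, m2 _ (Ioc_subset_Icc_self htm'), e2 _ htm'.1]
    exact ht htm'

end IsNonlinearForcing

/-- Global existence for the nonlinear equation. -/
theorem exists_forcing (hΦ : IsDamping L K Φ) (hW : IsContractionSemigroup W)
    (hA : IsGenerator (OperatorGraph L) W) {T : ℝ} (hT : 0 ≤ T) (y₀ : L2 L) :
    ∃ F, IsNonlinearForcing W Φ T y₀ F := by
  obtain ⟨δ, hδ, hloc⟩ := exists_local_forcing hΦ hW hA (norm_nonneg y₀)
  have hglob : ∀ n : ℕ, ∃ F, IsNonlinearForcing W Φ (n * δ) y₀ F := fun n => by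
    induction n with
    | zero => exact ⟨0, by simp [IsNonlinearForcing]⟩
    | succ n ih =>
      obtain ⟨F, hF⟩ := ih
      have hn : 0 ≤ n * δ := by positivity
      -- The norm at time `n δ` is at most `‖y₀‖`, so the same step length `δ` serves again.
      obtain ⟨F', hF'⟩ := hloc _ (hF.norm_le hΦ hW hA hn)
      rw [Nat.cast_succ, add_one_mul]
      exact ⟨_, hF.append hW hn hδ.le hF'⟩
  obtain ⟨n, hn⟩ := exists_nat_ge (T / δ)
  obtain ⟨F, hF⟩ := hglob n
  exact ⟨F, hF.mono hT ((div_le_iff₀ hδ).1 hn)⟩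

end KdV
end

/-! ### The two saturations as Lipschitz dampings. -/

noncomputable section
namespace KdV

variable {L : ℝ}

/-- The defining properties of the projection on a ball. -/
lemma satTwo_spec {u₀ : ℝ} (hu : 0 < u₀) (s : L2 L) :
    ∃ c, 0 ≤ c ∧ s = (1 + c) • satTwo L u₀ s ∧ ‖satTwo L u₀ s‖ ≤ u₀ ∧
      c * ‖satTwo L u₀ s‖ ^ 2 = c * u₀ ^ 2 := by
  unfold satTwo
  split_ifs with h
  · exact ⟨0, le_rfl, by simp, h, by simp⟩
  · have h' := not_le.1 h
    have hs : 0 < ‖s‖ := hu.trans h'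
    have hn : ‖(u₀ / ‖s‖) • s‖ = u₀ := by
      rw [norm_smul, Real.norm_of_nonneg (by positivity), div_mul_cancel₀ _ hs.ne']
    refine ⟨‖s‖ / u₀ - 1, ?_, ?_, hn.le, by rw [hn]⟩
    · rw [sub_nonneg, le_div_iff₀ hu]; linarith
    · rw [smul_smul, add_sub_cancel, div_mul_div_cancel₀ hu.ne', div_self hs.ne', one_smul]

/-- Projections are firmly nonexpansive: with `s = (1 + c) p` and `t = (1 + d) q`, the
complementarity relations make `⟨c p - d q, p - q⟩ ≥ 0`, so `‖p - q‖² ≤ ⟨s - t, p - q⟩`. -/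
lemma norm_satTwo_sub_le {u₀ : ℝ} (hu : 0 < u₀) (s t : L2 L) :
    ‖satTwo L u₀ s - satTwo L u₀ t‖ ≤ ‖s - t‖ := by
  obtain ⟨c, hc, es, ns, ks⟩ := satTwo_spec hu s
  obtain ⟨d, hd, et, nt, kt⟩ := satTwo_spec hu t
  set p := satTwo L u₀ s
  set q := satTwo L u₀ t
  have hpq : inner ℝ p q ≤ u₀ ^ 2 := (real_inner_le_norm p q).trans (by
    rw [sq]; gcongr)
  have h1 : ‖p - q‖ ^ 2 ≤ inner ℝ (s - t) (p - q) := by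
    rw [es, et, ← real_inner_self_eq_norm_sq]
    simp only [inner_sub_left, inner_sub_right, inner_smul_left, real_inner_self_eq_norm_sq,
      real_inner_comm p q, RCLike.conj_to_real]
    nlinarith [mul_le_mul_of_nonneg_left hpq hc, mul_le_mul_of_nonneg_left hpq hd]
  have h2 := h1.trans (real_inner_le_norm _ _)
  by_contra! h
  nlinarith [norm_nonneg (s - t)]

/-- A saturation turns a nonnegative gain into a damping. -/
lemma isDamping_satTwo {u₀ : ℝ} (hu : 0 < u₀) {C : ℝ} {b : Lp ℝ ∞ (mu L)} (hC : ‖b‖ ≤ C)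
    (hb : ∀ᵐ x ∂(mu L), 0 ≤ b x) : IsDamping L C fun u => satTwo L u₀ (mulTop L b u) where
  nonneg := (norm_nonneg _).trans hC
  zero := by simp [satTwo]
  lipschitz u v := by
    refine (norm_satTwo_sub_le hu _ _).trans ?_
    rw [← map_sub]
    exact (norm_mulTop_le _ _).trans (by gcongr)
  inner_nonneg u := by
    have h0 : 0 ≤ inner ℝ u (mulTop L b u) := by
      rw [inner_eq_integral]
      refine integral_nonneg_of_ae ?_
      filter_upwards [coeFn_mulTop b u, hb] with x hx hbx
      rw [hx, Pi.zero_apply]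
      nlinarith [mul_nonneg hbx (mul_self_nonneg (u x))]
    obtain ⟨c, hc, e, -, -⟩ := satTwo_spec hu (mulTop L b u)
    rw [e, inner_smul_right] at h0
    exact nonneg_of_mul_nonneg_right h0 (by positivity)

lemma mul_sat_nonneg {u₀ : ℝ} (hu : 0 < u₀) {b : ℝ} (hb : 0 ≤ b) (x : ℝ) :
    0 ≤ x * sat u₀ (b * x) := by
  unfold sat
  split_ifs with h1 h2
  · have : x ≤ 0 := by by_contra! h; nlinarith [mul_nonneg hb h.le]
    nlinarith
  · nlinarith [mul_nonneg hb (mul_self_nonneg x)]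
  · have : 0 ≤ x := by by_contra! h; nlinarith [mul_nonneg hb (neg_nonneg.2 h.le)]
    positivity

lemma isDamping_satLoc {u₀ : ℝ} (hu : 0 < u₀) {C : ℝ} {b : Lp ℝ ∞ (mu L)} (hC : ‖b‖ ≤ C)
    (hb : ∀ᵐ x ∂(mu L), 0 ≤ b x) : IsDamping L C fun u => satLoc L u₀ hu (mulTop L b u) where
  nonneg := (norm_nonneg _).trans hC
  zero := by simp [satLoc]
  lipschitz u v := by
    refine ((sat_lipschitz hu).norm_compLp_sub_le (sat_zero hu) _ _).trans ?_
    rw [← map_sub, NNReal.coe_one, one_mul]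
    exact (norm_mulTop_le _ _).trans (by gcongr)
  inner_nonneg u := by
    rw [inner_eq_integral]
    refine integral_nonneg_of_ae ?_
    filter_upwards [coeFn_mulTop b u, hb,
      (sat_lipschitz hu).coeFn_compLp (sat_zero hu) (mulTop L b u)] with x hx hbx hs
    rw [satLoc, hs, Function.comp_apply, hx]
    exact mul_sat_nonneg hu hbx _

variable {a₀ a₁ : ℝ} {Ω : Set ℝ} {a : ℝ → ℝ}

lemma GainCondition.memLp (ha : GainCondition L a₀ a₁ Ω a) : MemLp a ∞ (mu L) := by
  refine memLp_top_of_bound ha.measurable.aestronglyMeasurable a₁ ?_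
  filter_upwards [mu_Ioo_ae L] with x hx
  have hx := Ioo_subset_Icc_self hx
  rw [Real.norm_of_nonneg (ha.nonneg x hx)]
  exact ha.upper x hx

/-- The saturated feedback is a damping. -/
lemma GainCondition.isDamping (ha : GainCondition L a₀ a₁ Ω a) {u₀ : ℝ} (hu : 0 < u₀)
    {𝔰 : L2 L → L2 L} (h𝔰 : 𝔰 = satLoc L u₀ hu ∨ 𝔰 = satTwo L u₀) :
    IsDamping L ‖ha.memLp.toLp‖ fun u => 𝔰 (mulTop L ha.memLp.toLp u) := by
  have hb : ∀ᵐ x ∂(mu L), 0 ≤ ha.memLp.toLp a x := by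
    filter_upwards [ha.memLp.coeFn_toLp, mu_Ioo_ae L] with x h1 h2
    rw [h1]
    exact ha.nonneg x (Ioo_subset_Icc_self h2)
  rcases h𝔰 with rfl | rfl
  · exact isDamping_satLoc hu le_rfl hb
  · exact isDamping_satTwo hu le_rfl hb

lemma GainCondition.isFeedback_iff (ha : GainCondition L a₀ a₁ Ω a) {𝔰 : L2 L → L2 L}
    {u f : L2 L} : IsFeedback L 𝔰 a u f ↔ f = 𝔰 (mulTop L ha.memLp.toLp u) := by
  have hm : mulTop L ha.memLp.toLp u =ᵐ[mu L] fun x => a x * u x := by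
    filter_upwards [coeFn_mulTop ha.memLp.toLp u, ha.memLp.coeFn_toLp] with x h1 h2
    rw [h1, h2]
  constructor
  · rintro ⟨m, h, rfl⟩
    rw [Lp.ext (h.trans hm.symm)]
  · exact fun h => ⟨_, hm, h⟩

/-- The product `u u_x` in terms of `u_x`. -/
lemma isConvection_volterra_iff [Fact (0 < L)] {g p : L2 L} :
    IsConvection L (volterra L g) p ↔ p = mulTop L (volterraTop L g) g := by
  have hm : mulTop L (volterraTop L g) g =ᵐ[mu L] fun x => volterra L g x * g x := by
    filter_upwards [coeFn_mulTop (volterraTop L g) g, coeFn_volterra g, coeFn_volterraTop g]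
      with x h1 h2 h3
    rw [h1, h2, h3]
  constructor
  · rintro ⟨ux, h, hp⟩
    obtain rfl := h.unique (isWeakDeriv_volterra g)
    exact Lp.ext (hp.trans hm.symm)
  · exact fun h => ⟨g, isWeakDeriv_volterra g, h ▸ hm⟩

end KdV
end

/-! ### Assembly of existence and uniqueness. -/

noncomputable section
namespace KdV

variable {L : ℝ}

lemma IsSemigroupOfA.isContractionSemigroup {W : ℝ → L2 L →L[ℝ] L2 L} (h : IsSemigroupOfA L W) :
    IsContractionSemigroup W :=
  ⟨h.map_zero, h.map_add, h.contraction, h.continuous_at_zero⟩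

lemma IsSemigroupOfA.isGenerator {W : ℝ → L2 L →L[ℝ] L2 L} (h : IsSemigroupOfA L W) :
    IsGenerator (OperatorGraph L) W := h.generator

lemma exists_isSemigroupOfA (L : ℝ) [Fact (0 < L)] : ∃ W, IsSemigroupOfA L W := by
  obtain ⟨W, hW, hA⟩ := (isMaxDissipative_operatorGraph L).exists_semigroup
  exact ⟨W, hW.map_zero, hW.map_add, hW.contraction, hW.continuous_at_zero, hA⟩

/-- The formula of variation of constants with two source terms. -/
lemma sub_conv_eq_mild {W : ℝ → L2 L →L[ℝ] L2 L} (hW : IsContractionSemigroup W) (y₀ : L2 L)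
    {p f : ℝ → L2 L} {t : ℝ} (ht : 0 ≤ t) (hp : IntervalIntegrable p volume 0 t)
    (hf : IntervalIntegrable f volume 0 t) :
    W t y₀ - (∫ τ in (0 : ℝ)..t, W (t - τ) (p τ)) - ∫ τ in (0 : ℝ)..t, W (t - τ) (f τ) =
      mild W y₀ (fun s => -(p s + f s)) t := by
  unfold mild
  simp only [map_neg, map_add]
  rw [intervalIntegral.integral_neg, intervalIntegral.integral_add
    (hW.intervalIntegrable_conv ht hp) (hW.intervalIntegrable_conv ht hf)]
  abel

end KdV
end

theorem theorem1 (L : ℝ) (hL : 0 < L) (T : ℝ) (hT : 0 < T)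
    (a₀ a₁ : ℝ) (Ω : Set ℝ) (a : ℝ → ℝ) (ha : KdV.GainCondition L a₀ a₁ Ω a)
    (u₀ : ℝ) (hu : 0 < u₀) (𝔰 : KdV.L2 L → KdV.L2 L)
    (h𝔰 : 𝔰 = KdV.satLoc L u₀ hu ∨ 𝔰 = KdV.satTwo L u₀) (y₀ : KdV.L2 L) :
    ∃ y : ℝ → KdV.L2 L,
      (KdV.MemB L T y ∧ KdV.IsMildSolution L T 𝔰 a y₀ y) ∧
      ∀ z : ℝ → KdV.L2 L, KdV.MemB L T z → KdV.IsMildSolution L T 𝔰 a y₀ z →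
        EqOn z y (Icc 0 T) := by
  have : Fact (0 < L) := ⟨hL⟩
  have hΦ := ha.isDamping hu h𝔰
  set Φ : KdV.L2 L → KdV.L2 L := fun u => 𝔰 (KdV.mulTop L ha.memLp.toLp u)
  obtain ⟨W, hWA⟩ := KdV.exists_isSemigroupOfA L
  have hW := hWA.isContractionSemigroup
  obtain ⟨F, hFi, hF⟩ := KdV.exists_forcing hΦ hW hWA.isGenerator hT.le y₀
  have hG := KdV.isMaxDissipative_operatorGraph L
  have hy := isResolventSolution_mild hG hW hWA.isGenerator hT.le y₀ hFi
  have hyF : ∀ᵐ t ∂(volume.restrict (Ioc 0 T)), ∃ g, mild W y₀ F t = KdV.volterra L g ∧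
      F t = -KdV.nonlinearity Φ g := hF.mono fun t ⟨g, h1, _, h2⟩ => ⟨g, h1, h2⟩
  obtain ⟨g, hg, hgy, -⟩ := KdV.exists_deriv_of_resolventSolution hT.le hy
  refine ⟨mild W y₀ F, ⟨⟨hy.continuousOn, ?_, g, ?_, ?_⟩, ?_⟩, ?_⟩
  · rw [restrict_Ioo_eq_restrict_Ioc]
    refine ((KdV.volterra L).comp_memLp' hg).ae_eq ?_
    filter_upwards [hgy] with t ht
    exact ht.1.symm
  · rwa [restrict_Ioo_eq_restrict_Ioc]
  · rw [restrict_Ioo_eq_restrict_Ioc]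
    filter_upwards [hgy] with t ht
    rw [ht.1]
    exact KdV.isWeakDeriv_volterra _
  · have hf : Integrable (fun t => Φ (KdV.volterra L (g t))) (volume.restrict (Ioc 0 T)) := by
      refine (((KdV.volterra L).comp_memLp' hg).integrable one_le_two).norm.const_mul
        ‖ha.memLp.toLp‖ |>.mono' (hΦ.continuous.comp_aestronglyMeasurable
          ((KdV.volterra L).continuous.comp_aestronglyMeasurable hg.aestronglyMeasurable))
        (Eventually.of_forall fun t => ?_)
      have := hΦ.lipschitz (KdV.volterra L (g t)) 0
      rwa [hΦ.zero, sub_zero, sub_zero] at this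
    have hp : Integrable (fun t => KdV.mulTop L (KdV.volterraTop L (g t)) (g t))
        (volume.restrict (Ioc 0 T)) := by
      refine ((KdV.integrable_nonlinearity hΦ hg).sub hf).congr (Eventually.of_forall fun t => ?_)
      simp [KdV.nonlinearity]
    refine ⟨W, hWA, fun t => KdV.mulTop L (KdV.volterraTop L (g t)) (g t),
      fun t => Φ (KdV.volterra L (g t)), ?_, ?_, ?_, ?_, fun t ht => ?_⟩
    · rwa [← integrableOn_Ioc_iff_integrableOn_Ioo]
    · rwa [← integrableOn_Ioc_iff_integrableOn_Ioo]
    · rw [restrict_Ioo_eq_restrict_Ioc]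
      filter_upwards [hgy] with t ht
      rw [ht.1]
      exact KdV.isConvection_volterra_iff.2 rfl
    · rw [restrict_Ioo_eq_restrict_Ioc]
      filter_upwards [hgy] with t ht
      rw [ht.1]
      exact ha.isFeedback_iff.2 rfl
    · rw [KdV.sub_conv_eq_mild hW y₀ ht.1
        (intervalIntegrable_initial ((intervalIntegrable_iff_integrableOn_Ioc_of_le hT.le).2 hp) ht)
        (intervalIntegrable_initial
          ((intervalIntegrable_iff_integrableOn_Ioc_of_le hT.le).2 hf) ht)]
      refine mild_congr W y₀ ht.1
        (ae_restrict_of_ae_restrict_of_subset (Ioc_subset_Ioc_right ht.2) ?_)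
      filter_upwards [hgy, hyF] with s e1 ⟨g', e2, e3⟩
      rw [e3, KdV.volterra_injective (e2.symm.trans e1.1)]
      rfl
  · rintro z - ⟨W', hWA', p, f, hp, hf, hzp, hzf, hz⟩
    rw [← integrableOn_Ioc_iff_integrableOn_Ioo,
      ← intervalIntegrable_iff_integrableOn_Ioc_of_le hT.le] at hp hf
    rw [restrict_Ioo_eq_restrict_Ioc] at hzp hzf
    have hW' := hWA'.isContractionSemigroup
    -- The competitor `z` may come with another semigroup `W'`. The resolvent formulation depends
    -- only on the graph of `A`, so both solutions can be compared without identifying `W'` with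
    -- `W`.
    have hzm : IsResolventSolution hG T y₀ (fun s => -(p s + f s)) z :=
      (isResolventSolution_mild hG hW' hWA'.isGenerator hT.le y₀ (hp.add hf).neg).congr
        fun t ht => by
          rw [hz t ht]
          exact KdV.sub_conv_eq_mild hW' y₀ ht.1 (intervalIntegrable_initial hp ht)
            (intervalIntegrable_initial hf ht)
    obtain ⟨g', -, hg', -⟩ := KdV.exists_deriv_of_resolventSolution hT.le hzm
    refine KdV.eqOn_of_nonlinear hΦ hT.le hy hzm hyF ?_
    filter_upwards [hzp, hzf, hg'] with t e1 e2 e3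
    rw [e3.1] at e1 e2
    refine ⟨g' t, e3.1, ?_⟩
    rw [KdV.isConvection_volterra_iff.1 e1, ha.isFeedback_iff.1 e2]
    rfl
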